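/- Let $K$ be an algebraically closed field, let $S=K[x_1,\dots,x_n]$ be the polynomial ring and $S_2$ its space of quadrics (homogeneous elements of degree $2$), of dimension $\binom{n+1}{2}$. For a subspace $V\subseteq S_2$ of codimension $c$ let $R_V=S/(V)$, where $(V)$ is the ideal of $S$ generated by $V$. The algebra $R_V$ is called G-quadratic if, for some system of coordinates of $S$ (a basis of the space $S_1$ of linear forms) and some term order on the monomials in these coordinates, the ideal $(V)$ has a Gröbner basis that consists of quadrics. (1) If $c<n$, then $R_V$ is G-quadratic for generic $V$; that is, there is a non-empty Zariski open subset $U$ of the Grassmannian of subspaces of codimension $c$ of $S_2$ such that $R_V$ is G-quadratic for all $V\in U$. (2) If $c\le 2$, then $R_V$ is G-quadratic if and only if $V$ is not of the following exceptional form: $n\geq 3$ and there is a system of coordinates $x,y,z,t_1,\dots,t_{n-3}$ of $S$ such that $V$ is spanned by $x^2,\ xy,\ y^2-xz,\ yz$ and all products $t_j\ell$ with $1\le j\le n-3$ and $\ell\in\{x,y,z,t_1,\dots,t_{n-3}\}$. (For $n=3$ this is the space $\langle x^2,xy,y^2-xz,yz\rangle\subset K[x,y,z]$ up to a change of coordinates;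 for $n>3$ it is its trivial extension by $n-3$ variables.) -/

import Mathlib

open MvPolynomial

/-- A system of coordinates of `K[x_1, …, x_n]`: linear forms `ℓ_1, …, ℓ_n` that are linearly
independent, hence a basis of the space of linear forms. -/
structure IsCoordinateSystem {K : Type*} [Field K] {n : ℕ}
    (ℓ : Fin n → MvPolynomial (Fin n) K) : Prop where
  isHomogeneous : ∀ i, (ℓ i).IsHomogeneous 1
  linearIndependent : LinearIndependent K ℓ

/-- `B` is a Gröbner basis of the ideal `J` with respect to the term order `m`: `B` is contained in
`J` and the leading terms of the elements of `B` generate the initial ideal of `J`. -/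
def IsGroebnerBasisOf {K : Type*} [Field K] {n : ℕ} (m : MonomialOrder (Fin n))
    (B : Set (MvPolynomial (Fin n) K)) (J : Ideal (MvPolynomial (Fin n) K)) : Prop :=
  B ⊆ (J : Set (MvPolynomial (Fin n) K)) ∧
    Ideal.span (m.leadingTerm '' B) =
      Ideal.span (m.leadingTerm '' (J : Set (MvPolynomial (Fin n) K)))

/-- The algebra `K[x_1, …, x_n]/I` is G-quadratic: its defining ideal `I` has a Gröbner basis of
quadrics with respect to some system of coordinates `ℓ` and some term order `m`. The ideal `I`,
written in the coordinates `ℓ`, is the preimage of `I` under the automorphism `y_i ↦ ℓ_i`. -/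
def IsGQuadratic {K : Type*} [Field K] {n : ℕ} (I : Ideal (MvPolynomial (Fin n) K)) : Prop :=
  ∃ ℓ : Fin n → MvPolynomial (Fin n) K, IsCoordinateSystem ℓ ∧
    ∃ (m : MonomialOrder.{0, 0} (Fin n)) (B : Set (MvPolynomial (Fin n) K)),
      (∀ b ∈ B, b.IsHomogeneous 2) ∧
        IsGroebnerBasisOf m B (I.comap (aeval ℓ : MvPolynomial (Fin n) K →ₐ[K] _))

/-- The Grassmannian of the `d`-dimensional vector spaces of quadrics in `n` variables. -/
def spacesOfQuadrics (K : Type*) [Field K] (n d : ℕ) :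
    Set (Submodule K (MvPolynomial (Fin n) K)) :=
  {V | V ≤ homogeneousSubmodule (Fin n) K 2 ∧ Module.finrank K V = d}

/-- The ideal generated by `V`, that is, the defining ideal of the algebra `R_V`. -/
noncomputable def idealOfQuadrics {K : Type*} [Field K] {n : ℕ} (V : Submodule K (MvPolynomial (Fin n) K)) :
    Ideal (MvPolynomial (Fin n) K) :=
  Ideal.span (V : Set (MvPolynomial (Fin n) K))

/-- The set `U` of `d`-dimensional spaces of quadrics is open in the Zariski topology of the
Grassmannian. This is the quotient topology under the map that sends a linearly independent
`d`-tuple `q` of quadrics to its span: the tuples with span in `U` are those at which some member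
of a family `P` of polynomials in the coefficients of `q_1, …, q_d` does not vanish. -/
def IsZariskiOpen {K : Type*} [Field K] {n : ℕ} (d : ℕ)
    (U : Set (Submodule K (MvPolynomial (Fin n) K))) : Prop :=
  U ⊆ spacesOfQuadrics K n d ∧
    ∃ P : Set (MvPolynomial (Fin d × {e : Fin n →₀ ℕ // e.degree = 2}) K),
      ∀ q : Fin d → MvPolynomial (Fin n) K, (∀ i, (q i).IsHomogeneous 2) →
        LinearIndependent K q →
          (Submodule.span K (Set.range q) ∈ U ↔
            ∃ F ∈ P, eval (fun p => coeff p.2.1 (q p.1)) F ≠ 0)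

/-- In suitable coordinates `x, y, z, t_1, …, t_r` with `r = n - 3`, the space `V` is spanned by
`x², xy, y² - xz, yz` and by all products of some `t_j` with a coordinate. For `r = 0` this is the
exceptional space in three variables, and in general the algebra `R_V` is a trivial extension of
the exceptional algebra, by variables that annihilate all elements of positive degree. -/
def IsExceptional {K : Type*} [Field K] {n : ℕ}
    (V : Submodule K (MvPolynomial (Fin n) K)) : Prop :=
  ∃ (hn : 3 ≤ n) (ℓ : Fin n → MvPolynomial (Fin n) K), IsCoordinateSystem ℓ ∧
    let x := ℓ ⟨0, by omega⟩
    let y := ℓ ⟨1, by omega⟩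
    let z := ℓ ⟨2, by omega⟩
    V = Submodule.span K ({x ^ 2, x * y, y ^ 2 - x * z, y * z} ∪
      {q | ∃ i j : Fin n, 3 ≤ (j : ℕ) ∧ q = ℓ i * ℓ j})

/-! Write R = S/(V) and study the multiplication R_1 × R_1 → R_2, seen as a symmetric bilinear map
on coefficient vectors with values in a space of dimension c (`mulForm`). Working with bilinear
rather than quadratic forms makes the arguments independent of the characteristic.

Quadratic Gröbner bases come mainly from a linear form x ≠ 0 with x² = 0 and xR_1 = R_2
(`isGQuadratic_of_generator`). Take x as the first coordinate and order monomials so that products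
with x are the smallest. Then every product without x, and x² as well, is a leading monomial; the
standard quadratic monomials all have the form x b_j with b_j ≠ x, and no monomial of degree three
has only such quadratic divisors. So the initial ideal contains all monomials of degree three, and
quadrics suffice.

For (1), c < n quadratic forms in n variables have a common zero a ≠ 0, by Krull's height theorem
and the Nullstellensatz, so there is always some a with a² = 0. It remains that aR_1 = R_2 for every
such a, for all V in a non-empty open set. Elimination theory
(`exists_eval_ne_zero_of_forall_eq_zero`) spreads this property from one space to a neighbourhood,
and diagonal forms with Vandermonde coefficients provide that one space.

For (2), over an algebraically closed field a symmetric bilinear form is the square of a functional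
unless it has an isotropic vector outside its radical (`isotropic_or_square`). This settles c = 1.
For c = 2 there is a pencil of forms. If no nonzero member is the square of a functional, there is a
common isotropic x outside the common radical; either xR_1 = R_2, or xR_1 is a line and an isotropic
vector for the form modulo that line gives a second coordinate (`isGQuadratic_of_line`). If the
pencil contains a square p², restrict a second form to the hyperplane p = 0. An isotropic vector
outside the radical of the restriction gives standard monomials z^k and xy
(`isGQuadratic_of_point`); otherwise the pencil is spanned by p² and q² + 2pr, understood as
polarized forms. This is monomial in suitable coordinates unless p, q, r are independent, which is
the exceptional case.

An exceptional space is never G-quadratic, because R_3 is spanned by z³. With a quadratic Gröbner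
basis, two different cubic monomials, at least one with nonzero class coefficient, cannot both have
only standard quadratic divisors. If u is the smallest coordinate with p(u) ≠ 0, then u² is
standard, and this restriction forces the second standard monomial to be vw with u, v, w distinct.
Every possible order of u, v, w then contradicts the multiplication table
(`false_of_standard_pair`). -/

/-- The linear form with coefficient vector `a`. -/
noncomputable def linForm {K : Type*} [Field K] {n : ℕ} :
    (Fin n → K) →ₗ[K] MvPolynomial (Fin n) K :=
  Fintype.linearCombination K X

/-! ### Linear changes of coordinates -/

section Coordinates

variable {K : Type*} [Field K] {n : ℕ}

lemma linForm_apply (a : Fin n → K) : linForm a = ∑ i, a i • (X i : MvPolynomial (Fin n) K) := rfl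

@[simp] lemma linForm_single (i : Fin n) :
    linForm (Pi.single i 1) = (X i : MvPolynomial (Fin n) K) := by
  simp [linForm]

lemma isHomogeneous_linForm (a : Fin n → K) : (linForm a).IsHomogeneous 1 := by
  rw [linForm_apply, ← mem_homogeneousSubmodule]
  exact Submodule.sum_mem _ fun i _ => Submodule.smul_mem _ _ (isHomogeneous_X _ _)

lemma isHomogeneous_linForm_mul (a b : Fin n → K) : (linForm a * linForm b).IsHomogeneous 2 :=
  (isHomogeneous_linForm a).mul (isHomogeneous_linForm b)

lemma range_linForm : LinearMap.range (linForm (K := K) (n := n)) = homogeneousSubmodule (Fin n) K 1 := by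
  rw [homogeneousSubmodule_one_eq_span_X, linForm, Fintype.range_linearCombination]

lemma linForm_injective : Function.Injective (linForm (K := K) (n := n)) := by
  rw [← LinearMap.ker_eq_bot, LinearMap.ker_eq_bot']
  intro a ha
  rw [linForm_apply] at ha
  have := Fintype.linearIndependent_iff.mp (linearIndependent_X (σ := Fin n) (R := K)) a ha
  exact funext this

lemma aeval_linForm (ℓ : Fin n → (Fin n → K)) (a : Fin n → K) :
    aeval (fun i => linForm (ℓ i)) (linForm a) = linForm (∑ i, a i • ℓ i) := by
  simp [linForm_apply a, map_sum]

/-- The automorphism `X i ↦ linForm (b i)` of the polynomial ring. -/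
noncomputable def coordChange (b : Module.Basis (Fin n) K (Fin n → K)) :
    MvPolynomial (Fin n) K ≃ₐ[K] MvPolynomial (Fin n) K :=
  AlgEquiv.ofAlgHom (aeval fun i => linForm (b i))
    (aeval fun i => linForm (b.equivFun (Pi.single i 1)))
    (by
      ext1 i
      have h : ∑ j, b.equivFun (Pi.single i 1) j • b j = Pi.single i 1 := b.sum_equivFun _
      simp only [AlgHom.comp_apply, aeval_X, AlgHom.id_apply]
      rw [aeval_linForm, h, linForm_single])
    (by
      ext1 i
      have h : ∑ j, b i j • b.equivFun (Pi.single j 1) = Pi.single i 1 := by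
        simp_rw [← map_smul, ← map_sum, ← Pi.single_smul', smul_eq_mul, mul_one,
          Finset.univ_sum_single]
        ext k; simp [Pi.single_apply, eq_comm]
      simp only [AlgHom.comp_apply, aeval_X, AlgHom.id_apply]
      rw [aeval_linForm, h, linForm_single])

lemma coordChange_apply (b : Module.Basis (Fin n) K (Fin n → K)) (f : MvPolynomial (Fin n) K) :
    coordChange b f = aeval (fun i => linForm (b i)) f := rfl

@[simp] lemma coordChange_X (b : Module.Basis (Fin n) K (Fin n → K)) (i : Fin n) :
    coordChange b (X i) = linForm (b i) := by simp [coordChange_apply]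

lemma coordChange_symm_linForm (b : Module.Basis (Fin n) K (Fin n → K)) (a : Fin n → K) :
    (coordChange b).symm (linForm a) = linForm (b.equivFun a) := by
  rw [AlgEquiv.symm_apply_eq, coordChange_apply, aeval_linForm, b.sum_equivFun]

lemma isHomogeneous_coordChange (b : Module.Basis (Fin n) K (Fin n → K))
    {f : MvPolynomial (Fin n) K} {k : ℕ} (hf : f.IsHomogeneous k) :
    (coordChange b f).IsHomogeneous k := by
  have := hf.aeval (fun i => linForm (b i)) (n := 1) fun i => isHomogeneous_linForm _
  rw [one_mul] at this
  exact this

lemma isHomogeneous_coordChange_symm (b : Module.Basis (Fin n) K (Fin n → K))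
    {f : MvPolynomial (Fin n) K} {k : ℕ} (hf : f.IsHomogeneous k) :
    ((coordChange b).symm f).IsHomogeneous k := by
  have := hf.aeval (fun i => linForm (b.equivFun (Pi.single i 1))) (n := 1)
    fun i => isHomogeneous_linForm _
  rw [one_mul] at this
  exact this

lemma isCoordinateSystem_linForm (b : Module.Basis (Fin n) K (Fin n → K)) :
    IsCoordinateSystem fun i => linForm (b i) :=
  ⟨fun _ => isHomogeneous_linForm _,
    b.linearIndependent.map' linForm (LinearMap.ker_eq_bot.mpr linForm_injective)⟩

lemma IsCoordinateSystem.exists_basis {ℓ : Fin n → MvPolynomial (Fin n) K}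
    (h : IsCoordinateSystem ℓ) :
    ∃ b : Module.Basis (Fin n) K (Fin n → K), ℓ = fun i => linForm (b i) := by
  have h1 : ∀ i, ∃ a, linForm a = ℓ i := fun i => by
    have : ℓ i ∈ LinearMap.range (linForm (K := K) (n := n)) := by
      rw [range_linForm]; exact h.isHomogeneous i
    exact this
  choose a ha using h1
  have hli : LinearIndependent K a := by
    apply LinearIndependent.of_comp linForm
    have : (linForm ∘ a) = ℓ := funext ha
    rw [this]; exact h.linearIndependent
  refine ⟨basisOfLinearIndependentOfCardEqFinrank' a hli (by simp), ?_⟩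
  ext1 i
  simp [ha]

lemma homogeneousSubmodule_two_eq_span (b : Module.Basis (Fin n) K (Fin n → K)) :
    homogeneousSubmodule (Fin n) K 2 =
      Submodule.span K (Set.range fun p : Fin n × Fin n => linForm (b p.1) * linForm (b p.2)) := by
  have h1 : homogeneousSubmodule (Fin n) K 1 =
      Submodule.span K (Set.range fun i => linForm (b i)) := by
    rw [← range_linForm, LinearMap.range_eq_map, ← b.span_eq, Submodule.map_span,
      ← Set.range_comp]
    rfl
  rw [← homogeneousSubmodule_one_pow, pow_two, h1, Submodule.span_mul_span]
  congr 1
  ext f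
  simp [Set.mem_mul]

lemma homogeneousSubmodule_two_eq_span_linForm :
    homogeneousSubmodule (Fin n) K 2 =
      Submodule.span K (Set.range fun p : (Fin n → K) × (Fin n → K) => linForm p.1 * linForm p.2) := by
  apply le_antisymm
  · rw [homogeneousSubmodule_two_eq_span (Pi.basisFun K (Fin n))]
    apply Submodule.span_mono
    rintro _ ⟨p, rfl⟩
    exact ⟨(_, _), rfl⟩
  · rw [Submodule.span_le]
    rintro _ ⟨p, rfl⟩
    exact isHomogeneous_linForm_mul _ _

lemma Finsupp.exists_eq_single_add_single {σ : Type*} {e : σ →₀ ℕ} (h : e.degree = 2) :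
    ∃ i j, e = Finsupp.single i 1 + Finsupp.single j 1 := by
  classical
  have h0 : e ≠ 0 := by rintro rfl; simp at h
  obtain ⟨i, hi⟩ := Finsupp.ne_iff.mp h0
  have h1 : Finsupp.single i 1 ≤ e := by
    rw [Finsupp.single_le_iff]; exact Nat.one_le_iff_ne_zero.mpr hi
  obtain ⟨e', rfl⟩ := exists_add_of_le h1
  have h2 : e'.degree = 1 := by
    rw [map_add, Finsupp.degree_single] at h; omega
  have h3 : e' ≠ 0 := by rintro rfl; simp at h2
  obtain ⟨j, hj⟩ := Finsupp.ne_iff.mp h3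
  have h4 : Finsupp.single j 1 ≤ e' := by
    rw [Finsupp.single_le_iff]; exact Nat.one_le_iff_ne_zero.mpr hj
  obtain ⟨e'', rfl⟩ := exists_add_of_le h4
  have h5 : e''.degree = 0 := by
    rw [map_add, Finsupp.degree_single] at h2; omega
  rw [Finsupp.degree_eq_zero_iff] at h5
  exact ⟨i, j, by rw [h5, add_zero]⟩

lemma coordChange_monomial (b : Module.Basis (Fin n) K (Fin n → K)) (i j : Fin n) :
    coordChange b (monomial (Finsupp.single i 1 + Finsupp.single j 1) 1) =
      linForm (b i) * linForm (b j) := by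
  rw [← one_mul (1 : K), ← monomial_mul, map_mul]
  exact congrArg₂ _ (coordChange_X b i) (coordChange_X b j)

/-- The preimage of a space of quadrics, written in the coordinates given by `b`. -/
noncomputable def inCoords (b : Module.Basis (Fin n) K (Fin n → K))
    (V : Submodule K (MvPolynomial (Fin n) K)) : Submodule K (MvPolynomial (Fin n) K) :=
  V.comap (coordChange b).toLinearMap

lemma mem_inCoords {b : Module.Basis (Fin n) K (Fin n → K)}
    {V : Submodule K (MvPolynomial (Fin n) K)} {f : MvPolynomial (Fin n) K} :
    f ∈ inCoords b V ↔ coordChange b f ∈ V := Iff.rfl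

lemma inCoords_le {b : Module.Basis (Fin n) K (Fin n → K)}
    {V : Submodule K (MvPolynomial (Fin n) K)} (hV : V ≤ homogeneousSubmodule (Fin n) K 2) :
    inCoords b V ≤ homogeneousSubmodule (Fin n) K 2 := by
  intro f hf
  have := isHomogeneous_coordChange_symm b (hV (mem_inCoords.mp hf))
  rwa [AlgEquiv.symm_apply_apply] at this

/-- An automorphism carries generators to generators, so a choice of coordinates can be made on the
space V alone; all later work is with `inCoords b V`. -/
lemma comap_idealOfQuadrics (b : Module.Basis (Fin n) K (Fin n → K))
    (V : Submodule K (MvPolynomial (Fin n) K)) :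
    (idealOfQuadrics V).comap
      (aeval (fun i => linForm (b i)) : MvPolynomial (Fin n) K →ₐ[K] _) =
      idealOfQuadrics (inCoords b V) := by
  apply le_antisymm
  · have h : idealOfQuadrics V ≤ (idealOfQuadrics (inCoords b V)).comap
        ((coordChange b).symm : MvPolynomial (Fin n) K →ₐ[K] _) := by
      refine Ideal.span_le.mpr fun v hv => Ideal.subset_span ?_
      rw [SetLike.mem_coe, mem_inCoords, AlgEquiv.coe_toAlgHom, AlgEquiv.apply_symm_apply]
      exact hv
    intro f hf
    have h1 := h (Ideal.mem_comap.mp hf)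
    rwa [Ideal.mem_comap, ← coordChange_apply, AlgEquiv.coe_toAlgHom,
      AlgEquiv.symm_apply_apply] at h1
  · exact Ideal.span_le.mpr fun v hv => Ideal.subset_span hv

end Coordinates

/-! ### Term orders given by weights -/

section WeightOrder

/-- The type of exponents, to be ordered by weight and then lexicographically. -/
def WeightSyn {n : ℕ} (_ : Fin n → ℕ) : Type := Fin n →₀ ℕ

variable {n : ℕ} (w : Fin n → ℕ)

noncomputable instance : AddCommMonoid (WeightSyn w) :=
  inferInstanceAs (AddCommMonoid (Fin n →₀ ℕ))

/-- The weight of an exponent. -/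
def Finsupp.wt (a : Fin n →₀ ℕ) : ℕ := ∑ i, w i * a i

/-- The key by which exponents are compared. -/
noncomputable def weightKey (a : WeightSyn w) : ℕ ×ₗ Lex (Fin n →₀ ℕ) :=
  toLex (Finsupp.wt w a, toLex a)

lemma weightKey_injective : Function.Injective (weightKey w) := fun _ _ h =>
  congrArg (fun p : ℕ ×ₗ Lex (Fin n →₀ ℕ) => ofLex (ofLex p).2) h

lemma Finsupp.wt_add (a b : Fin n →₀ ℕ) : Finsupp.wt w (a + b) = a.wt w + b.wt w := by
  simp [Finsupp.wt, mul_add, Finset.sum_add_distrib]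

lemma weightKey_add (a b : WeightSyn w) : weightKey w (a + b) = weightKey w a + weightKey w b :=
  congrArg toLex (Prod.ext (Finsupp.wt_add w a b) rfl)

noncomputable instance : LinearOrder (WeightSyn w) :=
  LinearOrder.lift' (weightKey w) (weightKey_injective w)

lemma weightSyn_le_iff (a b : WeightSyn w) : a ≤ b ↔ weightKey w a ≤ weightKey w b := Iff.rfl

instance : IsOrderedAddMonoid (WeightSyn w) where
  add_le_add_left a b h c := by
    rw [weightSyn_le_iff] at h ⊢
    rw [weightKey_add, weightKey_add]
    exact add_le_add_left h _

instance : WellFoundedLT (WeightSyn w) where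
  wf := InvImage.wf (weightKey w) (wellFounded_lt (α := ℕ ×ₗ Lex (Fin n →₀ ℕ)))

/-- The term order that compares weights first and breaks ties lexicographically. -/
noncomputable def weightOrder : MonomialOrder.{0, 0} (Fin n) where
  syn := WeightSyn w
  toSyn :=
    { toFun := fun a => a
      invFun := fun a => a
      left_inv := fun _ => rfl
      right_inv := fun _ => rfl
      map_add' := fun _ _ => rfl }
  toSyn_monotone := by
    intro a b h
    obtain ⟨c, rfl⟩ := exists_add_of_le h
    change weightKey w a ≤ weightKey w _
    refine le_trans ?_ (weightKey_add w a c).symm.le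
    refine le_add_of_nonneg_right ?_
    rw [Prod.Lex.le_iff]
    rcases Nat.eq_zero_or_pos (Finsupp.wt w c) with h0 | h0
    · refine Or.inr ⟨h0.symm, ?_⟩
      exact Finsupp.toLex_monotone (zero_le (a := c))
    · exact Or.inl h0

lemma weightOrder_lt {a b : Fin n →₀ ℕ} (h : a.wt w < b.wt w) :
    (weightOrder w).toSyn a < (weightOrder w).toSyn b := by
  change weightKey w a < weightKey w b
  rw [Prod.Lex.lt_iff]
  exact Or.inl h

@[simp] lemma Finsupp.wt_single (i : Fin n) (k : ℕ) : (Finsupp.single i k).wt w = w i * k := by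
  simp [Finsupp.wt, Finsupp.single_apply]

end WeightOrder

/-! ### Criteria for quadratic Gröbner bases -/

section Criterion

variable {K : Type*} [Field K] {n : ℕ}

/-- Multiplying a quadric by a variable leaves degree two, so in degree two only scalar combinations
of V survive. -/
lemma component_of_mem_idealOfQuadrics {V : Submodule K (MvPolynomial (Fin n) K)}
    (hV : V ≤ homogeneousSubmodule (Fin n) K 2) {f : MvPolynomial (Fin n) K}
    (hf : f ∈ idealOfQuadrics V) :
    (∀ e : Fin n →₀ ℕ, e.degree < 2 → coeff e f = 0) ∧ homogeneousComponent 2 f ∈ V := by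
  induction hf using Submodule.span_induction with
  | mem v hv =>
    refine ⟨fun e he => (hV hv).coeff_eq_zero (by omega), ?_⟩
    rw [homogeneousComponent_eq_self (hV hv)]; exact hv
  | zero => simp
  | add x y _ _ hx hy =>
    refine ⟨fun e he => by rw [coeff_add, hx.1 e he, hy.1 e he, add_zero], ?_⟩
    rw [map_add]; exact V.add_mem hx.2 hy.2
  | smul g x _ hx =>
    rw [smul_eq_mul]
    induction g using MvPolynomial.induction_on with
    | C c =>
      refine ⟨fun e he => by rw [coeff_C_mul, hx.1 e he, mul_zero], ?_⟩
      rw [homogeneousComponent_C_mul, ← smul_eq_C_mul]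
      exact V.smul_mem _ hx.2
    | add p q hp hq =>
      rw [add_mul]
      refine ⟨fun e he => by rw [coeff_add, hp.1 e he, hq.1 e he, add_zero], ?_⟩
      rw [map_add]; exact V.add_mem hp.2 hq.2
    | mul_X p i hp =>
      have key : ∀ e : Fin n →₀ ℕ, e.degree < 3 → coeff e (p * X i * x) = 0 := by
        intro e he
        rw [mul_right_comm, coeff_mul_X']
        split_ifs with hi
        · refine hp.1 _ ?_
          have h1 : Finsupp.single i 1 ≤ e := by
            rw [Finsupp.single_le_iff]
            exact Nat.one_le_iff_ne_zero.mpr (Finsupp.mem_support_iff.mp hi)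
          obtain ⟨e', rfl⟩ := exists_add_of_le h1
          rw [map_add, Finsupp.degree_single] at he
          rw [add_tsub_cancel_left]; omega
        · rfl
      refine ⟨fun e he => key e (by omega), ?_⟩
      convert V.zero_mem
      ext e
      rw [coeff_homogeneousComponent, coeff_zero]
      split_ifs with h
      · exact key e (by omega)
      · rfl

lemma leadingTerm_mem_span_of_le (m : MonomialOrder (Fin n)) {B : Set (MvPolynomial (Fin n) K)}
    {f g : MvPolynomial (Fin n) K} (hg : g ∈ B) (hg0 : g ≠ 0) (h : m.degree g ≤ m.degree f) :
    m.leadingTerm f ∈ Ideal.span (m.leadingTerm '' B) := by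
  have h1 : m.leadingTerm f =
      monomial (m.degree f - m.degree g) (m.leadingCoeff f / m.leadingCoeff g) * m.leadingTerm g := by
    rw [MonomialOrder.leadingTerm, MonomialOrder.leadingTerm, monomial_mul, tsub_add_cancel_of_le h,
      div_mul_cancel₀ _ (m.leadingCoeff_ne_zero_iff.mpr hg0)]
  rw [h1]
  exact Ideal.mul_mem_left _ _ (Ideal.subset_span ⟨g, hg, rfl⟩)

/-- A space of quadrics `V` generates an ideal with a quadratic Gröbner basis, if no exponent of
degree at least three that is not a multiple of a leading exponent of `V` occurs in the ideal. -/
theorem isGQuadratic_of_leadingExponents {V : Submodule K (MvPolynomial (Fin n) K)}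
    (hV : V ≤ homogeneousSubmodule (Fin n) K 2) (b : Module.Basis (Fin n) K (Fin n → K))
    (m : MonomialOrder.{0, 0} (Fin n))
    (h : ∀ a : Fin n →₀ ℕ, 3 ≤ a.degree →
      (∀ g ∈ inCoords b V, g ≠ 0 → ¬ m.degree g ≤ a) →
        ∀ f ∈ idealOfQuadrics (inCoords b V), coeff a f = 0) :
    IsGQuadratic (idealOfQuadrics V) := by
  refine ⟨_, isCoordinateSystem_linForm b, m, inCoords b V, fun _ hg => inCoords_le hV hg, ?_⟩
  rw [comap_idealOfQuadrics]
  refine ⟨Ideal.subset_span, le_antisymm (Ideal.span_mono (Set.image_mono Ideal.subset_span)) ?_⟩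
  rw [Ideal.span_le]
  rintro _ ⟨f, hf, rfl⟩
  by_cases hf0 : f = 0
  · simp [hf0]
  have hc : coeff (m.degree f) f ≠ 0 := (m.coeff_degree_ne_zero_iff).mpr hf0
  have hcomp := component_of_mem_idealOfQuadrics (inCoords_le (b := b) hV) hf
  -- The ideal has nothing below degree two. If the leading exponent has degree two, the quadratic
  -- component of f lies in V and has the same leading exponent. Above degree two, h applies since
  -- the leading exponent does occur in f.
  rcases lt_trichotomy (m.degree f).degree 2 with hd | hd | hd
  · exact absurd (hcomp.1 _ hd) hc
  · have hc2 : coeff (m.degree f) (homogeneousComponent 2 f) ≠ 0 := by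
      rwa [coeff_homogeneousComponent, if_pos hd]
    refine leadingTerm_mem_span_of_le m hcomp.2 (fun h0 => hc2 (by rw [h0, coeff_zero]))
      (le_of_eq ?_)
    apply m.toSyn.injective
    apply le_antisymm
    · rw [m.degree_le_iff]
      intro c hc'
      refine m.le_degree ?_
      rw [mem_support_iff, coeff_homogeneousComponent] at hc'
      rw [mem_support_iff]
      intro h0; simp [h0] at hc'
    · exact m.le_degree (mem_support_iff.mpr hc2)
  · have := mt (h (m.degree f) hd) (fun h0 => hc (h0 f hf))
    push Not at this
    obtain ⟨g, hg, hg0, hle⟩ := this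
    exact leadingTerm_mem_span_of_le m hg hg0 hle

/-- The leading exponents of a space of quadrics are the exponents of those monomials that, modulo
the space, are combinations of smaller monomials. -/
lemma exists_degree_eq_iff {E : Type*} [AddCommGroup E] [Module K E]
    {V : Submodule K (MvPolynomial (Fin n) K)} {π : MvPolynomial (Fin n) K →ₗ[K] E}
    (hπ : ∀ v, v ∈ V ↔ v.IsHomogeneous 2 ∧ π v = 0)
    (b : Module.Basis (Fin n) K (Fin n → K)) (m : MonomialOrder (Fin n)) {e : Fin n →₀ ℕ}
    (he : e.degree = 2) :
    (∃ g ∈ inCoords b V, g ≠ 0 ∧ m.degree g = e) ↔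
      π (coordChange b (monomial e 1)) ∈ Submodule.span K
        ((fun e' => π (coordChange b (monomial e' 1))) ''
          {e' | e'.degree = 2 ∧ m.toSyn e' < m.toSyn e}) := by
  classical
  constructor
  · rintro ⟨g, hg, hg0, rfl⟩
    have h0 : π (coordChange b g) = 0 := ((hπ _).mp (mem_inCoords.mp hg)).2
    have hlc : coeff (m.degree g) g ≠ 0 := m.coeff_degree_ne_zero_iff.mpr hg0
    have hmon : ∀ a : Fin n →₀ ℕ, π (coordChange b (monomial a (coeff a g))) =
        coeff a g • π (coordChange b (monomial a 1)) := by
      intro a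
      rw [← map_smul π, ← map_smul (coordChange b), smul_monomial, smul_eq_mul, mul_one]
    rw [g.as_sum, map_sum, map_sum,
      ← Finset.add_sum_erase _ _ (m.degree_mem_support hg0), hmon] at h0
    rw [add_eq_zero_iff_eq_neg, ← eq_inv_smul_iff₀ hlc] at h0
    rw [h0]
    refine Submodule.smul_mem _ _ (Submodule.neg_mem _ (Submodule.sum_mem _ fun a ha => ?_))
    rw [hmon]
    refine Submodule.smul_mem _ _ (Submodule.subset_span ⟨a, ⟨?_, ?_⟩, rfl⟩)
    · by_contra hne
      have hhom : g.IsHomogeneous 2 := inCoords_le (fun v hv => ((hπ v).mp hv).1) hg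
      exact mem_support_iff.mp (Finset.mem_of_mem_erase ha) (hhom.coeff_eq_zero hne)
    · refine lt_of_le_of_ne (m.le_degree (Finset.mem_of_mem_erase ha)) fun h => ?_
      exact Finset.ne_of_mem_erase ha (m.toSyn.injective h)
  · intro h
    have hset : (fun e' => π (coordChange b (monomial e' 1))) ''
          {e' | e'.degree = 2 ∧ m.toSyn e' < m.toSyn e} =
        (π ∘ₗ (coordChange b).toLinearMap) '' ((fun e' => monomial e' (1 : K)) ''
          {e' | e'.degree = 2 ∧ m.toSyn e' < m.toSyn e}) := by
      rw [Set.image_image]; rfl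
    rw [hset, ← Submodule.map_span] at h
    obtain ⟨g, hg, hgπ⟩ := h
    have hg2 : g.IsHomogeneous 2 ∧ ∀ c ∈ g.support, m.toSyn c < m.toSyn e := by
      clear hgπ
      induction hg using Submodule.span_induction with
      | mem x hx =>
        obtain ⟨e', ⟨he', hlt⟩, rfl⟩ := hx
        refine ⟨isHomogeneous_monomial _ he', fun c hc => ?_⟩
        rwa [Finset.mem_singleton.mp (support_monomial_subset hc)]
      | zero => exact ⟨isHomogeneous_zero _ _ _, by simp⟩
      | add x y _ _ hx hy =>
        refine ⟨hx.1.add hy.1, fun c hc => ?_⟩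
        rcases Finset.mem_union.mp (support_add hc) with h | h
        exacts [hx.2 c h, hy.2 c h]
      | smul r x _ hx =>
        exact ⟨Submodule.smul_mem (homogeneousSubmodule _ K 2) r hx.1,
          fun c hc => hx.2 c (support_smul hc)⟩
    have hce : coeff e g = 0 := by
      by_contra hne
      exact lt_irrefl _ (hg2.2 _ (mem_support_iff.mpr hne))
    have hc1 : coeff e (monomial e (1 : K) - g) ≠ 0 := by
      simp [hce]
    refine ⟨monomial e 1 - g, ?_, fun h0 => hc1 (by rw [h0, coeff_zero]), ?_⟩
    · rw [mem_inCoords, hπ]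
      refine ⟨isHomogeneous_coordChange b ((isHomogeneous_monomial _ he).sub hg2.1), ?_⟩
      rw [map_sub, map_sub, sub_eq_zero]
      exact hgπ.symm
    · apply m.toSyn.injective
      apply le_antisymm
      · rw [m.degree_le_iff]
        intro c hc
        rcases Finset.mem_union.mp (support_sub _ _ _ hc) with h | h
        · rw [Finset.mem_singleton.mp (support_monomial_subset h)]
        · exact (hg2.2 c h).le
      · exact m.le_degree (mem_support_iff.mpr hc1)

/-- The product of two coordinates that, modulo `V`, is a combination of products of lower weight is
the leading monomial of an element of `V`. -/
lemma exists_degree_eq_of_mem_span {E : Type*} [AddCommGroup E] [Module K E]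
    {V : Submodule K (MvPolynomial (Fin n) K)} {π : MvPolynomial (Fin n) K →ₗ[K] E}
    (hπ : ∀ v, v ∈ V ↔ v.IsHomogeneous 2 ∧ π v = 0)
    (b : Module.Basis (Fin n) K (Fin n → K)) (w : Fin n → ℕ) {i j : Fin n}
    (h : π (linForm (b i) * linForm (b j)) ∈ Submodule.span K
      {x | ∃ k l, w k + w l < w i + w j ∧ x = π (linForm (b k) * linForm (b l))}) :
    ∃ g ∈ inCoords b V, g ≠ 0 ∧
      (weightOrder w).degree g = Finsupp.single i 1 + Finsupp.single j 1 := by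
  rw [exists_degree_eq_iff hπ b _ (by simp), coordChange_monomial]
  refine Submodule.span_mono ?_ h
  rintro _ ⟨k, l, hkl, rfl⟩
  refine ⟨Finsupp.single k 1 + Finsupp.single l 1, ⟨by simp, weightOrder_lt w ?_⟩,
    congrArg π (coordChange_monomial b k l)⟩
  simpa [Finsupp.wt_add] using hkl

/-- Gröbner bases of quadrics from a relation `M` that holds for all pairs of coordinates whose
product is not a combination, modulo `V`, of products of lower weight. -/
theorem isGQuadratic_of_weights {E : Type*} [AddCommGroup E] [Module K E]
    {V : Submodule K (MvPolynomial (Fin n) K)} {π : MvPolynomial (Fin n) K →ₗ[K] E}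
    (hπ : ∀ v, v ∈ V ↔ v.IsHomogeneous 2 ∧ π v = 0)
    (b : Module.Basis (Fin n) K (Fin n → K)) (w : Fin n → ℕ) (M : Fin n → Fin n → Prop)
    (hM : ∀ i j, ¬ M i j → π (linForm (b i) * linForm (b j)) ∈ Submodule.span K
      {x | ∃ k l, w k + w l < w i + w j ∧ x = π (linForm (b k) * linForm (b l))})
    (h : ∀ a : Fin n →₀ ℕ, 3 ≤ a.degree →
      (∀ i j, Finsupp.single i 1 + Finsupp.single j 1 ≤ a → M i j) →
        ∀ f ∈ idealOfQuadrics (inCoords b V), coeff a f = 0) :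
    IsGQuadratic (idealOfQuadrics V) := by
  refine isGQuadratic_of_leadingExponents (fun v hv => ((hπ v).mp hv).1) b (weightOrder w)
    fun a ha hlead f hf => h a ha (fun i j hij => ?_) f hf
  by_contra hMij
  obtain ⟨g, hg, hg0, hdeg⟩ := exists_degree_eq_of_mem_span hπ b w (hM i j hMij)
  exact hlead g hg hg0 (hdeg ▸ hij)

/-- An exponent of degree at least three is divisible by a square or by a product of three different
variables. -/
lemma Finsupp.exists_pairs_of_three_le_degree {a : Fin n →₀ ℕ} (ha : 3 ≤ a.degree) :
    (∃ i, Finsupp.single i 1 + Finsupp.single i 1 ≤ a) ∨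
      ∃ i j k, i ≠ j ∧ i ≠ k ∧ j ≠ k ∧ Finsupp.single i 1 + Finsupp.single j 1 ≤ a ∧
        Finsupp.single i 1 + Finsupp.single k 1 ≤ a ∧
        Finsupp.single j 1 + Finsupp.single k 1 ≤ a := by
  by_cases hsq : ∃ i, 2 ≤ a i
  · obtain ⟨i, hi⟩ := hsq
    left
    refine ⟨i, ?_⟩
    rw [← Finsupp.single_add, Finsupp.single_le_iff]
    exact hi
  · push Not at hsq
    right
    have hcard : 2 < a.support.card := by
      have : a.degree ≤ a.support.card := by
        rw [Finsupp.degree_apply, Finset.card_eq_sum_ones]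
        exact Finset.sum_le_sum fun i _ => by have := hsq i; omega
      omega
    obtain ⟨i, j, k, hi, hj, hk, hij, hik, hjk⟩ := Finset.two_lt_card_iff.mp hcard
    have key : ∀ x y, x ≠ y → x ∈ a.support → y ∈ a.support →
        Finsupp.single x 1 + Finsupp.single y 1 ≤ a := by
      intro x y hxy hx hy z
      rw [Finsupp.mem_support_iff] at hx hy
      simp only [Finsupp.add_apply, Finsupp.single_apply]
      split_ifs with h1 h2 h2
      · exact absurd (h1.trans h2.symm) hxy
      · subst h1; omega
      · subst h2; omega
      · omega
    exact ⟨i, j, k, hij, hik, hjk, key _ _ hij hi hj, key _ _ hik hi hk, key _ _ hjk hj hk⟩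

/-- View `M` as a graph on the coordinates. A monomial of degree at least three all of whose
quadratic divisors are edges would produce a loop or a triangle; without these every cubic monomial
is a multiple of a leading monomial of V, and nothing has to be known about the ideal beyond degree
two. -/
theorem isGQuadratic_of_squarefree {E : Type*} [AddCommGroup E] [Module K E]
    {V : Submodule K (MvPolynomial (Fin n) K)} {π : MvPolynomial (Fin n) K →ₗ[K] E}
    (hπ : ∀ v, v ∈ V ↔ v.IsHomogeneous 2 ∧ π v = 0)
    (b : Module.Basis (Fin n) K (Fin n → K)) (w : Fin n → ℕ) (M : Fin n → Fin n → Prop)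
    (hM : ∀ i j, ¬ M i j → π (linForm (b i) * linForm (b j)) ∈ Submodule.span K
      {x | ∃ k l, w k + w l < w i + w j ∧ x = π (linForm (b k) * linForm (b l))})
    (hsq : ∀ i, ¬ M i i)
    (htri : ∀ i j k, i ≠ j → i ≠ k → j ≠ k → M i j → M i k → ¬ M j k) :
    IsGQuadratic (idealOfQuadrics V) := by
  refine isGQuadratic_of_weights hπ b w M hM fun a ha hall => ?_
  rcases Finsupp.exists_pairs_of_three_le_degree ha with ⟨i, hi⟩ | ⟨i, j, k, hij, hik, hjk, h1, h2, h3⟩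
  · exact absurd (hall _ _ hi) (hsq i)
  · exact absurd (hall _ _ h3) (htri i j k hij hik hjk (hall _ _ h1) (hall _ _ h2))

/-- A space of quadrics spanned by monomials in suitable coordinates defines a G-quadratic
algebra. -/
theorem isGQuadratic_of_monomial {V : Submodule K (MvPolynomial (Fin n) K)}
    (b : Module.Basis (Fin n) K (Fin n → K)) (M : Fin n → Fin n → Prop)
    (hM : V = Submodule.span K {x | ∃ i j, ¬ M i j ∧ x = linForm (b i) * linForm (b j)}) :
    IsGQuadratic (idealOfQuadrics V) := by
  have hV : V ≤ homogeneousSubmodule (Fin n) K 2 := by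
    rw [hM, Submodule.span_le]
    rintro _ ⟨i, j, -, rfl⟩
    exact isHomogeneous_linForm_mul _ _
  have hmem : ∀ i j, ¬ M i j →
      monomial (Finsupp.single i 1 + Finsupp.single j 1) (1 : K) ∈ inCoords b V := by
    intro i j hij
    rw [mem_inCoords, coordChange_monomial, hM]
    exact Submodule.subset_span ⟨i, j, hij, rfl⟩
  let T : Set (Fin n →₀ ℕ) :=
    {e | ∃ i j, ¬ M i j ∧ e = Finsupp.single i 1 + Finsupp.single j 1}
  have hle : idealOfQuadrics (inCoords b V) ≤
      Ideal.span ((fun s => monomial s (1 : K)) '' T) := by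
    refine Ideal.span_le.mpr fun v hv => ?_
    have h1 : (inCoords b V) ≤ Submodule.span K ((fun s => monomial s (1 : K)) '' T) := by
      intro v hv
      rw [mem_inCoords] at hv
      have h2 : V ≤ (Submodule.span K ((fun s => monomial s (1 : K)) '' T)).map
          (coordChange b).toLinearMap := by
        rw [hM, Submodule.span_le]
        rintro _ ⟨i, j, hij, rfl⟩
        exact ⟨_, Submodule.subset_span ⟨_, ⟨i, j, hij, rfl⟩, rfl⟩, coordChange_monomial b i j⟩
      obtain ⟨u, hu, huv⟩ := h2 hv
      rwa [← (coordChange b).injective huv]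
    exact Submodule.span_le_restrictScalars K (MvPolynomial (Fin n) K) _ (h1 hv)
  -- Weight zero leaves the lexicographic order; for a monomial ideal any term order would do.
  refine isGQuadratic_of_leadingExponents hV b (weightOrder 0) fun a _ hlead f hf => ?_
  by_contra hne
  obtain ⟨e, ⟨i, j, hij, rfl⟩, hle'⟩ :=
    (mem_ideal_span_monomial_image.mp (hle hf)) a (mem_support_iff.mpr hne)
  classical
  refine hlead _ (hmem i j hij) (by simp) ?_
  rwa [MonomialOrder.degree_monomial, if_neg one_ne_zero]

end Criterion

/-! ### Dimension of spaces of quadrics, functionals and dual bases -/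

section Dimension

variable {K : Type*} [Field K] {n : ℕ}

noncomputable instance (k : ℕ) : Fintype {e : Fin n →₀ ℕ // e.degree = k} :=
  Fintype.ofEquiv {e // e ∈ (Finset.finsuppAntidiag Finset.univ k : Finset (Fin n →₀ ℕ))}
    (Equiv.subtypeEquivRight fun e => by
      simp [Finset.mem_finsuppAntidiag, Finsupp.degree_eq_sum])

lemma card_exponents_two :
    Fintype.card {e : Fin n →₀ ℕ // e.degree = 2} = (n + 1).choose 2 := by
  rw [Fintype.ofEquiv_card, Fintype.card_coe (Finset.finsuppAntidiag _ _ : Finset (Fin n →₀ ℕ)), Finset.card_finsuppAntidiag_nat_eq_choose]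
  simp

/-- Quadrics as vectors of coefficients. -/
noncomputable def quadricEquiv :
    homogeneousSubmodule (Fin n) K 2 ≃ₗ[K] ({e : Fin n →₀ ℕ // e.degree = 2} → K) where
  toFun q e := coeff e.1 q.1
  map_add' _ _ := rfl
  map_smul' _ _ := rfl
  invFun c := ⟨∑ e, monomial e.1 (c e), Submodule.sum_mem _ fun e _ => isHomogeneous_monomial _ e.2⟩
  left_inv q := by
    classical
    ext a
    simp only [coeff_sum, coeff_monomial]
    by_cases ha : a.degree = 2
    · rw [Finset.sum_eq_single ⟨a, ha⟩]
      · simp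
      · intro e _ he
        rw [if_neg fun h => he (Subtype.ext h)]
      · simp
    · rw [q.2.coeff_eq_zero ha, Finset.sum_eq_zero]
      intro e _
      rw [if_neg]
      rintro rfl
      exact ha e.2
  right_inv c := by
    classical
    ext a
    simp only [coeff_sum, coeff_monomial]
    rw [Finset.sum_eq_single a]
    · simp
    · intro e _ he
      rw [if_neg fun h => he (Subtype.ext h)]
    · simp

instance : Module.Finite K (homogeneousSubmodule (Fin n) K 2) :=
  Module.Finite.equiv quadricEquiv.symm

variable (K n) in
lemma finrank_quadrics : Module.finrank K (homogeneousSubmodule (Fin n) K 2) = (n + 1).choose 2 := by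
  rw [quadricEquiv.finrank_eq, Module.finrank_fintype_fun_eq_card, card_exponents_two]

/-- Projection to the quadrics. -/
noncomputable def quadricPart :
    MvPolynomial (Fin n) K →ₗ[K] homogeneousSubmodule (Fin n) K 2 :=
  (homogeneousComponent 2).codRestrict _ fun f => homogeneousComponent_mem 2 f

lemma quadricPart_coe (q : homogeneousSubmodule (Fin n) K 2) :
    quadricPart (q : MvPolynomial (Fin n) K) = q :=
  Subtype.ext (homogeneousComponent_eq_self q.2)

/-- A space of quadrics of codimension `c` is the kernel of `c` independent functionals. -/
lemma exists_functionals {c d : ℕ} (hd : d + c = (n + 1).choose 2)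
    {V : Submodule K (MvPolynomial (Fin n) K)} (hV : V ∈ spacesOfQuadrics K n d) :
    ∃ π : MvPolynomial (Fin n) K →ₗ[K] (Fin c → K),
      (∀ v, v ∈ V ↔ v.IsHomogeneous 2 ∧ π v = 0) ∧ ∀ y, ∃ q, q.IsHomogeneous 2 ∧ π q = y := by
  set V' := V.submoduleOf (homogeneousSubmodule (Fin n) K 2)
  have h1 : Module.finrank K V' = d := by
    rw [(Submodule.submoduleOfEquivOfLe hV.1).finrank_eq, hV.2]
  have h2 : Module.finrank K (homogeneousSubmodule (Fin n) K 2 ⧸ V') = c := by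
    have := Submodule.finrank_quotient_add_finrank V'
    rw [finrank_quadrics] at this
    omega
  let e : (homogeneousSubmodule (Fin n) K 2 ⧸ V') ≃ₗ[K] (Fin c → K) :=
    LinearEquiv.ofFinrankEq _ _ (by rw [h2, Module.finrank_fin_fun])
  refine ⟨e.toLinearMap ∘ₗ V'.mkQ ∘ₗ quadricPart, fun v => ?_, fun y => ?_⟩
  · constructor
    · intro hv
      refine ⟨hV.1 hv, ?_⟩
      rw [LinearMap.comp_apply, LinearMap.comp_apply, quadricPart_coe ⟨v, hV.1 hv⟩]
      have : V'.mkQ ⟨v, hV.1 hv⟩ = 0 := (Submodule.Quotient.mk_eq_zero _).mpr hv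
      rw [this, map_zero]
    · rintro ⟨hv, h0⟩
      rw [LinearMap.comp_apply, LinearMap.comp_apply, quadricPart_coe ⟨v, hv⟩] at h0
      exact (Submodule.Quotient.mk_eq_zero V').mp ((map_eq_zero_iff _ e.injective).mp h0)
  · obtain ⟨q, hq⟩ := V'.mkQ_surjective (e.symm y)
    refine ⟨q, q.2, ?_⟩
    rw [LinearMap.comp_apply, LinearMap.comp_apply, quadricPart_coe, hq]
    exact e.apply_symm_apply y

/-- Linear maps that agree on products of linear forms agree on quadrics. -/
lemma eq_of_forall_linForm_mul {E : Type*} [AddCommGroup E] [Module K E]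
    {f g : MvPolynomial (Fin n) K →ₗ[K] E}
    (h : ∀ a b, f (linForm a * linForm b) = g (linForm a * linForm b))
    {q : MvPolynomial (Fin n) K} (hq : q.IsHomogeneous 2) : f q = g q := by
  have : homogeneousSubmodule (Fin n) K 2 ≤ LinearMap.eqLocus f g := by
    rw [homogeneousSubmodule_two_eq_span_linForm, Submodule.span_le]
    rintro _ ⟨p, rfl⟩
    exact h _ _
  exact this hq

/-- A linearly independent family extends to a basis. -/
lemma exists_basis_extending {k : ℕ} (v : Fin k → (Fin n → K)) (hv : LinearIndependent K v) :
    ∃ (hk : k ≤ n) (b : Module.Basis (Fin n) K (Fin n → K)), ∀ i, b (Fin.castLE hk i) = v i := by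
  classical
  have hk : k ≤ n := by simpa using hv.fintype_card_le_finrank
  let B := Module.Basis.sumExtend hv
  have : Finite (Fin k ⊕ (Module.Basis.sumExtendIndex hv)) := Module.Finite.finite_basis B
  have : Finite (Module.Basis.sumExtendIndex hv) := Finite.sum_right (Fin k)
  have := Fintype.ofFinite (Module.Basis.sumExtendIndex hv)
  have hc : Fintype.card (Module.Basis.sumExtendIndex hv) = n - k := by
    have := Module.finrank_eq_card_basis B
    rw [Module.finrank_fin_fun, Fintype.card_sum, Fintype.card_fin] at this
    omega
  let e : Fin k ⊕ (Module.Basis.sumExtendIndex hv) ≃ Fin n :=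
    ((Equiv.refl _).sumCongr (Fintype.equivFinOfCardEq hc)).trans
      (finSumFinEquiv.trans (finCongr (by omega)))
  refine ⟨hk, B.reindex e, fun i => ?_⟩
  have h1 : e.symm (Fin.castLE hk i) = Sum.inl i := by
    rw [Equiv.symm_apply_eq]
    ext; simp [e]
  rw [Module.Basis.reindex_apply, h1]
  change Module.Basis.sumExtend hv (Sum.inl i) = v i
  rw [Module.Basis.sumExtend, Module.Basis.reindex_apply, Module.Basis.extend_apply_self]
  rfl

/-- A linearly independent family of functionals is part of the dual basis of some basis. -/
lemma exists_dual_basis {k : ℕ} (f : Fin k → Module.Dual K (Fin n → K))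
    (hf : LinearIndependent K f) :
    ∃ (hk : k ≤ n) (b : Module.Basis (Fin n) K (Fin n → K)),
      ∀ i j, f i (b j) = if j = Fin.castLE hk i then 1 else 0 := by
  let T := (Pi.basisFun K (Fin n)).toDualEquiv
  have hv : LinearIndependent K (fun i => T.symm (f i)) :=
    hf.map' T.symm.toLinearMap T.symm.ker
  obtain ⟨hk, b', hb'⟩ := exists_basis_extending _ hv
  refine ⟨hk, (b'.map T).dualBasis.map (Module.evalEquiv K (Fin n → K)).symm, fun i j => ?_⟩
  have h1 : f i = (b'.map T) (Fin.castLE hk i) := by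
    rw [Module.Basis.map_apply, hb', LinearEquiv.apply_symm_apply]
  rw [h1, Module.Basis.map_apply (b := (b'.map T).dualBasis), Module.apply_evalEquiv_symm_apply,
    Module.Basis.dualBasis_apply_self]
  simp [eq_comm]

end Dimension

/-! ### Common zeros of quadratic forms and isotropic vectors -/

section CommonZeros

variable {K : Type*} [Field K] {n : ℕ}

/-- The prime ideal generated by the first `i` variables. -/
noncomputable def coordPrime (K : Type*) [Field K] (n i : ℕ) : Ideal (MvPolynomial (Fin n) K) :=
  RingHom.ker (aeval fun j : Fin n => if (j : ℕ) < i then 0 else (X j : MvPolynomial (Fin n) K))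

instance (i : ℕ) : (coordPrime K n i).IsPrime := RingHom.ker_isPrime _

lemma coordPrime_lt {i : ℕ} (hi : i < n) : coordPrime K n i < coordPrime K n (i + 1) := by
  rw [lt_iff_le_not_ge]
  constructor
  · intro f hf
    have h : (aeval fun j : Fin n => if (j : ℕ) < i + 1 then 0 else (X j : MvPolynomial (Fin n) K)) =
        (aeval fun j : Fin n => if (j : ℕ) < i + 1 then 0 else (X j : MvPolynomial (Fin n) K)).comp
        (aeval fun j : Fin n => if (j : ℕ) < i then 0 else (X j : MvPolynomial (Fin n) K)) := by
      ext1 j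
      simp only [aeval_X, AlgHom.comp_apply]
      rcases lt_trichotomy (j : ℕ) i with h | h | h
      · simp [h, h.trans (Nat.lt_succ_self i)]
      · simp [h]
      · simp [h, show ¬ (j : ℕ) < i + 1 by omega, show ¬ (j : ℕ) < i by omega]
    rw [coordPrime, RingHom.mem_ker] at hf ⊢
    rw [h, AlgHom.comp_apply, hf, map_zero]
  · intro h
    have h1 : (X ⟨i, hi⟩ : MvPolynomial (Fin n) K) ∈ coordPrime K n (i + 1) := by
      simp [coordPrime, RingHom.mem_ker]
    have h2 := h h1
    simp [coordPrime, RingHom.mem_ker] at h2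

/-- The coordinate primes form a strictly increasing chain, and each step raises the height. -/
lemma le_height_coordPrime {i : ℕ} (hi : i ≤ n) : (i : ℕ∞) ≤ (coordPrime K n i).height := by
  induction i with
  | zero => simp
  | succ i ih =>
    refine le_trans ?_ (Ideal.height_add_one_le_of_lt_of_isPrime (coordPrime_lt (K := K) hi))
    push_cast
    gcongr
    exact ih (by omega)

lemma mem_coordPrime_self {f : MvPolynomial (Fin n) K} :
    f ∈ coordPrime K n n ↔ eval 0 f = 0 := by
  have h : (aeval fun j : Fin n => if (j : ℕ) < n then 0 else (X j : MvPolynomial (Fin n) K)) =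
      (Algebra.ofId K (MvPolynomial (Fin n) K)).comp (aeval (0 : Fin n → K)) := by
    ext1 j
    simp
  rw [coordPrime, RingHom.mem_ker, h, AlgHom.comp_apply, Algebra.ofId_apply,
    map_eq_zero_iff _ (FaithfulSMul.algebraMap_injective K (MvPolynomial (Fin n) K))]
  exact Eq.congr_left (DFunLike.congr_fun (coe_aeval_eq_eval 0) f)

variable [IsAlgClosed K]

/-- Fewer than `n` polynomials in `n` variables that vanish at the origin have another common
zero. -/
theorem exists_ne_zero_common_zero {c : ℕ} (hc : c < n) (F : Fin c → MvPolynomial (Fin n) K)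
    (hF : ∀ i, eval 0 (F i) = 0) : ∃ a : Fin n → K, a ≠ 0 ∧ ∀ i, eval a (F i) = 0 := by
  by_contra hcon
  push Not at hcon
  set I := Ideal.span (Set.range F) with hI
  have hIle : I ≤ coordPrime K n n := by
    rw [hI, Ideal.span_le]
    rintro _ ⟨i, rfl⟩
    exact mem_coordPrime_self.mpr (hF i)
  have hrad : coordPrime K n n ≤ I.radical := by
    rw [← vanishingIdeal_zeroLocus_eq_radical (K := K)]
    intro f hf a ha
    have : a = 0 := by
      by_contra ha0
      obtain ⟨i, hi⟩ := hcon a ha0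
      exact hi (ha (F i) (Ideal.subset_span ⟨i, rfl⟩))
    rw [this]
    refine (DFunLike.congr_fun (coe_aeval_eq_eval 0) f).trans ?_
    exact mem_coordPrime_self.mp hf
  -- If the origin were the only common zero, its maximal ideal, of height at least n, would be
  -- minimal over an ideal with c < n generators, against Krull's height theorem.
  have hmin : coordPrime K n n ∈ I.minimalPrimes :=
    ⟨⟨inferInstance, hIle⟩, fun q hq _ => hrad.trans ((Ideal.IsPrime.radical_le_iff hq.1).mpr hq.2)⟩
  have h1 := Ideal.height_le_card_of_mem_minimalPrimes_span (Set.finite_range F) hmin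
  have h2 := (le_height_coordPrime (K := K) (le_refl n)).trans h1
  have h3 : (Set.range F).ncard ≤ c := by
    rw [← Set.image_univ]
    exact (Set.ncard_image_le Set.finite_univ).trans (by simp [Set.ncard_univ])
  have h4 : n ≤ (Set.range F).ncard := by exact_mod_cast h2
  omega

/-- Fewer than `n` quadratic forms in `n` variables have a nontrivial common zero. -/
theorem exists_isotropic {c : ℕ} (hc : c < n)
    (B : Fin c → (Fin n → K) →ₗ[K] (Fin n → K) →ₗ[K] K) :
    ∃ a : Fin n → K, a ≠ 0 ∧ ∀ i, B i a a = 0 := by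
  let F : Fin c → MvPolynomial (Fin n) K := fun i =>
    ∑ j, ∑ k, C (B i (Pi.single j 1) (Pi.single k 1)) * (X j * X k)
  have hF : ∀ i a, eval a (F i) = B i a a := by
    intro i a
    have ha : a = ∑ j, a j • Pi.single j (1 : K) := by
      ext k; simp [Finset.sum_apply, Pi.single_apply]
    conv_rhs => rw [ha]
    simp only [map_sum, map_smul, LinearMap.sum_apply, LinearMap.smul_apply, F, map_mul, eval_C,
      eval_X, smul_eq_mul]
    rw [Finset.sum_comm]
    refine Finset.sum_congr rfl fun j _ => ?_
    rw [Finset.mul_sum]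
    exact Finset.sum_congr rfl fun k _ => by ring
  obtain ⟨a, ha, h⟩ := exists_ne_zero_common_zero hc F fun i => by rw [hF]; simp
  exact ⟨a, ha, fun i => by rw [← hF, h]⟩

/-- A symmetric bilinear form over an algebraically closed field is the square of a functional,
unless it has an isotropic vector outside its radical. -/
theorem isotropic_or_square {W : Type*} [AddCommGroup W] [Module K W] (B : W →ₗ[K] W →ₗ[K] K)
    (hB : ∀ a b, B a b = B b a) :
    (∃ x y, B x x = 0 ∧ B x y ≠ 0) ∨ ∃ q : W →ₗ[K] K, ∀ a b, B a b = q a * q b := by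
  rw [or_iff_not_imp_left]
  intro h
  push Not at h
  by_cases h0 : ∀ b, B b b = 0
  · exact ⟨0, fun a b => by simp [h a b (h0 a)]⟩
  · push Not at h0
    obtain ⟨b₀, hb₀⟩ := h0
    obtain ⟨r, hr⟩ := IsAlgClosed.exists_pow_nat_eq (B b₀ b₀) two_pos
    have hr0 : r ≠ 0 := by rintro rfl; simp at hr; exact hb₀ hr.symm
    set b := r⁻¹ • b₀ with hb
    have hbb : B b b = 1 := by
      simp only [hb, map_smul, LinearMap.smul_apply, smul_eq_mul, ← hr]
      field_simp
    refine ⟨B b, fun a a' => ?_⟩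
    set a₀ := a - B b a • b with ha₀
    have h1 : B b a₀ = 0 := by simp [ha₀, hbb]
    -- With B(b, b) = 1 and a₀ orthogonal to b, this t makes a₀ + t b isotropic, hence radical.
    -- Pairing with b gives t = 0, so a₀ itself is isotropic and radical, and B only sees the
    -- b-components.
    obtain ⟨t, ht⟩ := IsAlgClosed.exists_pow_nat_eq (-(B a₀ a₀)) two_pos
    have h1' : B a₀ b = 0 := by rw [hB, h1]
    have h2 : B (a₀ + t • b) (a₀ + t • b) = 0 := by
      simp only [map_add, map_smul, LinearMap.add_apply, LinearMap.smul_apply, smul_eq_mul, h1, h1',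
        hbb]
      linear_combination ht
    have h3 := h _ b h2
    simp only [map_add, map_smul, LinearMap.add_apply, LinearMap.smul_apply, smul_eq_mul, h1',
      hbb, zero_add, mul_one] at h3
    have h4 : B a₀ a₀ = 0 := by rw [h3] at ht; simpa using ht.symm
    have h5 := h a₀ a' h4
    rw [ha₀, map_sub, map_smul, LinearMap.sub_apply, LinearMap.smul_apply, smul_eq_mul,
      sub_eq_zero] at h5
    exact h5

end CommonZeros

/-! ### Gröbner bases from an isotropic linear form -/

section Constructions

variable {K : Type*} [Field K] {n : ℕ}

/-- The symmetric bilinear form on coefficient vectors of linear forms given by a functional on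
quadrics. -/
noncomputable def mulForm {E : Type*} [AddCommGroup E] [Module K E]
    (π : MvPolynomial (Fin n) K →ₗ[K] E) : (Fin n → K) →ₗ[K] (Fin n → K) →ₗ[K] E :=
  ((LinearMap.mul K (MvPolynomial (Fin n) K)).compl₁₂ linForm linForm).compr₂ π

lemma mulForm_apply {E : Type*} [AddCommGroup E] [Module K E]
    (π : MvPolynomial (Fin n) K →ₗ[K] E) (a b : Fin n → K) :
    mulForm π a b = π (linForm a * linForm b) := rfl

lemma mulForm_comm {E : Type*} [AddCommGroup E] [Module K E]
    (π : MvPolynomial (Fin n) K →ₗ[K] E) (a b : Fin n → K) :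
    mulForm π a b = mulForm π b a := by
  rw [mulForm_apply, mulForm_apply, mul_comm]

lemma mulForm_comp {E F : Type*} [AddCommGroup E] [Module K E] [AddCommGroup F] [Module K F]
    (θ : E →ₗ[K] F) (π : MvPolynomial (Fin n) K →ₗ[K] E) (a b : Fin n → K) :
    mulForm (θ ∘ₗ π) a b = θ (mulForm π a b) := rfl

lemma eq_sum_smul_basis (b : Module.Basis (Fin n) K (Fin n → K)) (a : Fin n → K) :
    a = ∑ k, b.equivFun a k • b k := (b.sum_equivFun a).symm

variable {E : Type*} [AddCommGroup E] [Module K E] {V : Submodule K (MvPolynomial (Fin n) K)}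
  {π : MvPolynomial (Fin n) K →ₗ[K] E}

/-- Membership of the products with an isotropic first coordinate in spans of products of lower
weight. -/
lemma mulForm_mem_span_lower (b : Module.Basis (Fin n) K (Fin n → K)) {i₀ i j : Fin n}
    (hi₀ : (i₀ : ℕ) = 0) (hi : i ≠ i₀) (hj : j ≠ i₀) (hx : mulForm π (b i₀) (b i₀) = 0)
    (u : Fin n → K) :
    mulForm π (b i₀) u ∈ Submodule.span K
      {x | ∃ k l : Fin n, (if k = i₀ then 0 else n + (k : ℕ)) + (if l = i₀ then 0 else n + (l : ℕ)) <
        (if i = i₀ then 0 else n + (i : ℕ)) + (if j = i₀ then 0 else n + (j : ℕ)) ∧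
        x = π (linForm (b k) * linForm (b l))} := by
  rw [eq_sum_smul_basis b u, map_sum]
  refine Submodule.sum_mem _ fun k _ => ?_
  rw [map_smul]
  refine Submodule.smul_mem _ _ ?_
  by_cases hk : k = i₀
  · rw [hk, hx]; exact Submodule.zero_mem _
  · refine Submodule.subset_span ⟨i₀, k, ?_, rfl⟩
    rw [if_pos rfl, if_neg hk, if_neg hi, if_neg hj]
    have h1 : (i : ℕ) ≠ 0 := fun h => hi (Fin.ext (h.trans hi₀.symm))
    have := k.2
    omega

/-- The weight of x b_k grows with k, so dependence on earlier multiples of x is dependence on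
products of lower weight. -/
lemma span_singleton_lower (b : Module.Basis (Fin n) K (Fin n → K)) {i₀ j : Fin n}
    (hj : j ≠ i₀)
    (h : mulForm π (b i₀) (b j) ∈ Submodule.span K
      {x | ∃ k : Fin n, k ≠ i₀ ∧ k < j ∧ x = mulForm π (b i₀) (b k)}) :
    mulForm π (b i₀) (b j) ∈ Submodule.span K
      {x | ∃ k l : Fin n, (if k = i₀ then 0 else n + (k : ℕ)) + (if l = i₀ then 0 else n + (l : ℕ)) <
        (if i₀ = i₀ then 0 else n + (i₀ : ℕ)) + (if j = i₀ then 0 else n + (j : ℕ)) ∧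
        x = π (linForm (b k) * linForm (b l))} := by
  refine Submodule.span_mono ?_ h
  rintro _ ⟨k, hk, hkj, rfl⟩
  refine ⟨i₀, k, ?_, rfl⟩
  rw [if_pos rfl, if_neg hk, if_neg hj]
  have : (k : ℕ) < j := hkj
  omega

/-- If `x` is a linear form with `x² = 0` whose multiples fill the degree two part, then
the algebra is G-quadratic. -/
theorem isGQuadratic_of_generator (hπ : ∀ v, v ∈ V ↔ v.IsHomogeneous 2 ∧ π v = 0)
    {x : Fin n → K} (hx0 : x ≠ 0) (hxx : mulForm π x x = 0)
    (hx : ∀ a b, ∃ u, mulForm π a b = mulForm π x u) : IsGQuadratic (idealOfQuadrics V) := by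
  obtain ⟨hk, b, hb⟩ := exists_basis_extending ![x] (LinearIndependent.of_subsingleton 0 hx0)
  set i₀ : Fin n := Fin.castLE hk 0 with hi₀
  have hb0 : b i₀ = x := hb 0
  rw [← hb0] at hxx hx
  -- A greedy choice: the x b_j that are not spanned by the preceding ones form a basis of xR_1.
  let S : Fin n → Prop := fun j => mulForm π (b i₀) (b j) ∉ Submodule.span K
      {x | ∃ k : Fin n, k ≠ i₀ ∧ k < j ∧ x = mulForm π (b i₀) (b k)}
  -- Products with x weigh at most 2n - 1, products without x at least 2n. All edges of the graph
  -- contain x and none is a loop, so it is a star and has no triangle.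
  refine isGQuadratic_of_squarefree hπ b (fun i => if i = i₀ then 0 else n + (i : ℕ))
    (fun i j => (i = i₀ ∧ j ≠ i₀ ∧ S j) ∨ (j = i₀ ∧ i ≠ i₀ ∧ S i)) ?_ ?_ ?_
  · intro i j hM
    push Not at hM
    by_cases hi : i = i₀
    · subst hi
      by_cases hj : j = i₀
      · subst hj
        have : π (linForm (b i₀) * linForm (b i₀)) = 0 := hxx
        rw [this]; exact Submodule.zero_mem _
      · exact span_singleton_lower b hj (not_not.mp (hM.1 rfl hj))
    · by_cases hj : j = i₀
      · subst hj
        rw [mul_comm]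
        simp_rw [add_comm (if i = i₀ then 0 else _)]
        exact span_singleton_lower b hi (not_not.mp (hM.2 rfl hi))
      · obtain ⟨u, hu⟩ := hx (b i) (b j)
        rw [← mulForm_apply, hu]
        exact mulForm_mem_span_lower b rfl hi hj hxx u
  · rintro i (⟨h1, h2, -⟩ | ⟨h1, h2, -⟩) <;> exact h2 h1
  · rintro i j k hij hik hjk (⟨h1, h2, -⟩ | ⟨h1, h2, -⟩) (⟨h3, h4, -⟩ | ⟨h3, h4, -⟩) <;>
      rintro (⟨h5, h6, -⟩ | ⟨h5, h6, -⟩) <;> simp_all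

/-- The degree two part has dimension two, and multiplication by a linear form `x` with `x² = 0` has
image in the line spanned by `e`, modulo which there is an isotropic vector outside the radical. -/
theorem isGQuadratic_of_line (hπ : ∀ v, v ∈ V ↔ v.IsHomogeneous 2 ∧ π v = 0)
    {x s u v : Fin n → K} (hx0 : x ≠ 0) (hxx : mulForm π x x = 0)
    (φ : E →ₗ[K] K) (hφ : ∀ y, φ y = 0 ↔ y ∈ Submodule.span K {mulForm π x s})
    (hx : ∀ a, φ (mulForm π x a) = 0) (huu : φ (mulForm π u u) = 0) (huv : φ (mulForm π u v) ≠ 0) :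
    IsGQuadratic (idealOfQuadrics V) := by
  have hli : LinearIndependent K ![x, u, v] := by
    rw [Fintype.linearIndependent_iff]
    intro g hg
    simp only [Fin.sum_univ_three, Matrix.cons_val] at hg
    have h1 : g 2 = 0 := by
      have := congrArg (fun y => φ (mulForm π u y)) hg
      simp only [map_add, map_smul, map_zero, huu, mulForm_comm π u x, hx, mul_zero, zero_add,
        smul_eq_mul] at this
      exact (mul_eq_zero.mp this).resolve_right huv
    have h2 : g 1 = 0 := by
      have := congrArg (fun y => φ (mulForm π v y)) hg
      simp only [map_add, map_smul, map_zero, h1, mulForm_comm π v x, mulForm_comm π v u, hx,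
        zero_smul, mul_zero, zero_add, add_zero, smul_eq_mul] at this
      exact (mul_eq_zero.mp this).resolve_right huv
    have h3 : g 0 = 0 := by
      rw [h1, h2, zero_smul, zero_smul, add_zero, add_zero] at hg
      exact (smul_eq_zero.mp hg).resolve_right hx0
    intro i
    fin_cases i
    exacts [h3, h2, h1]
  obtain ⟨hk, b, hb⟩ := exists_basis_extending ![x, u, v] hli
  set i₀ : Fin n := Fin.castLE hk 0 with hi₀
  set i₁ : Fin n := Fin.castLE hk 1 with hi₁
  set i₂ : Fin n := Fin.castLE hk 2 with hi₂
  have hb0 : b i₀ = x := hb 0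
  have hb1 : b i₁ = u := hb 1
  have hb2 : b i₂ = v := hb 2
  rw [← hb0] at hxx hx hφ
  rw [← hb1] at huu huv
  rw [← hb2] at huv
  have v0 : (i₀ : ℕ) = 0 := rfl
  have v1 : (i₁ : ℕ) = 1 := rfl
  have v2 : (i₂ : ℕ) = 2 := rfl
  have h10 : i₁ ≠ i₀ := fun h => by have := congrArg Fin.val h; omega
  have h20 : i₂ ≠ i₀ := fun h => by have := congrArg Fin.val h; omega
  have h12 : i₁ ≠ i₂ := fun h => by have := congrArg Fin.val h; omega
  let S : Fin n → Prop := fun j => mulForm π (b i₀) (b j) ∉ Submodule.span K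
      {x | ∃ k : Fin n, k ≠ i₀ ∧ k < j ∧ x = mulForm π (b i₀) (b k)}
  -- All multiples of x lie on one line, so the greedy choice stops after the first nonzero one.
  have hS : ∀ i j, i ≠ i₀ → S i → S j → ¬ i < j := by
    intro i j hi0 hi hj hij
    apply hj
    have hne : mulForm π (b i₀) (b i) ≠ 0 := fun h0 => hi (by rw [h0]; exact Submodule.zero_mem _)
    obtain ⟨α, hα⟩ := Submodule.mem_span_singleton.mp ((hφ _).mp (hx (b i)))
    obtain ⟨β, hβ⟩ := Submodule.mem_span_singleton.mp ((hφ _).mp (hx (b j)))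
    have hα0 : α ≠ 0 := by rintro rfl; rw [zero_smul] at hα; exact hne hα.symm
    have : mulForm π (b i₀) (b j) = (β / α) • mulForm π (b i₀) (b i) := by
      rw [← hα, ← hβ, smul_smul, div_mul_cancel₀ _ hα0]
    rw [this]
    exact Submodule.smul_mem _ _ (Submodule.subset_span ⟨i, hi0, hij, rfl⟩)
  have hSS : ∀ i j, i ≠ i₀ → j ≠ i₀ → S i → S j → i = j := fun i j hi hj hSi hSj =>
    le_antisymm (not_lt.mp (hS j i hj hSj hSi)) (not_lt.mp (hS i j hi hSi hSj))
  let A : Fin n → Fin n → Prop := fun i j => (i = i₀ ∧ j ≠ i₀ ∧ S j) ∨ (i = i₁ ∧ j = i₂)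
  refine isGQuadratic_of_squarefree hπ b (fun i => if i = i₀ then 0 else n + (i : ℕ))
    (fun i j => A i j ∨ A j i) ?_ ?_ ?_
  · intro i j hM
    simp only [A] at hM
    push Not at hM
    by_cases hi : i = i₀
    · by_cases hj : j = i₀
      · rw [hi, hj, ← mulForm_apply, hxx]; exact Submodule.zero_mem _
      · subst hi
        exact span_singleton_lower b hj (not_not.mp (hM.1.1 rfl hj))
    · by_cases hj : j = i₀
      · subst hj
        rw [mul_comm]
        simp_rw [add_comm (if i = i₀ then 0 else _)]
        exact span_singleton_lower b hi (not_not.mp (hM.2.1 rfl hi))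
      · rw [← mulForm_apply]
        -- Among products without x, u² has the least weight and uv the next. By the choice of u, u²
        -- lies on the line of x s; any other product is a multiple of uv modulo that line. The
        -- standard pairs are thus uv and at most one x b_j: two edges, no triangle.
        by_cases h11 : i = i₁ ∧ j = i₁
        · obtain ⟨rfl, rfl⟩ := h11
          obtain ⟨α, hα⟩ := Submodule.mem_span_singleton.mp ((hφ _).mp huu)
          rw [← hα]
          exact Submodule.smul_mem _ _ (mulForm_mem_span_lower b v0 hi hj hxx s)
        · set t := φ (mulForm π (b i) (b j)) / φ (mulForm π (b i₁) (b i₂)) with ht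
          have h3 : φ (mulForm π (b i) (b j) - t • mulForm π (b i₁) (b i₂)) = 0 := by
            rw [map_sub, map_smul, ht, smul_eq_mul, div_mul_cancel₀ _ huv, sub_self]
          obtain ⟨α, hα⟩ := Submodule.mem_span_singleton.mp ((hφ _).mp h3)
          rw [eq_sub_iff_add_eq] at hα
          rw [← hα]
          refine Submodule.add_mem _ (Submodule.smul_mem _ _
            (mulForm_mem_span_lower b v0 hi hj hxx s)) (Submodule.smul_mem _ _ ?_)
          refine Submodule.subset_span ⟨i₁, i₂, ?_, rfl⟩
          rw [if_neg hi, if_neg hj, if_neg h10, if_neg h20, v1, v2]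
          have ni : (i : ℕ) ≠ 0 := fun h => hi (Fin.ext (h.trans v0.symm))
          have nj : (j : ℕ) ≠ 0 := fun h => hj (Fin.ext (h.trans v0.symm))
          have n11 : ¬ ((i : ℕ) = 1 ∧ (j : ℕ) = 1) := fun h =>
            h11 ⟨Fin.ext (h.1.trans v1.symm), Fin.ext (h.2.trans v1.symm)⟩
          have n12 : ¬ ((i : ℕ) = 1 ∧ (j : ℕ) = 2) := fun h =>
            hM.1.2 (Fin.ext (h.1.trans v1.symm)) (Fin.ext (h.2.trans v2.symm))
          have n21 : ¬ ((j : ℕ) = 1 ∧ (i : ℕ) = 2) := fun h =>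
            hM.2.2 (Fin.ext (h.1.trans v1.symm)) (Fin.ext (h.2.trans v2.symm))
          omega
  · rintro i (h | h) <;> rcases h with ⟨h1, h2, -⟩ | ⟨h1, h2⟩ <;> simp_all
  · have hA : ∀ i j, (A i j ∨ A j i) → i = i₀ → j ≠ i₀ ∧ S j := by
      rintro i j (h | h) rfl <;> rcases h with ⟨h1, h2, h3⟩ | ⟨h1, h2⟩
      · exact ⟨h2, h3⟩
      · exact absurd h1.symm h10
      · exact absurd rfl h2
      · exact absurd h2.symm h20
    have hA' : ∀ i j, (A i j ∨ A j i) → i ≠ i₀ → j ≠ i₀ → (i = i₁ ∧ j = i₂) ∨ (j = i₁ ∧ i = i₂) := by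
      rintro i j (h | h) hi hj <;> rcases h with ⟨h1, h2, h3⟩ | ⟨h1, h2⟩
      · exact absurd h1 hi
      · exact Or.inl ⟨h1, h2⟩
      · exact absurd h1 hj
      · exact Or.inr ⟨h1, h2⟩
    intro i j k hij hik hjk h1 h2 h3
    by_cases hi : i = i₀
    · obtain ⟨a1, a2⟩ := hA i j h1 hi
      obtain ⟨a3, a4⟩ := hA i k h2 hi
      exact hjk (hSS j k a1 a3 a2 a4)
    by_cases hj : j = i₀
    · obtain ⟨a1, a2⟩ := hA j i h1.symm hj
      obtain ⟨a3, a4⟩ := hA j k h3 hj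
      exact hik (hSS i k a1 a3 a2 a4)
    by_cases hk : k = i₀
    · obtain ⟨a1, a2⟩ := hA k i h2.symm hk
      obtain ⟨a3, a4⟩ := hA k j h3.symm hk
      exact hij (hSS i j a1 a3 a2 a4)
    have c1 := hA' i j h1 hi hj
    have c2 := hA' i k h2 hi hk
    have c3 := hA' j k h3 hj hk
    grind

end Constructions

/-! ### Pencils that contain the square of a functional -/

section RankOne

variable {K : Type*} [Field K] {n : ℕ} {V : Submodule K (MvPolynomial (Fin n) K)}

lemma eq_of_forall_basis_mul {E : Type*} [AddCommGroup E] [Module K E]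
    (b : Module.Basis (Fin n) K (Fin n → K)) {f g : MvPolynomial (Fin n) K →ₗ[K] E}
    (h : ∀ i j, f (linForm (b i) * linForm (b j)) = g (linForm (b i) * linForm (b j)))
    {q : MvPolynomial (Fin n) K} (hq : q.IsHomogeneous 2) : f q = g q := by
  have : homogeneousSubmodule (Fin n) K 2 ≤ LinearMap.eqLocus f g := by
    rw [homogeneousSubmodule_two_eq_span b, Submodule.span_le]
    rintro _ ⟨p, rfl⟩
    exact h _ _
  exact this hq

lemma coeff_X_mul_X (e : Fin n →₀ ℕ) (i j : Fin n) :
    coeff e (X i * X j : MvPolynomial (Fin n) K) =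
      if Finsupp.single i 1 + Finsupp.single j 1 = e then 1 else 0 := by
  rw [X, X, monomial_mul, coeff_monomial, one_mul]

lemma single_add_single_eq_two {i j z : Fin n} :
    Finsupp.single i 1 + Finsupp.single j 1 = Finsupp.single z 2 ↔ i = z ∧ j = z := by
  constructor
  · intro h
    have h1 := DFunLike.congr_fun h i
    have h2 := DFunLike.congr_fun h j
    simp only [Finsupp.add_apply, Finsupp.single_apply] at h1 h2
    constructor
    · by_contra hne
      simp [Ne.symm hne] at h1
    · by_contra hne
      simp [Ne.symm hne] at h2
  · rintro ⟨rfl, rfl⟩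
    rw [← Finsupp.single_add]

/-- Pure powers of a coordinate do not occur in the ideal generated by quadrics that vanish at the
corresponding coordinate point. -/
lemma coeff_single_eq_zero_of_point {f : MvPolynomial (Fin n) K →ₗ[K] K}
    (hV : ∀ v ∈ V, v.IsHomogeneous 2 ∧ f v = 0) (b : Module.Basis (Fin n) K (Fin n → K))
    {p : (Fin n → K) →ₗ[K] K} (hf : ∀ a a', mulForm f a a' = p a * p a') {z : Fin n}
    (hp : ∀ j, p (b j) = if j = z then 1 else 0) {F : MvPolynomial (Fin n) K}
    (hF : F ∈ idealOfQuadrics (inCoords b V)) (k : ℕ) : coeff (Finsupp.single z k) F = 0 := by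
  have hle : inCoords b V ≤ homogeneousSubmodule (Fin n) K 2 := inCoords_le fun v hv => (hV v hv).1
  induction hF using Submodule.span_induction generalizing k with
  | mem v hv =>
    by_cases hk : k = 2
    · subst hk
      -- In coordinates where p is dual to z, the functional f is the coefficient of z².
      have h1 : (f ∘ₗ (coordChange b).toLinearMap) v = lcoeff K (Finsupp.single z 2) v := by
        refine eq_of_forall_basis_mul (Pi.basisFun K (Fin n)) (fun i j => ?_) (hle hv)
        simp only [Pi.basisFun_apply, linForm_single, lcoeff_apply]
        have h2 : (f ∘ₗ (coordChange b).toLinearMap) (X i * X j) = mulForm f (b i) (b j) := by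
          rw [mulForm_apply, ← coordChange_X, ← coordChange_X, ← map_mul]
          rfl
        rw [h2, hf, hp, hp, coeff_X_mul_X]
        simp only [single_add_single_eq_two]
        split_ifs <;> simp_all
      rw [lcoeff_apply] at h1
      rw [← h1]
      exact (hV _ hv).2
    · exact (hle hv).coeff_eq_zero (by rwa [Finsupp.degree_single])
  | zero => simp
  | add x y _ _ hx hy => rw [coeff_add, hx, hy, add_zero]
  | smul g x _ hx =>
    rw [smul_eq_mul]
    induction g using MvPolynomial.induction_on generalizing k with
    | C c => rw [coeff_C_mul, hx, mul_zero]
    | add p q hp hq => rw [add_mul, coeff_add, hp, hq, add_zero]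
    | mul_X p i hp =>
      rw [mul_right_comm, coeff_mul_X']
      split_ifs with hi
      · have hiz : i = z := by
          by_contra hne
          simp [Ne.symm hne] at hi
        rw [hiz, ← Finsupp.single_tsub]
        exact hp _
      · rfl

/-- The point case: `V` lies in the kernel of evaluation of quadrics at a point, and the second form
has an isotropic vector outside its radical on the hyperplane of the point. -/
theorem isGQuadratic_of_point {f g : MvPolynomial (Fin n) K →ₗ[K] K}
    (hV : ∀ v, v ∈ V ↔ v.IsHomogeneous 2 ∧ f v = 0 ∧ g v = 0) {p : (Fin n → K) →ₗ[K] K}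
    (hf : ∀ a a', mulForm f a a' = p a * p a') {x y z : Fin n → K} (hx : p x = 0) (hy : p y = 0)
    (hz : p z = 1) (hxx : mulForm g x x = 0) (hxy : mulForm g x y ≠ 0) :
    IsGQuadratic (idealOfQuadrics V) := by
  have hli : LinearIndependent K ![x, y, z] := by
    rw [Fintype.linearIndependent_iff]
    intro c hc
    simp only [Fin.sum_univ_three, Matrix.cons_val] at hc
    have h1 : c 2 = 0 := by
      have := congrArg p hc
      simpa [hx, hy, hz] using this
    have h2 : c 1 = 0 := by
      have := congrArg (mulForm g x) hc
      simpa [h1, hxx, hxy] using this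
    have h3 : c 0 = 0 := by
      rw [h1, h2, zero_smul, zero_smul, add_zero, add_zero] at hc
      refine (smul_eq_zero.mp hc).resolve_right ?_
      rintro rfl
      simp at hxy
    intro i
    fin_cases i
    exacts [h3, h2, h1]
  obtain ⟨hk, b', hb'⟩ := exists_basis_extending ![x, y, z] hli
  set i₀ : Fin n := Fin.castLE hk 0
  set i₁ : Fin n := Fin.castLE hk 1
  set i₂ : Fin n := Fin.castLE hk 2
  have v0 : (i₀ : ℕ) = 0 := rfl
  have v1 : (i₁ : ℕ) = 1 := rfl
  have v2 : (i₂ : ℕ) = 2 := rfl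
  have h10 : i₁ ≠ i₀ := fun h => by have := congrArg Fin.val h; omega
  have h20 : i₂ ≠ i₀ := fun h => by have := congrArg Fin.val h; omega
  have h21 : i₂ ≠ i₁ := fun h => by have := congrArg Fin.val h; omega
  have hb0' : b' i₀ = x := hb' 0
  have hb1' : b' i₁ = y := hb' 1
  have hb2' : b' i₂ = z := hb' 2
  -- Shearing `b'` along z by this functional fixes x, y, z and makes p the coordinate function dual
  -- to z.
  have hη : (b'.coord i₂ - p) z = 0 := by
    rw [LinearMap.sub_apply, hz, ← hb2', Module.Basis.coord_apply, Module.Basis.repr_self]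
    simp
  let b := b'.map (LinearEquiv.transvection hη)
  have hb : ∀ j, b j = b' j + ((if j = i₂ then 1 else 0) - p (b' j)) • z := by
    intro j
    simp [b, LinearMap.transvection.apply, Finsupp.single_apply]
  have hb0 : b i₀ = x := by rw [hb, if_neg h20.symm, hb0', hx]; simp
  have hb1 : b i₁ = y := by rw [hb, if_neg h21.symm, hb1', hy]; simp
  have hpb : ∀ j, p (b j) = if j = i₂ then 1 else 0 := by
    intro j
    rw [hb, map_add, map_smul, hz]
    simp
  rw [← hb0] at hxx hxy
  rw [← hb1] at hxy
  have hπ : ∀ v, v ∈ V ↔ v.IsHomogeneous 2 ∧ f.prod g v = 0 := by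
    intro v
    rw [hV, LinearMap.prod_apply, Prod.ext_iff]
    exact Iff.rfl
  refine isGQuadratic_of_weights hπ b (fun i => if i = i₀ then 0 else n + (i : ℕ))
    (fun i j => (i = i₂ ∧ j = i₂) ∨ (i = i₀ ∧ j = i₁) ∨ (i = i₁ ∧ j = i₀)) ?_ ?_
  · intro i j hM
    -- Since p kills every basis vector but z, f kills all products except z²; so each product other
    -- than z² is a multiple of xy, whose weight is the least after that of x².
    have hμ : f.prod g (linForm (b i) * linForm (b j)) =
        (mulForm g (b i) (b j) / mulForm g (b i₀) (b i₁)) •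
          f.prod g (linForm (b i₀) * linForm (b i₁)) := by
      rw [LinearMap.prod_apply, LinearMap.prod_apply]
      ext
      · change mulForm f (b i) (b j) = _ • mulForm f (b i₀) (b i₁)
        rw [hf, hf, hpb, hpb, hpb, if_neg h20.symm]
        have : ¬ (i = i₂ ∧ j = i₂) := fun h => hM (Or.inl h)
        by_cases h : i = i₂ <;> simp_all
      · change mulForm g (b i) (b j) = _ • mulForm g (b i₀) (b i₁)
        rw [smul_eq_mul, div_mul_cancel₀ _ hxy]
    rw [hμ]
    by_cases h00 : i = i₀ ∧ j = i₀
    · rw [h00.1, h00.2, hxx, zero_div, zero_smul]; exact Submodule.zero_mem _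
    · refine Submodule.smul_mem _ _ (Submodule.subset_span ⟨i₀, i₁, ?_, rfl⟩)
      have hval : ∀ k : Fin n, ∀ k' : Fin n, (k : ℕ) = k' → k = k' := fun _ _ h => Fin.ext h
      have n1 : ¬ (i = i₀ ∧ j = i₁) := fun h => hM (Or.inr (Or.inl h))
      have n2 : ¬ (i = i₁ ∧ j = i₀) := fun h => hM (Or.inr (Or.inr h))
      simp only [Fin.ext_iff, v0, v1] at n1 n2 h00 ⊢
      split_ifs <;> omega
  · intro a ha hall F hF
    have h3 : ∃ i, Finsupp.single i 1 + Finsupp.single i 1 ≤ a := by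
      rcases Finsupp.exists_pairs_of_three_le_degree ha with h | ⟨i, j, k, hij, hik, hjk, m1, m2, m3⟩
      · exact h
      · have m1 := hall _ _ m1
        have m2 := hall _ _ m2
        have m3 := hall _ _ m3
        grind
    obtain ⟨i, hi⟩ := h3
    have hi2 : i = i₂ := by
      rcases hall _ _ hi with h | h | h
      · exact h.1
      · exact absurd (h.2.symm.trans h.1) h10
      · exact absurd (h.1.symm.trans h.2) h10
    have ha' : a = Finsupp.single i₂ (a i₂) := by
      ext j
      rw [Finsupp.single_apply]
      split_ifs with hj
      · rw [hj]
      · by_contra hne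
        have hle : Finsupp.single i₂ 1 + Finsupp.single j 1 ≤ a := by
          intro k
          have h2 := hi k
          rw [hi2] at h2
          simp only [Finsupp.add_apply, Finsupp.single_apply] at h2 ⊢
          by_cases hk1 : i₂ = k
          · have : ¬ j = k := fun h => hj (hk1.trans h.symm)
            simp only [hk1, this, if_true, if_false] at h2 ⊢
            omega
          · by_cases hk2 : j = k
            · subst hk2
              simp only [hk1, if_true, if_false]
              omega
            · simp [hk1, hk2]
        rcases hall _ _ hle with h | h | h
        · exact hj h.2.symm
        · exact h20 h.1
        · exact h21 h.1
    rw [ha']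
    exact coeff_single_eq_zero_of_point (fun v hv => ⟨((hV v).mp hv).1, ((hV v).mp hv).2.1⟩) b hf
      hpb hF _

/-- The monomial case: in suitable coordinates, the products outside `M` vanish and those in `M`
are independent. -/
theorem isGQuadratic_of_mulForm_eq_zero {E : Type*} [AddCommGroup E] [Module K E]
    {π : MvPolynomial (Fin n) K →ₗ[K] E} (hπ : ∀ v, v ∈ V ↔ v.IsHomogeneous 2 ∧ π v = 0)
    (b : Module.Basis (Fin n) K (Fin n → K)) (M : Fin n → Fin n → Prop)
    (h0 : ∀ i j, ¬ M i j → mulForm π (b i) (b j) = 0)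
    (hinj : ∀ v ∈ Submodule.span K {x | ∃ i j, M i j ∧ x = linForm (b i) * linForm (b j)},
      π v = 0 → v = 0) :
    IsGQuadratic (idealOfQuadrics V) := by
  refine isGQuadratic_of_monomial b M (le_antisymm ?_ ?_)
  · intro v hv
    obtain ⟨hv2, hv0⟩ := (hπ v).mp hv
    have h1 : homogeneousSubmodule (Fin n) K 2 ≤
        Submodule.span K {x | ∃ i j, ¬ M i j ∧ x = linForm (b i) * linForm (b j)} ⊔
        Submodule.span K {x | ∃ i j, M i j ∧ x = linForm (b i) * linForm (b j)} := by
      rw [homogeneousSubmodule_two_eq_span b, Submodule.span_le]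
      rintro _ ⟨⟨i, j⟩, rfl⟩
      by_cases hij : M i j
      · exact Submodule.mem_sup_right (Submodule.subset_span ⟨i, j, hij, rfl⟩)
      · exact Submodule.mem_sup_left (Submodule.subset_span ⟨i, j, hij, rfl⟩)
    obtain ⟨u, hu, t, ht, rfl⟩ := Submodule.mem_sup.mp (h1 hv2)
    have hu0 : π u = 0 := by
      have : Submodule.span K {x | ∃ i j, ¬ M i j ∧ x = linForm (b i) * linForm (b j)} ≤
          LinearMap.ker π := by
        rw [Submodule.span_le]
        rintro _ ⟨i, j, hij, rfl⟩
        exact h0 i j hij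
      exact this hu
    rw [map_add, hu0, zero_add] at hv0
    rw [hinj t ht hv0, add_zero]
    exact hu
  · rw [Submodule.span_le]
    rintro _ ⟨i, j, hij, rfl⟩
    exact (hπ _).mpr ⟨isHomogeneous_linForm_mul _ _, h0 i j hij⟩

/-- The case of two coordinates monomials that are not in `V`. -/
theorem isGQuadratic_of_two_monomials {f g : MvPolynomial (Fin n) K →ₗ[K] K}
    (hV : ∀ v, v ∈ V ↔ v.IsHomogeneous 2 ∧ f v = 0 ∧ g v = 0)
    (b : Module.Basis (Fin n) K (Fin n → K)) {i₁ j₁ i₂ j₂ : Fin n}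
    (h0 : ∀ i j, ¬ (i = i₁ ∧ j = j₁) → ¬ (i = j₁ ∧ j = i₁) → ¬ (i = i₂ ∧ j = j₂) →
      ¬ (i = j₂ ∧ j = i₂) → mulForm f (b i) (b j) = 0 ∧ mulForm g (b i) (b j) = 0)
    (hf₁ : mulForm f (b i₁) (b j₁) = 1) (hg₁ : mulForm g (b i₁) (b j₁) = 0)
    (hf₂ : mulForm f (b i₂) (b j₂) = 0) (hg₂ : mulForm g (b i₂) (b j₂) = 1) :
    IsGQuadratic (idealOfQuadrics V) := by
  have hπ : ∀ v, v ∈ V ↔ v.IsHomogeneous 2 ∧ f.prod g v = 0 := by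
    intro v
    rw [hV, LinearMap.prod_apply, Prod.ext_iff]
    exact Iff.rfl
  refine isGQuadratic_of_mulForm_eq_zero hπ b (fun i j => (i = i₁ ∧ j = j₁) ∨ (i = j₁ ∧ j = i₁) ∨
    (i = i₂ ∧ j = j₂) ∨ (i = j₂ ∧ j = i₂)) ?_ ?_
  · intro i j hM
    push Not at hM
    obtain ⟨h1, h2⟩ := h0 i j (fun h => hM.1 h.1 h.2) (fun h => hM.2.1 h.1 h.2)
      (fun h => hM.2.2.1 h.1 h.2) (fun h => hM.2.2.2 h.1 h.2)
    exact Prod.ext h1 h2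
  · intro v hv hv0
    have hv' : v ∈ Submodule.span K
        {linForm (b i₁) * linForm (b j₁), linForm (b i₂) * linForm (b j₂)} := by
      refine Submodule.span_mono ?_ hv
      rintro _ ⟨i, j, (⟨rfl, rfl⟩ | ⟨rfl, rfl⟩ | ⟨rfl, rfl⟩ | ⟨rfl, rfl⟩), rfl⟩
      · exact Or.inl rfl
      · exact Or.inl (mul_comm _ _)
      · exact Or.inr rfl
      · exact Or.inr (mul_comm _ _)
    obtain ⟨s, t, rfl⟩ := Submodule.mem_span_pair.mp hv'
    rw [mulForm_apply] at hf₁ hg₁ hf₂ hg₂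
    have h1 := congrArg Prod.fst hv0
    have h2 := congrArg Prod.snd hv0
    simp only [LinearMap.prod_apply, Function.prod] at h1 h2
    rw [map_add, map_smul, map_smul, hf₁, hf₂] at h1
    rw [map_add, map_smul, map_smul, hg₁, hg₂] at h2
    simp at h1 h2
    rw [h1, h2, zero_smul, zero_smul, add_zero]

/-- The exceptional space as the kernel of two functionals. -/
lemma mem_exceptional_span_iff (b : Module.Basis (Fin n) K (Fin n → K)) (hn : 3 ≤ n)
    {f g : MvPolynomial (Fin n) K →ₗ[K] K} {p q r : (Fin n → K) →ₗ[K] K}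
    (hf : ∀ a a', mulForm f a a' = p a * p a')
    (hg : ∀ a a', mulForm g a a' = q a * q a' + p a * r a' + r a * p a')
    (hp : ∀ j, p (b j) = if (j : ℕ) = 2 then 1 else 0)
    (hq : ∀ j, q (b j) = if (j : ℕ) = 1 then 1 else 0)
    (hr : ∀ j, r (b j) = if (j : ℕ) = 0 then 1 else 0) (v : MvPolynomial (Fin n) K) :
    v ∈ Submodule.span K ({linForm (b ⟨0, by omega⟩) ^ 2,
        linForm (b ⟨0, by omega⟩) * linForm (b ⟨1, by omega⟩),
        linForm (b ⟨1, by omega⟩) ^ 2 - linForm (b ⟨0, by omega⟩) * linForm (b ⟨2, by omega⟩),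
        linForm (b ⟨1, by omega⟩) * linForm (b ⟨2, by omega⟩)} ∪
      {q | ∃ i j : Fin n, 3 ≤ (j : ℕ) ∧ q = linForm (b i) * linForm (b j)}) ↔
      v.IsHomogeneous 2 ∧ f v = 0 ∧ g v = 0 := by
  set T := Submodule.span K ({linForm (b ⟨0, by omega⟩) ^ 2,
        linForm (b ⟨0, by omega⟩) * linForm (b ⟨1, by omega⟩),
        linForm (b ⟨1, by omega⟩) ^ 2 - linForm (b ⟨0, by omega⟩) * linForm (b ⟨2, by omega⟩),
        linForm (b ⟨1, by omega⟩) * linForm (b ⟨2, by omega⟩)} ∪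
      {q | ∃ i j : Fin n, 3 ≤ (j : ℕ) ∧ q = linForm (b i) * linForm (b j)}) with hT
  have hf' : ∀ a a', f (linForm a * linForm a') = p a * p a' := hf
  have hg' : ∀ a a', g (linForm a * linForm a') = q a * q a' + p a * r a' + r a * p a' := hg
  have hker : T ≤ homogeneousSubmodule (Fin n) K 2 ⊓ (LinearMap.ker f ⊓ LinearMap.ker g) := by
    rw [hT, Submodule.span_le]
    rintro _ ((rfl | rfl | rfl | rfl) | ⟨i, j, hj, rfl⟩)
    · rw [pow_two]
      refine ⟨isHomogeneous_linForm_mul _ _, ?_, ?_⟩ <;>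
        simp only [SetLike.mem_coe, LinearMap.mem_ker, hf', hg', hp, hq, hr] <;> norm_num
    · refine ⟨isHomogeneous_linForm_mul _ _, ?_, ?_⟩ <;>
        simp only [SetLike.mem_coe, LinearMap.mem_ker, hf', hg', hp, hq, hr] <;> norm_num
    · rw [pow_two]
      refine ⟨(isHomogeneous_linForm_mul _ _).sub (isHomogeneous_linForm_mul _ _), ?_, ?_⟩ <;>
        simp only [SetLike.mem_coe, LinearMap.mem_ker, map_sub, hf', hg', hp, hq, hr] <;> norm_num
    · refine ⟨isHomogeneous_linForm_mul _ _, ?_, ?_⟩ <;>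
        simp only [SetLike.mem_coe, LinearMap.mem_ker, hf', hg', hp, hq, hr] <;> norm_num
    · have h0 : (j : ℕ) ≠ 0 := by omega
      have h1 : (j : ℕ) ≠ 1 := by omega
      have h2 : (j : ℕ) ≠ 2 := by omega
      refine ⟨isHomogeneous_linForm_mul _ _, ?_, ?_⟩ <;>
        simp only [SetLike.mem_coe, LinearMap.mem_ker, hf', hg', hp, hq, hr, h0, h1, h2] <;> simp
  constructor
  · intro hv
    obtain ⟨h1, h2, h3⟩ := hker hv
    exact ⟨h1, h2, h3⟩
  · rintro ⟨hv, hfv, hgv⟩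
    set zz := linForm (b ⟨2, by omega⟩) * linForm (b ⟨2, by omega⟩) with hzz
    set xz := linForm (b ⟨0, by omega⟩) * linForm (b ⟨2, by omega⟩) with hxz
    -- The classes of z² and xz span the quadrics modulo T, and (f, g) takes the values (1, 0) and
    -- (0, 1) on them; hence T is the whole common kernel.
    have hle : homogeneousSubmodule (Fin n) K 2 ≤ T ⊔ Submodule.span K {zz, xz} := by
      rw [homogeneousSubmodule_two_eq_span b, Submodule.span_le]
      have key : ∀ i j : Fin n, (i : ℕ) ≤ j →
          linForm (b i) * linForm (b j) ∈ T ⊔ Submodule.span K {zz, xz} := by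
        rintro ⟨i, hi⟩ ⟨j, hj⟩ hij
        simp only at hij
        by_cases hj3 : 3 ≤ j
        · exact Submodule.mem_sup_left (Submodule.subset_span (Or.inr ⟨_, _, hj3, rfl⟩))
        · have hi3 : i < 3 := by omega
          have hj3 : j < 3 := by omega
          interval_cases j
          · interval_cases i
            exact Submodule.mem_sup_left
              (Submodule.subset_span (Or.inl (Or.inl (pow_two _).symm)))
          · interval_cases i
            · exact Submodule.mem_sup_left (Submodule.subset_span (Or.inl (Or.inr (Or.inl rfl))))
            · have h1 : linForm (b ⟨1, hi⟩) * linForm (b ⟨1, hi⟩) =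
                  (linForm (b ⟨1, hi⟩) ^ 2 - xz) + xz := by ring
              rw [h1]
              exact Submodule.add_mem_sup
                (Submodule.subset_span (Or.inl (Or.inr (Or.inr (Or.inl rfl)))))
                (Submodule.subset_span (Or.inr rfl))
          · interval_cases i
            · exact Submodule.mem_sup_right (Submodule.subset_span (Or.inr rfl))
            · exact Submodule.mem_sup_left
                (Submodule.subset_span (Or.inl (Or.inr (Or.inr (Or.inr rfl)))))
            · exact Submodule.mem_sup_right (Submodule.subset_span (Or.inl rfl))
      rintro _ ⟨⟨i, j⟩, rfl⟩
      rcases le_total (i : ℕ) j with h | h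
      · exact key i j h
      · change linForm (b i) * linForm (b j) ∈ _
        rw [mul_comm]; exact key j i h
    obtain ⟨t, ht, u, hu, rfl⟩ := Submodule.mem_sup.mp (hle hv)
    obtain ⟨α, β, rfl⟩ := Submodule.mem_span_pair.mp hu
    obtain ⟨-, h2, h3⟩ := hker ht
    rw [SetLike.mem_coe, LinearMap.mem_ker] at h2 h3
    rw [map_add, h2, map_add, map_smul, map_smul, hf', hf', hp, hp] at hfv
    rw [map_add, h3, map_add, map_smul, map_smul, hg', hg', hp, hp, hq, hq, hr, hr] at hgv
    norm_num at hfv hgv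
    rw [hfv, hgv, zero_smul, zero_smul, add_zero, add_zero]
    exact ht

/-- The coordinates x, y, z of the exceptional form are dual to r, q, p, and the t_j complete the
dual basis. -/
theorem isExceptional_of_linearIndependent {f g : MvPolynomial (Fin n) K →ₗ[K] K}
    (hV : ∀ v, v ∈ V ↔ v.IsHomogeneous 2 ∧ f v = 0 ∧ g v = 0) {p q r : (Fin n → K) →ₗ[K] K}
    (hf : ∀ a a', mulForm f a a' = p a * p a')
    (hg : ∀ a a', mulForm g a a' = q a * q a' + p a * r a' + r a * p a')
    (hli : LinearIndependent K ![r, q, p]) : IsExceptional V := by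
  obtain ⟨hn, b, hb⟩ := exists_dual_basis (K := K) (n := n) ![r, q, p] hli
  refine ⟨hn, _, isCoordinateSystem_linForm b, ?_⟩
  ext v
  rw [hV]
  refine (mem_exceptional_span_iff b hn hf hg (fun j => ?_) (fun j => ?_) (fun j => ?_) v).symm
  · have := hb 2 j
    simpa [Fin.ext_iff] using this
  · have := hb 1 j
    simpa [Fin.ext_iff] using this
  · have := hb 0 j
    simpa [Fin.ext_iff] using this

end RankOne

/-! ### Codimension at most two -/

section SmallCodimension

variable {K : Type*} [Field K] {n : ℕ} {V : Submodule K (MvPolynomial (Fin n) K)}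

lemma isGQuadratic_of_codim_zero {π : MvPolynomial (Fin n) K →ₗ[K] (Fin 0 → K)}
    (hπ : ∀ v, v ∈ V ↔ v.IsHomogeneous 2 ∧ π v = 0) : IsGQuadratic (idealOfQuadrics V) := by
  refine isGQuadratic_of_mulForm_eq_zero hπ (Pi.basisFun K (Fin n)) (fun _ _ => False)
    (fun _ _ _ => Subsingleton.elim _ _) fun v hv _ => ?_
  simpa using hv

/-- The pencil spanned by two different squares of functionals. -/
lemma isGQuadratic_of_two_squares {f g : MvPolynomial (Fin n) K →ₗ[K] K}
    (hV : ∀ v, v ∈ V ↔ v.IsHomogeneous 2 ∧ f v = 0 ∧ g v = 0) {p q : (Fin n → K) →ₗ[K] K}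
    (hf : ∀ a a', mulForm f a a' = p a * p a') (hg : ∀ a a', mulForm g a a' = q a * q a')
    (hli : LinearIndependent K ![p, q]) : IsGQuadratic (idealOfQuadrics V) := by
  obtain ⟨hk, b, hb⟩ := exists_dual_basis (K := K) (n := n) ![p, q] hli
  have h10 : Fin.castLE hk 1 ≠ Fin.castLE hk 0 := fun h => by simp at h
  have hbp : ∀ j, p (b j) = if j = Fin.castLE hk 0 then 1 else 0 := hb 0
  have hbq : ∀ j, q (b j) = if j = Fin.castLE hk 1 then 1 else 0 := hb 1
  generalize Fin.castLE hk 0 = i₀ at *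
  generalize Fin.castLE hk 1 = i₁ at *
  refine isGQuadratic_of_two_monomials hV b (i₁ := i₀) (j₁ := i₀) (i₂ := i₁) (j₂ := i₁)
    ?_ ?_ ?_ ?_ ?_
  · intro i j h1 _ h3 _
    rw [hf, hg, hbp, hbp, hbq, hbq]
    constructor
    · by_cases hi : i = i₀
      · rw [if_neg fun hj => h1 ⟨hi, hj⟩, mul_zero]
      · rw [if_neg hi, zero_mul]
    · by_cases hi : i = i₁
      · rw [if_neg fun hj => h3 ⟨hi, hj⟩, mul_zero]
      · rw [if_neg hi, zero_mul]
  · rw [hf, hbp, if_pos rfl, one_mul]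
  · rw [hg, hbq, if_neg h10.symm, zero_mul]
  · rw [hf, hbp, if_neg h10, zero_mul]
  · rw [hg, hbq, if_pos rfl, one_mul]

/-- The pencil spanned by the square of a functional and a product that it divides. -/
lemma isGQuadratic_of_square_and_product {f g : MvPolynomial (Fin n) K →ₗ[K] K}
    (hV : ∀ v, v ∈ V ↔ v.IsHomogeneous 2 ∧ f v = 0 ∧ g v = 0) {p r : (Fin n → K) →ₗ[K] K}
    (hf : ∀ a a', mulForm f a a' = p a * p a')
    (hg : ∀ a a', mulForm g a a' = p a * r a' + r a * p a')
    (hli : LinearIndependent K ![p, r]) : IsGQuadratic (idealOfQuadrics V) := by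
  obtain ⟨hk, b, hb⟩ := exists_dual_basis (K := K) (n := n) ![p, r] hli
  have h10 : Fin.castLE hk 1 ≠ Fin.castLE hk 0 := fun h => by simp at h
  have hbp : ∀ j, p (b j) = if j = Fin.castLE hk 0 then 1 else 0 := hb 0
  have hbr : ∀ j, r (b j) = if j = Fin.castLE hk 1 then 1 else 0 := hb 1
  generalize Fin.castLE hk 0 = i₀ at *
  generalize Fin.castLE hk 1 = i₁ at *
  refine isGQuadratic_of_two_monomials hV b (i₁ := i₀) (j₁ := i₀) (i₂ := i₀) (j₂ := i₁)
    ?_ ?_ ?_ ?_ ?_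
  · intro i j h1 _ h3 h4
    have e1 : p (b i) * p (b j) = 0 := by
      rw [hbp, hbp]
      by_cases hi : i = i₀
      · rw [if_neg fun hj => h1 ⟨hi, hj⟩, mul_zero]
      · rw [if_neg hi, zero_mul]
    have e2 : p (b i) * r (b j) = 0 := by
      rw [hbp, hbr]
      by_cases hi : i = i₀
      · rw [if_neg fun hj => h3 ⟨hi, hj⟩, mul_zero]
      · rw [if_neg hi, zero_mul]
    have e3 : r (b i) * p (b j) = 0 := by
      rw [hbp, hbr]
      by_cases hi : i = i₁
      · rw [if_neg fun hj => h4 ⟨hi, hj⟩, mul_zero]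
      · rw [if_neg hi, zero_mul]
    rw [hf, hg, e1, e2, e3, add_zero]
    exact ⟨rfl, rfl⟩
  · rw [hf, hbp, if_pos rfl, one_mul]
  · rw [hg, hbr, if_neg h10.symm, mul_zero, zero_mul, add_zero]
  · rw [hf, hbp, hbp, if_neg h10, mul_zero]
  · rw [hg, hbp, hbp, hbr, hbr, if_pos rfl, if_pos rfl, if_neg h10, mul_zero, add_zero, one_mul]

/-- Three cases for the pencil of p² and q² + 2pr, in polarized form. If q = 0, it is spanned by p²
and pr. If r is a multiple of q, completing the square leaves two squares. Otherwise p, q, r are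
independent, where z serves to separate p from q and r. -/
lemma isGQuadratic_or_isExceptional_of_normal_form {f g : MvPolynomial (Fin n) K →ₗ[K] K}
    (hV : ∀ v, v ∈ V ↔ v.IsHomogeneous 2 ∧ f v = 0 ∧ g v = 0) {p q r : (Fin n → K) →ₗ[K] K}
    (hf : ∀ a a', mulForm f a a' = p a * p a')
    (hg : ∀ a a', mulForm g a a' = q a * q a' + p a * r a' + r a * p a')
    {z : Fin n → K} (hz : p z = 1) (hqz : q z = 0) (hrz : r z = 0)
    (hne : ∃ a b, mulForm g a b ≠ 0) :
    IsGQuadratic (idealOfQuadrics V) ∨ IsExceptional V := by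
  by_cases hq0 : q = 0
  · left
    have hr0 : r ≠ 0 := by
      intro hr0
      obtain ⟨a, b, hab⟩ := hne
      apply hab
      rw [hg, hq0, hr0]
      simp
    have hli : LinearIndependent K ![p, r] := by
      rw [LinearIndependent.pair_iff]
      intro s t hst
      have h1 := DFunLike.congr_fun hst z
      simp [hz, hrz] at h1
      rw [h1, zero_smul, zero_add] at hst
      exact ⟨h1, (smul_eq_zero.mp hst).resolve_right hr0⟩
    exact isGQuadratic_of_square_and_product hV hf (fun a b => by rw [hg, hq0]; simp) hli
  by_cases hrq : ∃ c : K, r = c • q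
  · left
    obtain ⟨c, hc⟩ := hrq
    -- Completing the square, without division by two: for r = c q, adding c² p² to g gives (q + c
    -- p)².
    set q' := q + c • p with hq'
    set h₀ := g + (c ^ 2) • f with hg₁
    have hg₁m : ∀ a b, mulForm h₀ a b = q' a * q' b := by
      intro a b
      have h1 : mulForm h₀ a b = mulForm g a b + c ^ 2 * mulForm f a b := rfl
      rw [h1, hg, hf, hc]
      simp only [q', LinearMap.add_apply, LinearMap.smul_apply, smul_eq_mul]
      ring
    have hV' : ∀ v, v ∈ V ↔ v.IsHomogeneous 2 ∧ f v = 0 ∧ h₀ v = 0 := by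
      intro v
      rw [hV, hg₁, LinearMap.add_apply, LinearMap.smul_apply, smul_eq_mul]
      constructor
      · rintro ⟨h1, h2, h3⟩; exact ⟨h1, h2, by rw [h2, h3]; ring⟩
      · rintro ⟨h1, h2, h3⟩; exact ⟨h1, h2, by rw [h2] at h3; linear_combination h3⟩
    have hli : LinearIndependent K ![p, q'] := by
      rw [LinearIndependent.pair_iff]
      intro s t hst
      have h1 := DFunLike.congr_fun hst z
      simp [q', hz, hqz] at h1
      have ht : t • q = 0 := by
        have : t • q = (s • p + t • q') - (s + t * c) • p := by
          rw [hq', smul_add, smul_smul, add_smul]; abel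
        rw [this, hst, h1, zero_smul, sub_zero]
      have ht0 := (smul_eq_zero.mp ht).resolve_right hq0
      rw [ht0, zero_mul, add_zero] at h1
      exact ⟨h1, ht0⟩
    exact isGQuadratic_of_two_squares hV' hf hg₁m hli
  · right
    refine isExceptional_of_linearIndependent hV hf hg (r := r) ?_
    rw [Fintype.linearIndependent_iff]
    intro c hc
    simp only [Fin.sum_univ_three, Matrix.cons_val] at hc
    have h2 : c 2 = 0 := by
      have := DFunLike.congr_fun hc z
      simpa [hz, hqz, hrz] using this
    rw [h2, zero_smul, add_zero] at hc
    have h0 : c 0 = 0 := by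
      by_contra h0
      refine hrq ⟨-(c 1 / c 0), ?_⟩
      refine LinearMap.ext fun a => ?_
      have ha : c 0 * r a + c 1 * q a = 0 := DFunLike.congr_fun hc a
      rw [LinearMap.smul_apply, smul_eq_mul]
      field_simp
      linear_combination ha
    rw [h0, zero_smul, zero_add] at hc
    have h1 := (smul_eq_zero.mp hc).resolve_right hq0
    intro i
    fin_cases i
    exacts [h0, h1, h2]

variable [IsAlgClosed K]

/-- An isotropic x outside the radical generates the line R_2. Otherwise the form is q², and V is
spanned by all products except the square of the coordinate dual to q. -/
lemma isGQuadratic_of_codim_one {π : MvPolynomial (Fin n) K →ₗ[K] (Fin 1 → K)}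
    (hπ : ∀ v, v ∈ V ↔ v.IsHomogeneous 2 ∧ π v = 0) (hs : ∀ y, ∃ q, q.IsHomogeneous 2 ∧ π q = y) :
    IsGQuadratic (idealOfQuadrics V) := by
  set θ : (Fin 1 → K) →ₗ[K] K := LinearMap.proj 0 with hθ
  have hθ' : ∀ y, θ y = y 0 := fun _ => rfl
  rcases isotropic_or_square (mulForm (θ ∘ₗ π)) (mulForm_comm _) with ⟨x, y, hxx, hxy⟩ | ⟨q, hq⟩
  · rw [mulForm_comp, hθ'] at hxx hxy
    refine isGQuadratic_of_generator hπ (x := x) ?_ ?_ fun a b =>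
      ⟨(mulForm π a b 0 / mulForm π x y 0) • y, ?_⟩
    · rintro rfl; simp at hxy
    · ext i; rw [Subsingleton.elim i 0, hxx]; rfl
    · ext i
      rw [Subsingleton.elim i 0, map_smul, Pi.smul_apply, smul_eq_mul, div_mul_cancel₀ _ hxy]
  · have hq0 : q ≠ 0 := by
      rintro rfl
      obtain ⟨f, hf, hf1⟩ := hs 1
      have h1 : (θ ∘ₗ π) f = (0 : MvPolynomial (Fin n) K →ₗ[K] K) f :=
        eq_of_forall_linForm_mul (fun a b => (hq a b).trans (by simp)) hf
      rw [LinearMap.comp_apply, hf1, hθ'] at h1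
      simp at h1
    obtain ⟨hk, b, hb⟩ := exists_dual_basis (K := K) (n := n) ![q]
      (LinearIndependent.of_subsingleton 0 hq0)
    set i₀ : Fin n := Fin.castLE hk 0
    have hb' : ∀ j, q (b j) = if j = i₀ then 1 else 0 := hb 0
    have hμ : ∀ i j, mulForm π (b i) (b j) 0 = q (b i) * q (b j) := fun i j => hq _ _
    refine isGQuadratic_of_mulForm_eq_zero hπ b (fun i j => i = i₀ ∧ j = i₀) ?_ ?_
    · intro i j hij
      ext k
      rw [Subsingleton.elim k 0, hμ, hb', hb']
      by_cases h : i = i₀ <;> simp_all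
    · intro v hv hv0
      have hv' : v ∈ Submodule.span K {linForm (b i₀) * linForm (b i₀)} := by
        refine Submodule.span_mono ?_ hv
        rintro _ ⟨i, j, ⟨rfl, rfl⟩, rfl⟩
        rfl
      obtain ⟨s, rfl⟩ := Submodule.mem_span_singleton.mp hv'
      have h1 := congrFun hv0 0
      rw [map_smul, ← mulForm_apply, Pi.smul_apply, hμ, hb', if_pos rfl] at h1
      simp at h1
      rw [h1, zero_smul]

/-- Codimension two, when the pencil of bilinear forms contains a form of rank one. -/
theorem isGQuadratic_or_isExceptional_of_rank_one {f g : MvPolynomial (Fin n) K →ₗ[K] K}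
    (hV : ∀ v, v ∈ V ↔ v.IsHomogeneous 2 ∧ f v = 0 ∧ g v = 0)
    (hind : ∀ s t : K, (∀ a b, s * mulForm f a b + t * mulForm g a b = 0) → s = 0 ∧ t = 0)
    {p : (Fin n → K) →ₗ[K] K} (hf : ∀ a a', mulForm f a a' = p a * p a') :
    IsGQuadratic (idealOfQuadrics V) ∨ IsExceptional V := by
  obtain ⟨z, hz⟩ : ∃ z, p z = 1 := by
    have hp : p ≠ 0 := by
      rintro rfl
      have := (hind 1 0 fun a b => by rw [hf]; simp).1
      exact one_ne_zero this
    obtain ⟨z₀, hz₀⟩ := DFunLike.ne_iff.mp hp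
    rw [LinearMap.zero_apply] at hz₀
    exact ⟨(p z₀)⁻¹ • z₀, by rw [map_smul, smul_eq_mul, inv_mul_cancel₀ hz₀]⟩
  -- The projection to the hyperplane p = 0 along z.
  let P : (Fin n → K) →ₗ[K] (Fin n → K) := LinearMap.id - p.smulRight z
  have hP : ∀ a, P a = a - p a • z := fun a => rfl
  have hpP : ∀ a, p (P a) = 0 := fun a => by rw [hP, map_sub, map_smul, hz]; simp
  have hPz : P z = 0 := by rw [hP, hz, one_smul, sub_self]
  have hP' : ∀ a, a = P a + p a • z := fun a => by rw [hP, sub_add_cancel]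
  rcases isotropic_or_square ((mulForm g).compl₁₂ P P) (fun a b => mulForm_comm _ _ _) with
    ⟨x, y, hxx, hxy⟩ | ⟨q, hq⟩
  · exact Or.inl (isGQuadratic_of_point hV hf (hpP x) (hpP y) hz hxx hxy)
  have hq' : ∀ a b, mulForm g (P a) (P b) = q a * q b := hq
  have hqz : q z = 0 := by
    have := hq' z z
    rw [hPz, map_zero] at this
    simpa using this.symm
  set r : (Fin n → K) →ₗ[K] K := mulForm g z ∘ₗ P with hr
  have hr' : ∀ a, r a = mulForm g z (P a) := fun _ => rfl
  have hrz : r z = 0 := by rw [hr', hPz, map_zero]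
  -- Subtracting a multiple of p² removes the value at (z, z), which leaves q² on the hyperplane and
  -- the mixed terms in p and r.
  set g' := g - (mulForm g z z) • f with hg'
  have hmul : ∀ (s t : K) (a b : Fin n → K),
      mulForm (s • f + t • g) a b = s * mulForm f a b + t * mulForm g a b := fun _ _ _ _ => rfl
  have hg'm : ∀ a b, mulForm g' a b = q a * q b + p a * r b + r a * p b := by
    intro a b
    have h1 : mulForm g' a b = mulForm g a b - mulForm g z z * mulForm f a b := rfl
    rw [h1, hf, ← hq', hr', hr']
    conv_lhs => rw [hP' a, hP' b]
    simp only [map_add, map_smul, LinearMap.add_apply, LinearMap.smul_apply, smul_eq_mul, hpP, hz,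
      mulForm_comm g (P a) z]
    ring
  have hV' : ∀ v, v ∈ V ↔ v.IsHomogeneous 2 ∧ f v = 0 ∧ g' v = 0 := by
    intro v
    rw [hV, hg', LinearMap.sub_apply, LinearMap.smul_apply, smul_eq_mul]
    constructor
    · rintro ⟨h1, h2, h3⟩; exact ⟨h1, h2, by rw [h2, h3]; ring⟩
    · rintro ⟨h1, h2, h3⟩; exact ⟨h1, h2, by rw [h2] at h3; linear_combination h3⟩
  refine isGQuadratic_or_isExceptional_of_normal_form hV' hf hg'm hz hqz hrz ?_
  by_contra hcon
  push Not at hcon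
  have := (hind (-(mulForm g z z)) 1 fun a b => by
    have h2 : mulForm g a b - mulForm g z z * mulForm f a b = 0 := hcon a b
    linear_combination h2).2
  exact one_ne_zero this

/-- In a pencil of bilinear forms without forms of rank at most one, some common isotropic vector is
outside the common radical. -/
lemma exists_isotropic_notMem_radical {W : Type*} [AddCommGroup W] [Module K W]
    {B₁ B₂ : W →ₗ[K] W →ₗ[K] K} (h₁ : ∀ a b, B₁ a b = B₁ b a) (h₂ : ∀ a b, B₂ a b = B₂ b a)
    (hrk : ∀ s t : K, (s ≠ 0 ∨ t ≠ 0) →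
      ¬ ∃ q : W →ₗ[K] K, ∀ a b, s * B₁ a b + t * B₂ a b = q a * q b) :
    ∃ x, B₁ x x = 0 ∧ B₂ x x = 0 ∧ ∃ a, B₁ x a ≠ 0 ∨ B₂ x a ≠ 0 := by
  obtain ⟨x, y₀, hxx, hxy₀⟩ := (isotropic_or_square B₁ h₁).resolve_right fun ⟨q, hq⟩ =>
    hrk 1 0 (Or.inl one_ne_zero) ⟨q, fun a b => by rw [← hq]; ring⟩
  let N : Submodule K W := LinearMap.ker B₁ ⊓ LinearMap.ker B₂
  have hN : ∀ x, x ∉ N → ∃ a, B₁ x a ≠ 0 ∨ B₂ x a ≠ 0 := by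
    intro x hx
    by_contra hcon
    push Not at hcon
    exact hx ⟨LinearMap.ext fun a => (hcon a).1, LinearMap.ext fun a => (hcon a).2⟩
  have hN₁ : ∀ m ∈ N, ∀ a, B₁ m a = 0 := fun m hm a => by
    have : B₁ m = 0 := hm.1
    rw [this]; rfl
  have hN₂ : ∀ m ∈ N, ∀ a, B₂ m a = 0 := fun m hm a => by
    have : B₂ m = 0 := hm.2
    rw [this]; rfl
  -- The vectors x and y₀ are independent modulo the common radical N, so the question is whether
  -- W/N has dimension two or more. In dimension two a member of the pencil degenerates to rank one;
  -- in larger dimension two conics meet.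
  by_cases hspan : ∀ a, a ∈ N ⊔ Submodule.span K {x, y₀}
  · by_cases hα : B₂ x x = 0
    · exact ⟨x, hxx, hα, y₀, Or.inl hxy₀⟩
    exfalso
    -- a form of rank one on the plane spanned by `x` and `y`
    set y := y₀ - (B₂ x y₀ / B₂ x x) • x with hy
    have hxy2 : B₂ x y = 0 := by
      rw [hy, map_sub, map_smul, smul_eq_mul, div_mul_cancel₀ _ hα, sub_self]
    have hyx2 : B₂ y x = 0 := by rw [h₂, hxy2]
    have hxy1 : B₁ x y ≠ 0 := by
      rw [hy, map_sub, map_smul, hxx, smul_zero, sub_zero]; exact hxy₀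
    -- look for `u = y - s x` in the radical of a form of the pencil
    obtain ⟨r, hr⟩ : ∃ r, (B₁ x y) ^ 2 * (r * r) + (-(B₂ x x * B₁ y y)) * r +
        (-(B₂ x x * B₂ y y)) = 0 := by
      obtain ⟨r, hr⟩ := IsAlgClosed.exists_root
        (Polynomial.C ((B₁ x y) ^ 2) * Polynomial.X ^ 2 +
          Polynomial.C (-(B₂ x x * B₁ y y)) * Polynomial.X + Polynomial.C (-(B₂ x x * B₂ y y)))
        (by
          rw [Polynomial.degree_quadratic (pow_ne_zero 2 hxy1)]
          norm_num)
      refine ⟨r, ?_⟩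
      simp only [Polynomial.IsRoot.def, Polynomial.eval_add, Polynomial.eval_mul, Polynomial.eval_C,
        Polynomial.eval_pow, Polynomial.eval_X] at hr
      linear_combination hr
    set B := r • B₁ + B₂ with hB
    have hB' : ∀ a b, B a b = r * B₁ a b + B₂ a b := fun _ _ => rfl
    have hBs : ∀ a b, B a b = B b a := fun a b => by rw [hB', hB', h₁, h₂]
    have hBxx : B x x = B₂ x x := by rw [hB', hxx]; ring
    obtain ⟨ρ, hρ⟩ := IsAlgClosed.exists_pow_nat_eq (B x x) two_pos
    have hρ0 : ρ ≠ 0 := by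
      rintro rfl
      rw [hBxx] at hρ
      apply hα
      rw [← hρ]; ring
    have hBxx0 : B x x ≠ 0 := by rw [hBxx]; exact hα
    -- The root r was chosen so that the determinant of r B₁ + B₂ on the plane of x and y vanishes.
    -- As B(x, x) ≠ 0, B is then a multiple of the square of B(x, ·).
    have hcr : ∀ a b, B x x * B a b = B x a * B x b := by
      have hNB : ∀ m ∈ N, ∀ a, B m a = 0 := fun m hm a => by
        rw [hB', hN₁ m hm, hN₂ m hm]; ring
      have hNB' : ∀ m ∈ N, ∀ a, B a m = 0 := fun m hm a => by rw [hBs, hNB m hm]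
      have hyy : B x x * B y y = B x y * B x y := by
        rw [hBxx, hB', hB', hxy2]
        linear_combination -hr
      have hdec : ∀ a, ∃ m ∈ N, ∃ s t : K, a = m + (s • x + t • y) := by
        intro a
        obtain ⟨m, hm, u, hu, rfl⟩ := Submodule.mem_sup.mp (hspan a)
        obtain ⟨s, t, rfl⟩ := Submodule.mem_span_pair.mp hu
        refine ⟨m, hm, s + t * (B₂ x y₀ / B₂ x x), t, ?_⟩
        rw [hy, smul_sub, smul_smul, add_smul]
        abel
      intro a b
      obtain ⟨m, hm, s, t, rfl⟩ := hdec a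
      obtain ⟨m', hm', s', t', rfl⟩ := hdec b
      simp only [map_add, map_smul, LinearMap.add_apply, LinearMap.smul_apply, smul_eq_mul,
        hNB m hm, hNB' m hm, hNB' m' hm', hBs y x]
      linear_combination (t * t') * hyy
    refine hrk r 1 (Or.inr one_ne_zero) ⟨ρ⁻¹ • B x, fun a b => ?_⟩
    have h := hcr a b
    rw [← hρ, hB' a b] at h
    rw [LinearMap.smul_apply, LinearMap.smul_apply, smul_eq_mul, smul_eq_mul]
    field_simp
    linear_combination h
  · push Not at hspan
    obtain ⟨w, hw⟩ := hspan
    set v : Fin 3 → W := ![x, y₀, w] with hv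
    let T : (Fin 3 → K) →ₗ[K] W := Fintype.linearCombination K v
    -- Two quadratic forms on the span of x, y₀, w; these are independent modulo N, so a nontrivial
    -- zero stays outside N.
    obtain ⟨c, hc, hiso⟩ := exists_isotropic (K := K) (n := 3) (c := 2) (by norm_num)
      ![B₁.compl₁₂ T T, B₂.compl₁₂ T T]
    have hT : T c = c 0 • x + c 1 • y₀ + c 2 • w := by
      simp [T, Fintype.linearCombination_apply, Fin.sum_univ_three, hv]
    refine ⟨T c, hiso 0, hiso 1, hN _ fun hmem => hc ?_⟩
    rw [hT] at hmem
    have h2 : c 2 = 0 := by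
      by_contra h2
      apply hw
      have : w = (c 2)⁻¹ • (c 0 • x + c 1 • y₀ + c 2 • w) +
          (-((c 2)⁻¹ * c 0) • x + -((c 2)⁻¹ * c 1) • y₀) := by
        rw [smul_add, smul_add, smul_smul, smul_smul, smul_smul, inv_mul_cancel₀ h2, one_smul,
          neg_smul, neg_smul]
        abel
      rw [this]
      exact Submodule.add_mem_sup (N.smul_mem _ hmem) (Submodule.mem_span_pair.mpr ⟨_, _, rfl⟩)
    rw [h2, zero_smul, add_zero] at hmem
    have h1 : c 1 = 0 := by
      have := hN₁ _ hmem x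
      rw [map_add, map_smul, map_smul, LinearMap.add_apply, LinearMap.smul_apply,
        LinearMap.smul_apply, hxx, smul_zero, zero_add, h₁ y₀ x, smul_eq_mul] at this
      exact (mul_eq_zero.mp this).resolve_right hxy₀
    rw [h1, zero_smul, add_zero] at hmem
    have h0 : c 0 = 0 := by
      have := hN₁ _ hmem y₀
      rw [map_smul, LinearMap.smul_apply, smul_eq_mul] at this
      exact (mul_eq_zero.mp this).resolve_right hxy₀
    ext i
    fin_cases i
    exacts [h0, h1, h2]

/-- Codimension two: a space of quadrics is exceptional or defines a G-quadratic algebra. -/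
theorem isGQuadratic_or_isExceptional_of_codim_two {π : MvPolynomial (Fin n) K →ₗ[K] (Fin 2 → K)}
    (hπ : ∀ v, v ∈ V ↔ v.IsHomogeneous 2 ∧ π v = 0) (hs : ∀ y, ∃ q, q.IsHomogeneous 2 ∧ π q = y) :
    IsGQuadratic (idealOfQuadrics V) ∨ IsExceptional V := by
  set f₁ : MvPolynomial (Fin n) K →ₗ[K] K := LinearMap.proj 0 ∘ₗ π with hf₁
  set f₂ : MvPolynomial (Fin n) K →ₗ[K] K := LinearMap.proj 1 ∘ₗ π with hf₂
  have hm₁ : ∀ a b, mulForm f₁ a b = mulForm π a b 0 := fun _ _ => rfl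
  have hm₂ : ∀ a b, mulForm f₂ a b = mulForm π a b 1 := fun _ _ => rfl
  have hV : ∀ v, v ∈ V ↔ v.IsHomogeneous 2 ∧ f₁ v = 0 ∧ f₂ v = 0 := by
    intro v
    rw [hπ]
    refine and_congr_right fun _ => ⟨fun h => ?_, fun h => ?_⟩
    · simp [f₁, f₂, h]
    · ext i
      fin_cases i
      exacts [h.1, h.2]
  have hind : ∀ s t : K, (∀ a b, s * mulForm f₁ a b + t * mulForm f₂ a b = 0) → s = 0 ∧ t = 0 := by
    intro s t h
    have key : ∀ y : Fin 2 → K, s * y 0 + t * y 1 = 0 := by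
      intro y
      obtain ⟨q, hq, rfl⟩ := hs y
      have : (s • f₁ + t • f₂) q = (0 : MvPolynomial (Fin n) K →ₗ[K] K) q :=
        eq_of_forall_linForm_mul (fun a b => h a b) hq
      exact this
    have h0 := key ![1, 0]
    have h1 := key ![0, 1]
    simp at h0 h1
    exact ⟨h0, h1⟩
  by_cases hrk : ∃ s t : K, (s ≠ 0 ∨ t ≠ 0) ∧
      ∃ q : (Fin n → K) →ₗ[K] K, ∀ a b, s * mulForm f₁ a b + t * mulForm f₂ a b = q a * q b
  · obtain ⟨s, t, hst, q, hq⟩ := hrk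
    have hq' : ∀ a b, mulForm (s • f₁ + t • f₂) a b = q a * q b := hq
    -- The square replaces one of the two generators of the pencil; the other generator is kept.
    by_cases hs0 : s = 0
    · have ht0 : t ≠ 0 := hst.resolve_left (not_not.mpr hs0)
      refine isGQuadratic_or_isExceptional_of_rank_one (f := s • f₁ + t • f₂) (g := f₁) ?_ ?_ hq'
      · intro v
        rw [hV]
        refine and_congr_right fun _ => ?_
        simp only [LinearMap.add_apply, LinearMap.smul_apply, smul_eq_mul, hs0, zero_mul, zero_add,
          mul_eq_zero, ht0, false_or]
        exact and_comm
      · intro α β h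
        have := hind β (α * t) fun a b => by
          have h1 := h a b
          have h2 : mulForm (s • f₁ + t • f₂) a b = s * mulForm f₁ a b + t * mulForm f₂ a b := rfl
          rw [h2, hs0] at h1
          linear_combination h1
        exact ⟨(mul_eq_zero.mp this.2).resolve_right ht0, this.1⟩
    · refine isGQuadratic_or_isExceptional_of_rank_one (f := s • f₁ + t • f₂) (g := f₂) ?_ ?_ hq'
      · intro v
        rw [hV]
        refine and_congr_right fun _ => ?_
        simp only [LinearMap.add_apply, LinearMap.smul_apply, smul_eq_mul]
        constructor
        · rintro ⟨h1, h2⟩; simp [h1, h2]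
        · rintro ⟨h1, h2⟩
          rw [h2, mul_zero, add_zero] at h1
          exact ⟨(mul_eq_zero.mp h1).resolve_left hs0, h2⟩
      · intro α β h
        have := hind (α * s) (α * t + β) fun a b => by
          have h1 := h a b
          have h2 : mulForm (s • f₁ + t • f₂) a b = s * mulForm f₁ a b + t * mulForm f₂ a b := rfl
          rw [h2] at h1
          linear_combination h1
        have hα := (mul_eq_zero.mp this.1).resolve_right hs0
        refine ⟨hα, ?_⟩
        have h3 := this.2
        rwa [hα, zero_mul, zero_add] at h3
  left
  push Not at hrk
  have hrk' : ∀ s t : K, (s ≠ 0 ∨ t ≠ 0) → ¬ ∃ q : (Fin n → K) →ₗ[K] K,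
      ∀ a b, s * mulForm f₁ a b + t * mulForm f₂ a b = q a * q b := by
    rintro s t hst ⟨q, hq⟩
    obtain ⟨a, b, hab⟩ := hrk s t hst q
    exact hab (hq a b)
  obtain ⟨x, hx1, hx2, a, ha⟩ :=
    exists_isotropic_notMem_radical (mulForm_comm f₁) (mulForm_comm f₂) hrk'
  have hx0 : x ≠ 0 := by rintro rfl; simp at ha
  have hxx : mulForm π x x = 0 := by
    ext i; fin_cases i
    exacts [hx1, hx2]
  by_cases hsurj : ∀ y, ∃ u, y = mulForm π x u
  · exact isGQuadratic_of_generator hπ hx0 hxx fun a b => hsurj _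
  -- the products with `x` lie on the line spanned by `e = x * a`
  set e := mulForm π x a with he
  have he0 : e 0 ≠ 0 ∨ e 1 ≠ 0 := ha
  let φ : (Fin 2 → K) →ₗ[K] K := e 1 • LinearMap.proj 0 - e 0 • LinearMap.proj 1
  have hφ' : ∀ y, φ y = e 1 * y 0 - e 0 * y 1 := fun _ => rfl
  have hφ : ∀ y, φ y = 0 ↔ y ∈ Submodule.span K {e} := by
    intro y
    rw [Submodule.mem_span_singleton, hφ']
    constructor
    · intro h
      rcases he0 with h0 | h0
      · refine ⟨y 0 / e 0, ?_⟩
        ext i; fin_cases i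
        · simp [h0]
        · simp; field_simp; linear_combination h
      · refine ⟨y 1 / e 1, ?_⟩
        ext i; fin_cases i
        · simp; field_simp; linear_combination -h
        · simp [h0]
    · rintro ⟨s, rfl⟩; simp; ring
  -- A product x u off the line of e would span R_2 together with e, and x would generate R_2.
  have hx : ∀ u, φ (mulForm π x u) = 0 := by
    intro u
    by_contra hu
    apply hsurj
    intro y
    set t := φ y / φ (mulForm π x u)
    have h1 : φ (y - t • mulForm π x u) = 0 := by
      rw [map_sub, map_smul, smul_eq_mul, div_mul_cancel₀ _ hu, sub_self]
    obtain ⟨s, hs⟩ := Submodule.mem_span_singleton.mp ((hφ _).mp h1)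
    refine ⟨s • a + t • u, ?_⟩
    rw [map_add, map_smul, map_smul, ← he, hs, sub_add_cancel]
  -- The form modulo e is the member of the pencil with coefficients e 1 and -e 0, so it is not a
  -- square.
  rcases isotropic_or_square (mulForm (φ ∘ₗ π)) (mulForm_comm _) with ⟨u, v, huu, huv⟩ | ⟨q, hq⟩
  · exact isGQuadratic_of_line hπ hx0 hxx φ hφ hx huu huv
  · exfalso
    refine hrk' (e 1) (-(e 0)) ?_ ⟨q, fun a b => ?_⟩
    · rcases he0 with h | h
      exacts [Or.inr (neg_ne_zero.mpr h), Or.inl h]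
    · have h := hq a b
      rw [mulForm_comp, hφ'] at h
      rw [← h, hm₁, hm₂]; ring

end SmallCodimension

/-! ### Multiplication in the exceptional algebra -/

section Exceptional

variable {K : Type*} [Field K] {n : ℕ} {V : Submodule K (MvPolynomial (Fin n) K)}

lemma mulForm_lcoeff_single (z : Fin n) (a a' : Fin n → K) :
    mulForm (lcoeff K (Finsupp.single z 2)) a a' = a z * a' z := by
  have : mulForm (lcoeff K (Finsupp.single z 2)) =
      (LinearMap.mul K K).compl₁₂ (LinearMap.proj z) (LinearMap.proj z) := by
    refine LinearMap.ext_basis (Pi.basisFun K (Fin n)) (Pi.basisFun K (Fin n)) fun i j => ?_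
    rw [mulForm_apply, Pi.basisFun_apply, Pi.basisFun_apply, linForm_single, linForm_single,
      lcoeff_apply, coeff_X_mul_X]
    simp only [single_add_single_eq_two, LinearMap.compl₁₂_apply, LinearMap.proj_apply,
      LinearMap.mul_apply', Pi.single_apply]
    by_cases h1 : z = i <;> by_cases h2 : z = j <;> simp_all [eq_comm]
  rw [this]
  rfl

lemma mulForm_lcoeff_add {x z : Fin n} (hxz : x ≠ z) (a a' : Fin n → K) :
    mulForm (lcoeff K (Finsupp.single x 1 + Finsupp.single z 1)) a a' =
      a z * a' x + a x * a' z := by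
  have : mulForm (lcoeff K (Finsupp.single x 1 + Finsupp.single z 1)) =
      (LinearMap.mul K K).compl₁₂ (LinearMap.proj z) (LinearMap.proj x) +
      (LinearMap.mul K K).compl₁₂ (LinearMap.proj x) (LinearMap.proj z) := by
    refine LinearMap.ext_basis (Pi.basisFun K (Fin n)) (Pi.basisFun K (Fin n)) fun i j => ?_
    rw [mulForm_apply, Pi.basisFun_apply, Pi.basisFun_apply, linForm_single, linForm_single,
      lcoeff_apply, coeff_X_mul_X]
    have hiff : Finsupp.single i 1 + Finsupp.single j 1 =
        Finsupp.single x 1 + Finsupp.single z 1 ↔ (i = x ∧ j = z) ∨ (i = z ∧ j = x) := by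
      constructor
      · intro h
        have h1 := DFunLike.congr_fun h x
        have h2 := DFunLike.congr_fun h z
        simp only [Finsupp.add_apply, Finsupp.single_apply] at h1 h2
        grind
      · rintro (⟨rfl, rfl⟩ | ⟨rfl, rfl⟩)
        · rfl
        · rw [add_comm]
    simp only [hiff, LinearMap.add_apply, LinearMap.compl₁₂_apply, LinearMap.proj_apply,
      LinearMap.mul_apply', Pi.single_apply]
    by_cases h1 : x = i <;> by_cases h2 : x = j <;> by_cases h3 : z = i <;> by_cases h4 : z = j <;>
      simp_all [eq_comm]
  rw [this]
  rfl

/-- An exceptional space is the common kernel of two functionals of a special form. -/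
lemma IsExceptional.exists_functionals (h : IsExceptional V) :
    ∃ (f g : MvPolynomial (Fin n) K →ₗ[K] K) (p q r : (Fin n → K) →ₗ[K] K) (x y z : Fin n → K),
      (∀ v, v ∈ V ↔ v.IsHomogeneous 2 ∧ f v = 0 ∧ g v = 0) ∧
      (∀ a a', mulForm f a a' = p a * p a') ∧
      (∀ a a', mulForm g a a' = q a * q a' + p a * r a' + r a * p a') ∧
      (p x = 0 ∧ p y = 0 ∧ p z = 1) ∧ (q x = 0 ∧ q y = 1 ∧ q z = 0) ∧
      (r x = 1 ∧ r y = 0 ∧ r z = 0) := by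
  obtain ⟨hn, ℓ, hℓ, hV⟩ := h
  obtain ⟨b, rfl⟩ := hℓ.exists_basis
  set i₀ : Fin n := ⟨0, by omega⟩ with hi₀
  set i₁ : Fin n := ⟨1, by omega⟩ with hi₁
  set i₂ : Fin n := ⟨2, by omega⟩ with hi₂
  have h02 : i₀ ≠ i₂ := fun h => by simp [i₀, i₂] at h
  let S : MvPolynomial (Fin n) K →ₗ[K] MvPolynomial (Fin n) K := (coordChange b).symm.toLinearMap
  have hS : ∀ (θ : MvPolynomial (Fin n) K →ₗ[K] K) a a',
      mulForm (θ ∘ₗ S) a a' = mulForm θ (b.equivFun a) (b.equivFun a') := by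
    intro θ a a'
    rw [mulForm_apply, mulForm_apply, ← coordChange_symm_linForm, ← coordChange_symm_linForm,
      ← map_mul (coordChange b).symm]
    rfl
  let f := lcoeff K (Finsupp.single i₂ 2) ∘ₗ S
  let g := (lcoeff K (Finsupp.single i₁ 2) +
    lcoeff K (Finsupp.single i₀ 1 + Finsupp.single i₂ 1)) ∘ₗ S
  have hf : ∀ a a', mulForm f a a' = b.coord i₂ a * b.coord i₂ a' := by
    intro a a'
    rw [hS, mulForm_lcoeff_single]
    rfl
  have hg : ∀ a a', mulForm g a a' =
      b.coord i₁ a * b.coord i₁ a' + b.coord i₂ a * b.coord i₀ a' + b.coord i₀ a * b.coord i₂ a' := by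
    intro a a'
    have h1 : mulForm g a a' =
        mulForm (lcoeff K (Finsupp.single i₁ 2)) (b.equivFun a) (b.equivFun a') +
        mulForm (lcoeff K (Finsupp.single i₀ 1 + Finsupp.single i₂ 1)) (b.equivFun a)
          (b.equivFun a') := hS _ a a'
    rw [h1, mulForm_lcoeff_single, mulForm_lcoeff_add h02, add_assoc]
    rfl
  have hco : ∀ i j, b.coord i (b j) = if (j : ℕ) = (i : ℕ) then 1 else 0 := by
    intro i j
    rw [Module.Basis.coord_apply, Module.Basis.repr_self, Finsupp.single_apply]
    simp only [Fin.ext_iff]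
  refine ⟨f, g, b.coord i₂, b.coord i₁, b.coord i₀, b i₀, b i₁, b i₂, fun v => ?_, hf, hg, ?_⟩
  · rw [hV]
    exact mem_exceptional_span_iff b hn hf hg (hco i₂) (hco i₁) (hco i₀) v
  · simp [hco, i₀, i₁, i₂]

/-- Products of three linear forms modulo the ideal of an exceptional space. -/
lemma linForm_mul_mul_sub_mem {f g : MvPolynomial (Fin n) K →ₗ[K] K}
    {p q r : (Fin n → K) →ₗ[K] K} {x y z : Fin n → K}
    (hV : ∀ v, v ∈ V ↔ v.IsHomogeneous 2 ∧ f v = 0 ∧ g v = 0)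
    (hf : ∀ a a', mulForm f a a' = p a * p a')
    (hg : ∀ a a', mulForm g a a' = q a * q a' + p a * r a' + r a * p a')
    (hp : p x = 0 ∧ p y = 0 ∧ p z = 1) (hq : q x = 0 ∧ q y = 1 ∧ q z = 0)
    (hr : r x = 1 ∧ r y = 0 ∧ r z = 0) (a b c : Fin n → K) :
    linForm a * linForm b * linForm c - (p a * p b * p c) • linForm z ^ 3 ∈ idealOfQuadrics V := by
  obtain ⟨px, py, pz⟩ := hp
  obtain ⟨qx, qy, qz⟩ := hq
  obtain ⟨rx, ry, rz⟩ := hr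
  have hf' : ∀ a a', f (linForm a * linForm a') = p a * p a' := hf
  have hg' : ∀ a a', g (linForm a * linForm a') = q a * q a' + p a * r a' + r a * p a' := hg
  -- In degree two z² and xz are dual to f and g, so f and g give the coefficients of a product in
  -- terms of them.
  have m1 : ∀ a b, linForm a * linForm b - (p a * p b) • (linForm z * linForm z) -
      (q a * q b + p a * r b + r a * p b) • (linForm x * linForm z) ∈ V := by
    intro a b
    refine (hV _).mpr ⟨?_, ?_, ?_⟩
    · exact Submodule.sub_mem (homogeneousSubmodule _ K 2) (Submodule.sub_mem _
        (isHomogeneous_linForm_mul _ _) (Submodule.smul_mem _ _ (isHomogeneous_linForm_mul _ _)))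
        (Submodule.smul_mem _ _ (isHomogeneous_linForm_mul _ _))
    · simp only [map_sub, map_smul, hf', px, pz, smul_eq_mul]; ring
    · simp only [map_sub, map_smul, hg', px, pz, qx, qz, rx, rz, smul_eq_mul]; ring
  set I := idealOfQuadrics V
  have hI : ∀ v ∈ V, ∀ s, s * v ∈ I := fun v hv s => I.mul_mem_left _ (Ideal.subset_span hv)
  have hyy := m1 y y
  have hyz := m1 y z
  simp only [py, qy, ry, mul_zero, add_zero, mul_one, zero_smul, sub_zero, one_smul] at hyy
  simp only [py, qz, ry, zero_mul, mul_zero, add_zero, zero_smul, sub_zero] at hyz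
  -- The essential relation: y(yz) - z(y² - xz) = xz². It implies that xz is killed by every linear
  -- form.
  have hxzz : linForm x * linForm z * linForm z ∈ I := by
    have := I.sub_mem (hI _ hyz (linForm y)) (hI _ hyy (linForm z))
    convert this using 1
    ring
  have hxzc : ∀ c, linForm x * linForm z * linForm c ∈ I := by
    intro c
    have h := I.add_mem (hI _ (m1 x c) (linForm z)) (I.mul_mem_left (C (p c)) hxzz)
    simp only [px, qx, rx, zero_mul, zero_add, one_mul, zero_smul, sub_zero, smul_eq_C_mul] at h
    convert h using 1
    ring
  have hzzc : ∀ c, linForm z * linForm z * linForm c - p c • linForm z ^ 3 ∈ I := by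
    intro c
    have h := I.add_mem (hI _ (m1 z c) (linForm z)) (I.mul_mem_left (C (r c)) hxzz)
    simp only [pz, qz, rz, zero_mul, one_mul, zero_add, add_zero, smul_eq_C_mul] at h
    rw [smul_eq_C_mul]
    convert h using 1
    ring
  have h := I.add_mem (I.add_mem (hI _ (m1 a b) (linForm c))
    (I.mul_mem_left (C (p a * p b)) (hzzc c)))
    (I.mul_mem_left (C (q a * q b + p a * r b + r a * p b)) (hxzc c))
  simp only [smul_eq_C_mul] at h ⊢
  rw [C_mul (a := p a * p b) (a' := p c)]
  convert h using 1
  ring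

/-- The leading exponent of an element of an ideal is divisible by one of a Gröbner basis. -/
lemma IsGroebnerBasisOf.exists_degree_le {m : MonomialOrder (Fin n)}
    {B : Set (MvPolynomial (Fin n) K)} {J : Ideal (MvPolynomial (Fin n) K)}
    (hB : IsGroebnerBasisOf m B J) {F : MvPolynomial (Fin n) K} (hF : F ∈ J) (hF0 : F ≠ 0) :
    ∃ h ∈ B, h ≠ 0 ∧ m.degree h ≤ m.degree F := by
  classical
  have h1 : m.leadingTerm F ∈ Ideal.span (m.leadingTerm '' B) := by
    rw [hB.2]; exact Ideal.subset_span ⟨F, hF, rfl⟩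
  have h2 : Ideal.span (m.leadingTerm '' B) ≤
      Ideal.span ((fun s => monomial s (1 : K)) '' (m.degree '' {h | h ∈ B ∧ h ≠ 0})) := by
    rw [Ideal.span_le]
    rintro _ ⟨h, hh, rfl⟩
    by_cases hh0 : h = 0
    · simp [hh0]
    · have : m.leadingTerm h = C (m.leadingCoeff h) * monomial (m.degree h) 1 := by
        rw [MonomialOrder.leadingTerm, C_mul_monomial, mul_one]
      rw [this]
      exact Ideal.mul_mem_left _ _ (Ideal.subset_span ⟨_, ⟨h, ⟨hh, hh0⟩, rfl⟩, rfl⟩)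
  have h3 := (mem_ideal_span_monomial_image.mp (h2 h1)) (m.degree F) (by
    rw [m.support_leadingTerm' hF0]; simp)
  obtain ⟨_, ⟨h, ⟨hh, hh0⟩, rfl⟩, hle⟩ := h3
  exact ⟨h, hh, hh0, hle⟩

end Exceptional

/-! ### Exceptional algebras are not G-quadratic -/

section NotGQuadratic

variable {K : Type*} [Field K] {n : ℕ} {V : Submodule K (MvPolynomial (Fin n) K)}

/-- The exponent of the product of two variables. -/
noncomputable def pairExp (i j : Fin n) : Fin n →₀ ℕ := Finsupp.single i 1 + Finsupp.single j 1

lemma degree_pairExp (i j : Fin n) : (pairExp i j).degree = 2 := by simp [pairExp]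

lemma pairExp_comm (i j : Fin n) : pairExp i j = pairExp j i := add_comm _ _

lemma toSyn_pairExp (m : MonomialOrder (Fin n)) (i j : Fin n) :
    m.toSyn (pairExp i j) = m.toSyn (Finsupp.single i 1) + m.toSyn (Finsupp.single j 1) :=
  map_add _ _ _

/-- An exponent of degree two is standard if it is not the leading exponent of a quadric in `V`. -/
def IsStandard (m : MonomialOrder (Fin n)) (b : Module.Basis (Fin n) K (Fin n → K))
    (V : Submodule K (MvPolynomial (Fin n) K)) (e : Fin n →₀ ℕ) : Prop :=
  e.degree = 2 ∧ ¬ ∃ h ∈ inCoords b V, h ≠ 0 ∧ m.degree h = e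

section Standard

variable {E : Type*} [AddCommGroup E] [Module K E] {π : MvPolynomial (Fin n) K →ₗ[K] E}
  {b : Module.Basis (Fin n) K (Fin n → K)} {m : MonomialOrder (Fin n)}

/-- Macaulay's argument in degree two: a nonstandard monomial is rewritten by smaller ones, and the
term order is a well-order. -/
lemma mem_span_standard_le (hπ : ∀ v, v ∈ V ↔ v.IsHomogeneous 2 ∧ π v = 0) (e : Fin n →₀ ℕ)
    (he : e.degree = 2) :
    π (coordChange b (monomial e 1)) ∈ Submodule.span K
      ((fun e' => π (coordChange b (monomial e' 1))) ''
        {s | IsStandard m b V s ∧ m.toSyn s ≤ m.toSyn e}) := by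
  induction hs : m.toSyn e using WellFoundedLT.induction generalizing e with
  | _ x ih =>
    subst hs
    by_cases hstd : IsStandard m b V e
    · exact Submodule.subset_span ⟨e, ⟨hstd, le_refl _⟩, rfl⟩
    · have h1 : ∃ h ∈ inCoords b V, h ≠ 0 ∧ m.degree h = e := by
        by_contra hcon; exact hstd ⟨he, hcon⟩
      refine Submodule.span_le.mpr ?_ ((exists_degree_eq_iff hπ b m he).mp h1)
      rintro _ ⟨e', ⟨he', hlt⟩, rfl⟩
      refine Submodule.span_mono (Set.image_mono ?_) (ih _ hlt e' he' rfl)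
      exact fun s hs => ⟨hs.1, hs.2.trans hlt.le⟩

lemma mem_span_standard_lt (hπ : ∀ v, v ∈ V ↔ v.IsHomogeneous 2 ∧ π v = 0) {e : Fin n →₀ ℕ}
    (he : e.degree = 2) (hstd : ¬ IsStandard m b V e) :
    π (coordChange b (monomial e 1)) ∈ Submodule.span K
      ((fun e' => π (coordChange b (monomial e' 1))) ''
        {s | IsStandard m b V s ∧ m.toSyn s < m.toSyn e}) := by
  refine Submodule.span_mono (Set.image_mono ?_) (mem_span_standard_le (m := m) hπ e he)
  exact fun s hs => ⟨hs.1, lt_of_le_of_ne hs.2 fun h => hstd (m.toSyn.injective h ▸ hs.1)⟩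

/-- The counterpart to the spanning lemmas: standard monomials are independent modulo V, since a
relation would make one of them a leading monomial. -/
lemma IsStandard.notMem_span (hπ : ∀ v, v ∈ V ↔ v.IsHomogeneous 2 ∧ π v = 0) {e : Fin n →₀ ℕ}
    (h : IsStandard m b V e) {T : Set (Fin n →₀ ℕ)}
    (hT : ∀ s ∈ T, s.degree = 2 ∧ m.toSyn s < m.toSyn e) :
    π (coordChange b (monomial e 1)) ∉ Submodule.span K
      ((fun e' => π (coordChange b (monomial e' 1))) '' T) := fun hmem =>
  h.2 ((exists_degree_eq_iff hπ b m h.1).mpr (Submodule.span_mono (Set.image_mono hT) hmem))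

/-- In codimension two there are no three standard exponents. -/
lemma not_three_standard (hπ : ∀ v, v ∈ V ↔ v.IsHomogeneous 2 ∧ π v = 0)
    (hE : Module.finrank K E = 2) [Module.Finite K E] {s t w : Fin n →₀ ℕ}
    (hs : IsStandard m b V s) (ht : IsStandard m b V t) (hw : IsStandard m b V w)
    (hst : m.toSyn s < m.toSyn t) (htw : m.toSyn t < m.toSyn w) : False := by
  set μ : (Fin n →₀ ℕ) → E := fun e' => π (coordChange b (monomial e' 1)) with hμ
  have h1 : μ s ≠ 0 := by
    have := hs.notMem_span hπ (T := ∅) (by simp)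
    simpa using this
  have h2 : μ t ∉ Submodule.span K {μ s} := by
    have := ht.notMem_span hπ (T := {s}) (by rintro _ rfl; exact ⟨hs.1, hst⟩)
    rwa [Set.image_singleton] at this
  have h3 : μ w ∉ Submodule.span K {μ s, μ t} := by
    have := hw.notMem_span hπ (T := {s, t}) (by
      rintro _ (rfl | rfl)
      exacts [⟨hs.1, hst.trans htw⟩, ⟨ht.1, htw⟩])
    rwa [Set.image_pair] at this
  apply h3
  have hli : LinearIndependent K ![μ s, μ t] := by
    rw [LinearIndependent.pair_iff' h1]
    exact fun c hc => h2 (Submodule.mem_span_singleton.mpr ⟨c, hc⟩)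
  have htop := hli.span_eq_top_of_card_eq_finrank' (by rw [hE, Fintype.card_fin])
  rw [Matrix.range_cons, Matrix.range_cons, Matrix.range_empty, Set.union_empty] at htop
  have : ({μ s, μ t} : Set E) = {μ s} ∪ {μ t} := rfl
  rw [this, htop]
  exact Submodule.mem_top

end Standard

/-- The algebra of the situation `u² ≻ …`: the standard exponents are `u²` and `v w`. -/
lemma mem_span_of_smaller {p q r : Fin n → K} {u v w : Fin n} {α β δ : K} (hu : p u ≠ 0)
    (h1 : p v * p v = α * (p u * p u))
    (h2 : q v * q v + p v * r v + r v * p v = α * (q u * q u + p u * r u + r u * p u))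
    (h3 : p u * p v = β * (p u * p u))
    (h4 : q u * q v + p u * r v + r u * p v = β * (q u * q u + p u * r u + r u * p u))
    (h5 : p u * p w = δ * (p u * p u))
    (h6 : q u * q w + p u * r w + r u * p w = δ * (q u * q u + p u * r u + r u * p u)) :
    p v * p w = (β * δ) * (p u * p u) ∧
      q v * q w + p v * r w + r v * p w = (β * δ) * (q u * q u + p u * r u + r u * p u) := by
  have e1 : p v = β * p u := mul_left_cancel₀ hu (by linear_combination h3)
  have e2 : α = β ^ 2 := by
    have : (p u * p u) * α = (p u * p u) * β ^ 2 := by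
      rw [e1] at h1; linear_combination -h1
    exact mul_left_cancel₀ (mul_ne_zero hu hu) this
  have e3 : (q v - β * q u) ^ 2 = 0 := by
    rw [e2, e1] at h2
    rw [e1] at h4
    linear_combination h2 - 2 * β * h4
  have e4 : q v = β * q u := sub_eq_zero.mp (pow_eq_zero_iff two_ne_zero |>.mp e3)
  have e5 : r v = β * r u := by
    rw [e1, e4] at h4
    exact mul_left_cancel₀ hu (by linear_combination h4)
  rw [e1, e4, e5]
  exact ⟨by linear_combination β * h5, by linear_combination β * h6⟩

lemma pairExp_le_iff {i j : Fin n} {a : Fin n →₀ ℕ} (h : pairExp i j ≤ a) :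
    1 ≤ a i ∧ 1 ≤ a j ∧ (i = j → 2 ≤ a i) := by
  have h1 := h i
  have h2 := h j
  simp only [pairExp, Finsupp.add_apply, Finsupp.single_apply, if_true] at h1 h2
  refine ⟨by omega, by omega, ?_⟩
  rintro rfl
  simpa using h1

lemma eq_of_pairExp_le_cube {i j u : Fin n} (h : pairExp i j ≤ pairExp u u + Finsupp.single u 1) :
    pairExp i j = pairExp u u := by
  obtain ⟨h1, h2, -⟩ := pairExp_le_iff h
  simp only [pairExp, Finsupp.add_apply, Finsupp.single_apply] at h1 h2
  have hi : i = u := by by_contra hne; simp [Ne.symm hne] at h1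
  have hj : j = u := by by_contra hne; simp [Ne.symm hne] at h2
  rw [hi, hj]

lemma eq_of_pairExp_le_square_add {i j u t : Fin n} (htu : t ≠ u)
    (h : pairExp i j ≤ pairExp u u + Finsupp.single t 1) :
    pairExp i j = pairExp u u ∨ pairExp i j = pairExp u t := by
  obtain ⟨h1, h2, h3⟩ := pairExp_le_iff h
  simp only [pairExp, Finsupp.add_apply, Finsupp.single_apply] at h1 h2 h3
  have hi : i = u ∨ i = t := by
    by_contra hne
    push Not at hne
    simp [hne.1.symm, hne.2.symm] at h1
  have hj : j = u ∨ j = t := by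
    by_contra hne
    push Not at hne
    simp [hne.1.symm, hne.2.symm] at h2
  rcases hi with rfl | rfl <;> rcases hj with rfl | rfl
  · exact Or.inl rfl
  · exact Or.inr rfl
  · exact Or.inr (pairExp_comm _ _)
  · have := h3 rfl
    simp [htu.symm] at this

/-- If u < v < w, then v², uv and uw lie between u² and vw, hence are multiples of u²; this makes v
a multiple of u for the multiplication, and vw a multiple of u². If v < u, then v² = 0, so P and Q
vanish at v. Then either u < w and uv = 0 gives R v = 0, or w < u and w², a multiple of vw, gives P
w = 0. In both cases vw = 0, although vw is standard. -/
lemma false_of_standard_pair {π : MvPolynomial (Fin n) K →ₗ[K] K × K}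
    {b : Module.Basis (Fin n) K (Fin n → K)} {m : MonomialOrder (Fin n)}
    (hπ : ∀ v, v ∈ V ↔ v.IsHomogeneous 2 ∧ π v = 0) {P Q R : Fin n → K}
    (hμ : ∀ i j, π (coordChange b (monomial (pairExp i j) 1)) =
      (P i * P j, Q i * Q j + P i * R j + R i * P j)) {u v w : Fin n} (hu : P u ≠ 0)
    (hstd : IsStandard m b V (pairExp v w))
    (honly : ∀ s, IsStandard m b V s → s = pairExp u u ∨ s = pairExp v w)
    (huv : u ≠ v) (huw : u ≠ w)
    (hvw : m.toSyn (Finsupp.single v 1) < m.toSyn (Finsupp.single w 1)) : False := by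
  have hne : ∀ {i j : Fin n}, i ≠ j → m.toSyn (Finsupp.single i 1) ≠ m.toSyn (Finsupp.single j 1) :=
    fun hij h => hij ((Finsupp.single_left_inj one_ne_zero).mp (m.toSyn.injective h))
  -- reductions of products of coordinates
  have hred : ∀ i j, m.toSyn (pairExp i j) ≠ m.toSyn (pairExp u u) →
      m.toSyn (pairExp i j) ≠ m.toSyn (pairExp v w) → ∀ T : Set (Fin n →₀ ℕ),
      (m.toSyn (pairExp u u) < m.toSyn (pairExp i j) → pairExp u u ∈ T) →
      (m.toSyn (pairExp v w) < m.toSyn (pairExp i j) → pairExp v w ∈ T) →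
      π (coordChange b (monomial (pairExp i j) 1)) ∈
        Submodule.span K ((fun e' => π (coordChange b (monomial e' 1))) '' T) := by
    intro i j h1 h2 T hT1 hT2
    have hn : ¬ IsStandard m b V (pairExp i j) := fun h => by
      rcases honly _ h with h | h
      · exact h1 (by rw [h])
      · exact h2 (by rw [h])
    refine Submodule.span_mono (Set.image_mono ?_) (mem_span_standard_lt hπ (degree_pairExp i j) hn)
    rintro s ⟨hs, hlt⟩
    rcases honly s hs with rfl | rfl
    · exact hT1 hlt
    · exact hT2 hlt
  have hred0 : ∀ i j, m.toSyn (pairExp i j) < m.toSyn (pairExp u u) →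
      m.toSyn (pairExp i j) < m.toSyn (pairExp v w) →
      P i * P j = 0 ∧ Q i * Q j + P i * R j + R i * P j = 0 := by
    intro i j h1 h2
    have := hred i j h1.ne h2.ne ∅ (fun h => absurd h h1.not_gt) (fun h => absurd h h2.not_gt)
    rw [Set.image_empty, Submodule.span_empty, Submodule.mem_bot, hμ, Prod.mk_eq_zero] at this
    exact this
  have hred1 : ∀ i j, m.toSyn (pairExp u u) < m.toSyn (pairExp i j) →
      m.toSyn (pairExp i j) < m.toSyn (pairExp v w) → ∃ α, P i * P j = α * (P u * P u) ∧
      Q i * Q j + P i * R j + R i * P j = α * (Q u * Q u + P u * R u + R u * P u) := by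
    intro i j h1 h2
    have := hred i j h1.ne' h2.ne {pairExp u u} (fun _ => rfl) (fun h => absurd h h2.not_gt)
    rw [Set.image_singleton, Submodule.mem_span_singleton, hμ, hμ] at this
    obtain ⟨α, hα⟩ := this
    exact ⟨α, (congrArg Prod.fst hα).symm, (congrArg Prod.snd hα).symm⟩
  have hstd0 : ¬ (P v * P w = 0 ∧ Q v * Q w + P v * R w + R v * P w = 0) := by
    intro h
    have := hstd.notMem_span hπ (T := ∅) (by simp)
    rw [Set.image_empty, Submodule.span_empty, Submodule.mem_bot, hμ, Prod.mk_eq_zero] at this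
    exact this h
  simp only [toSyn_pairExp] at hred0 hred1
  rcases lt_or_gt_of_ne (hne huv) with h | h
  · obtain ⟨α, h1, h2⟩ := hred1 v v (add_lt_add h h) (add_lt_add_of_le_of_lt le_rfl hvw)
    obtain ⟨β, h3, h4⟩ := hred1 u v (add_lt_add_of_le_of_lt le_rfl h) (add_lt_add h hvw)
    obtain ⟨δ, h5, h6⟩ := hred1 u w (add_lt_add_of_le_of_lt le_rfl (h.trans hvw))
      (add_lt_add_of_lt_of_le h le_rfl)
    have h7 := mem_span_of_smaller hu h1 h2 h3 h4 h5 h6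
    refine hstd.notMem_span hπ (T := {pairExp u u}) ?_ ?_
    · rintro _ rfl
      refine ⟨degree_pairExp _ _, ?_⟩
      rw [toSyn_pairExp, toSyn_pairExp]
      exact add_lt_add h (h.trans hvw)
    · rw [Set.image_singleton, Submodule.mem_span_singleton, hμ, hμ]
      exact ⟨β * δ, Prod.ext h7.1.symm h7.2.symm⟩
  · obtain ⟨h1, h2⟩ := hred0 v v (add_lt_add h h) (add_lt_add_of_le_of_lt le_rfl hvw)
    have pv : P v = 0 := mul_self_eq_zero.mp h1
    have qv : Q v = 0 := by
      rw [pv] at h2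
      exact mul_self_eq_zero.mp (by linear_combination h2)
    rcases lt_or_gt_of_ne (hne huw) with h' | h'
    · obtain ⟨-, h4⟩ := hred0 u v (add_lt_add_of_le_of_lt le_rfl h)
        (by rw [add_comm]; exact add_lt_add_of_le_of_lt le_rfl h')
      have rv : R v = 0 := by
        rw [pv, qv] at h4
        exact (mul_eq_zero.mp (show P u * R v = 0 by linear_combination h4)).resolve_left hu
      exact hstd0 (by simp [pv, qv, rv])
    · have hww := hred w w
        (by rw [toSyn_pairExp, toSyn_pairExp]; exact (add_lt_add h' h').ne)
        (by rw [toSyn_pairExp, toSyn_pairExp]; exact (add_lt_add_of_lt_of_le hvw le_rfl).ne')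
        {pairExp v w}
        (fun hlt => by
          rw [toSyn_pairExp, toSyn_pairExp] at hlt
          exact absurd hlt (add_lt_add h' h').not_gt)
        (fun _ => rfl)
      rw [Set.image_singleton, Submodule.mem_span_singleton, hμ, hμ] at hww
      obtain ⟨α, hα⟩ := hww
      have h5 : α * (P v * P w) = P w * P w := congrArg Prod.fst hα
      have pw : P w = 0 := by
        rw [pv, zero_mul, mul_zero] at h5
        exact mul_self_eq_zero.mp h5.symm
      exact hstd0 (by simp [pv, qv, pw])

/-- Exceptional spaces do not define G-quadratic algebras. -/
theorem not_isGQuadratic_of_isExceptional (hexc : IsExceptional V) :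
    ¬ IsGQuadratic (idealOfQuadrics V) := by
  classical
  obtain ⟨f, g, p, q, r, x, y, z, hV, hf, hg, hp, hq, hr⟩ := hexc.exists_functionals
  have hcubic := linForm_mul_mul_sub_mem hV hf hg hp hq hr
  have hVle : V ≤ homogeneousSubmodule (Fin n) K 2 := fun v hv => ((hV v).mp hv).1
  rintro ⟨ℓ, hℓ, m, B, hB2, hB⟩
  obtain ⟨b, rfl⟩ := hℓ.exists_basis
  rw [comap_idealOfQuadrics] at hB
  have hBV : B ⊆ inCoords b V := by
    intro h hh
    have := (component_of_mem_idealOfQuadrics (inCoords_le hVle) (hB.1 hh)).2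
    rwa [homogeneousComponent_eq_self (hB2 h hh)] at this
  have hlead : ∀ F ∈ idealOfQuadrics (inCoords b V), F ≠ 0 →
      ∃ h ∈ inCoords b V, h ≠ 0 ∧ m.degree h ≤ m.degree F := by
    intro F hF hF0
    obtain ⟨h, hh, hh0, hle⟩ := hB.exists_degree_le hF hF0
    exact ⟨h, hBV hh, hh0, hle⟩
  -- the products of coordinates modulo `V`
  have hπ : ∀ v, v ∈ V ↔ v.IsHomogeneous 2 ∧ f.prod g v = 0 := by
    intro v
    rw [hV, LinearMap.prod_apply, Prod.ext_iff]
    exact Iff.rfl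
  set μ : (Fin n →₀ ℕ) → K × K := fun e => f.prod g (coordChange b (monomial e 1)) with hμdef
  set P : Fin n → K := fun i => p (b i) with hP
  set Q : Fin n → K := fun i => q (b i) with hQ
  set R : Fin n → K := fun i => r (b i) with hR
  have hμ : ∀ i j, μ (pairExp i j) = (P i * P j, Q i * Q j + P i * R j + R i * P j) := by
    intro i j
    rw [hμdef]
    simp only [pairExp, coordChange_monomial]
    exact Prod.ext (hf _ _) (hg _ _)
  have hE : Module.finrank K (K × K) = 2 := by simp
  -- the smallest coordinate that does not vanish at the point
  obtain ⟨u, huP, humin⟩ : ∃ u, P u ≠ 0 ∧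
      ∀ k, P k ≠ 0 → m.toSyn (Finsupp.single u 1) ≤ m.toSyn (Finsupp.single k 1) := by
    have hne : (Finset.univ.filter fun i => P i ≠ 0).Nonempty := by
      by_contra hcon
      rw [Finset.not_nonempty_iff_eq_empty, Finset.filter_eq_empty_iff] at hcon
      have h0 : p = 0 := b.ext fun i => by
        simpa [hP] using hcon (Finset.mem_univ i)
      have := hp.2.2
      rw [h0] at this
      simp at this
    obtain ⟨u, hu, hmin⟩ := Finset.exists_min_image _
      (fun i => m.toSyn (Finsupp.single i 1)) hne
    exact ⟨u, (Finset.mem_filter.mp hu).2,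
      fun k hk => hmin k (Finset.mem_filter.mpr ⟨Finset.mem_univ _, hk⟩)⟩
  -- By minimality of u, every smaller product has a factor on which p vanishes, so f kills it; but
  -- f does not kill u².
  have huu : IsStandard m b V (pairExp u u) := by
    refine ⟨degree_pairExp _ _, fun hcon => ?_⟩
    have hmem := (exists_degree_eq_iff hπ b m (degree_pairExp u u)).mp hcon
    have hle : Submodule.span K ((fun e' => f.prod g (coordChange b (monomial e' 1))) ''
        {e' | e'.degree = 2 ∧ m.toSyn e' < m.toSyn (pairExp u u)}) ≤
        LinearMap.ker (LinearMap.fst K K K) := by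
      rw [Submodule.span_le]
      rintro _ ⟨e', ⟨he', hlt⟩, rfl⟩
      obtain ⟨k, l, rfl⟩ := Finsupp.exists_eq_single_add_single he'
      change (μ (pairExp k l)).1 = 0
      rw [hμ]
      by_contra hne
      have h1 := humin k (left_ne_zero_of_mul hne)
      have h2 := humin l (right_ne_zero_of_mul hne)
      rw [toSyn_pairExp, map_add] at hlt
      exact absurd (add_le_add h1 h2) (not_le.mpr hlt)
    have h0 : (μ (pairExp u u)).1 = 0 := hle hmem
    rw [hμ] at h0
    exact mul_ne_zero huP huP h0
  -- another standard exponent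
  obtain ⟨e, he, heu⟩ : ∃ e, IsStandard m b V e ∧ e ≠ pairExp u u := by
    by_contra hcon
    push Not at hcon
    have hline : ∀ i j, μ (pairExp i j) ∈ Submodule.span K {μ (pairExp u u)} := by
      intro i j
      have := mem_span_standard_le (m := m) (b := b) hπ (pairExp i j) (degree_pairExp i j)
      refine Submodule.span_mono ?_ this
      rintro _ ⟨s, ⟨hs, -⟩, rfl⟩
      rw [hcon s hs]
      rfl
    set G := (μ (pairExp u u)).2
    -- With a single standard monomial the two forms would be proportional, but at (y, y) f vanishes
    -- and g does not.
    have hprop : (P u * P u) • mulForm g = G • mulForm f := by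
      refine LinearMap.ext_basis b b fun i j => ?_
      obtain ⟨c, hc⟩ := Submodule.mem_span_singleton.mp (hline i j)
      have h1 : mulForm f (b i) (b j) = c * (P u * P u) := by
        have := congrArg Prod.fst hc
        rw [hμ, hμ] at this
        rw [hf]; exact this.symm
      have h2 : mulForm g (b i) (b j) = c * G := by
        have := congrArg Prod.snd hc
        rw [hμ i j] at this
        rw [hg]; exact this.symm
      simp only [LinearMap.smul_apply, smul_eq_mul, h1, h2]
      ring
    have h3 := DFunLike.congr_fun (DFunLike.congr_fun hprop y) y
    simp only [LinearMap.smul_apply, smul_eq_mul, hf, hg, hp.2.1, hq.2.1, hr.2.1] at h3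
    simp [huP] at h3
  have honly : ∀ s, IsStandard m b V s → s = pairExp u u ∨ s = e := by
    intro s hs
    by_contra hcon
    push Not at hcon
    have n1 : m.toSyn s ≠ m.toSyn (pairExp u u) := fun h => hcon.1 (m.toSyn.injective h)
    have n2 : m.toSyn s ≠ m.toSyn e := fun h => hcon.2 (m.toSyn.injective h)
    have n3 : m.toSyn e ≠ m.toSyn (pairExp u u) := fun h => heu (m.toSyn.injective h)
    rcases lt_or_gt_of_ne n1 with h1 | h1 <;> rcases lt_or_gt_of_ne n2 with h2 | h2 <;>
      rcases lt_or_gt_of_ne n3 with h3 | h3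
    · exact not_three_standard hπ hE hs he huu h2 h3
    · exact not_three_standard hπ hE hs huu he h1 h3
    · exact not_three_standard hπ hE he hs huu h2 h1
    · exact lt_asymm h3 (h2.trans h1)
    · exact lt_asymm h3 (h1.trans h2)
    · exact not_three_standard hπ hE huu hs he h1 h2
    · exact not_three_standard hπ hE he huu hs h3 h1
    · exact not_three_standard hπ hE huu he hs h3 h2
  -- there are no relations between standard cubic monomials
  have hcub : ∀ i j k i' j' k' : Fin n,
      pairExp i j + Finsupp.single k 1 ≠ pairExp i' j' + Finsupp.single k' 1 →
      P i * P j * P k ≠ 0 →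
      ∃ h ∈ inCoords b V, h ≠ 0 ∧ (m.degree h ≤ pairExp i j + Finsupp.single k 1 ∨
        m.degree h ≤ pairExp i' j' + Finsupp.single k' 1) := by
    intro i j k i' j' k' hne hPne
    set e₁ := pairExp i j + Finsupp.single k 1
    set e₂ := pairExp i' j' + Finsupp.single k' 1
    have hmon : ∀ i j k, coordChange b (monomial (pairExp i j + Finsupp.single k 1) 1) =
        linForm (b i) * linForm (b j) * linForm (b k) := by
      intro i j k
      rw [← one_mul (1 : K), ← monomial_mul, map_mul, pairExp, coordChange_monomial]
      exact congrArg _ (coordChange_X b k)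
    -- Modulo the ideal a cubic monomial is its product of values of P times z³, so this combination
    -- cancels. Its leading exponent is one of the two exponents and has to be a multiple of a
    -- leading exponent of V.
    set F : MvPolynomial (Fin n) K :=
      monomial e₁ (P i' * P j' * P k') - monomial e₂ (P i * P j * P k) with hF
    have hFmem : F ∈ idealOfQuadrics (inCoords b V) := by
      rw [← comap_idealOfQuadrics, Ideal.mem_comap, ← coordChange_apply]
      have e1 : monomial e₁ (P i' * P j' * P k') = (P i' * P j' * P k') • monomial e₁ (1 : K) := by
        rw [smul_monomial, smul_eq_mul, mul_one]
      have e2 : monomial e₂ (P i * P j * P k) = (P i * P j * P k) • monomial e₂ (1 : K) := by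
        rw [smul_monomial, smul_eq_mul, mul_one]
      rw [hF, map_sub, e1, e2, map_smul, map_smul, hmon, hmon]
      have h1 := Ideal.mul_mem_left _ (C (P i' * P j' * P k')) (hcubic (b i) (b j) (b k))
      have h2 := Ideal.mul_mem_left _ (C (P i * P j * P k)) (hcubic (b i') (b j') (b k'))
      have h3 := Ideal.sub_mem _ h1 h2
      simp only [smul_eq_C_mul] at h3 ⊢
      convert h3 using 1
      ring
    have hF0 : F ≠ 0 := by
      intro h0
      have : coeff e₂ F = 0 := by rw [h0, coeff_zero]
      rw [hF, coeff_sub, coeff_monomial, coeff_monomial, if_neg hne, if_pos rfl, zero_sub,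
        neg_eq_zero] at this
      exact hPne this
    obtain ⟨h, hh, hh0, hle⟩ := hlead F hFmem hF0
    refine ⟨h, hh, hh0, ?_⟩
    rcases Finset.mem_union.mp (support_sub _ _ _ (m.degree_mem_support hF0)) with h1 | h1
    · rw [Finset.mem_singleton.mp (support_monomial_subset h1)] at hle
      exact Or.inl hle
    · rw [Finset.mem_singleton.mp (support_monomial_subset h1)] at hle
      exact Or.inr hle
  have hdeg : ∀ h ∈ inCoords b V, h ≠ 0 → ∃ i j, m.degree h = pairExp i j := by
    intro h hh hh0
    have hmem := m.degree_mem_support hh0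
    have h2 : (m.degree h).degree = 2 := by
      by_contra hne
      exact mem_support_iff.mp hmem ((inCoords_le hVle hh).coeff_eq_zero hne)
    exact Finsupp.exists_eq_single_add_single h2
  obtain ⟨v, w, rfl⟩ : ∃ v w, e = pairExp v w := Finsupp.exists_eq_single_add_single he.1
  have hnot : ∀ h ∈ inCoords b V, h ≠ 0 → m.degree h ≠ pairExp u u ∧ m.degree h ≠ pairExp v w :=
    fun h hh hh0 => ⟨fun hd => huu.2 ⟨h, hh, hh0, hd⟩, fun hd => he.2 ⟨h, hh, hh0, hd⟩⟩
  -- the second standard exponent does not involve `u`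
  have hA : ∀ t, t ≠ u → pairExp v w ≠ pairExp u t := by
    intro t htu heq
    -- If ut were standard, u³ and u²t would have only standard quadratic divisors.
    have hne3 : pairExp u u + Finsupp.single u 1 ≠ pairExp u u + Finsupp.single t 1 := by
      intro h
      have := DFunLike.congr_fun h t
      simp [htu.symm] at this
    obtain ⟨h, hh, hh0, hle⟩ := hcub u u u u u t hne3 (mul_ne_zero (mul_ne_zero huP huP) huP)
    obtain ⟨i, j, hij⟩ := hdeg h hh hh0
    have hn := hnot h hh hh0
    rw [hij] at hle hn
    rw [heq] at hn
    have key : pairExp i j = pairExp u u ∨ pairExp i j = pairExp u t := by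
      rcases hle with hle | hle
      · exact Or.inl (eq_of_pairExp_le_cube hle)
      · exact eq_of_pairExp_le_square_add htu hle
    exact key.elim hn.1 hn.2
  have hvu : v ≠ u := by
    rintro rfl
    by_cases hw : w = v
    · exact heu (by rw [hw])
    · exact hA w hw rfl
  have hwu : w ≠ u := by
    rintro rfl
    exact hA v hvu (pairExp_comm _ _)
  have hvw : v ≠ w := by
    rintro rfl
    -- If v² were standard, the same would hold for u³ and v³.
    have hne3 : pairExp u u + Finsupp.single u 1 ≠ pairExp v v + Finsupp.single v 1 := by
      intro h
      have := DFunLike.congr_fun h u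
      simp [pairExp, hvu] at this
    obtain ⟨h, hh, hh0, hle⟩ := hcub u u u v v v hne3 (mul_ne_zero (mul_ne_zero huP huP) huP)
    obtain ⟨i, j, hij⟩ := hdeg h hh hh0
    have hn := hnot h hh hh0
    rw [hij] at hle hn
    rcases hle with hle | hle
    · exact hn.1 (eq_of_pairExp_le_cube hle)
    · exact hn.2 (eq_of_pairExp_le_cube hle)
  rcases lt_or_gt_of_ne (fun h => hvw ((Finsupp.single_left_inj one_ne_zero).mp
    (m.toSyn.injective h)) : m.toSyn (Finsupp.single v 1) ≠ m.toSyn (Finsupp.single w 1)) with h | h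
  · exact false_of_standard_pair hπ hμ huP he honly hvu.symm hwu.symm h
  · rw [pairExp_comm v w] at he
    simp only [pairExp_comm v w] at honly
    exact false_of_standard_pair hπ hμ huP he honly hwu.symm hvu.symm h

end NotGQuadratic

/-! ### Elimination theory -/

section Elimination

variable {K : Type*} [Field K] {n : ℕ}

lemma MvPolynomial.IsHomogeneous.eval_smul {σ : Type*} {P : MvPolynomial σ K} {k : ℕ}
    (hP : P.IsHomogeneous k) (t : K) (a : σ → K) : eval (t • a) P = t ^ k * eval a P := by
  rw [eval_eq, eval_eq, Finset.mul_sum]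
  refine Finset.sum_congr rfl fun e he => ?_
  have h : e.degree = k := by
    by_contra h
    exact mem_support_iff.mp he (hP.coeff_eq_zero h)
  simp only [Pi.smul_apply, smul_eq_mul, mul_pow, Finset.prod_mul_distrib, Finset.prod_pow_eq_pow_sum]
  rw [← h, Finsupp.degree_apply]
  ring

/-- A polynomial that vanishes on the line through `a`, except possibly at the origin, has
homogeneous components that vanish at `a`. -/
lemma eval_homogeneousComponent_eq_zero [Infinite K] {σ : Type*} {P : MvPolynomial σ K}
    {a : σ → K} (h : ∀ t : K, t ≠ 0 → eval (t • a) P = 0) (k : ℕ) :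
    eval a (homogeneousComponent k P) = 0 := by
  let p : Polynomial K := ∑ i ∈ Finset.range (P.totalDegree + 1),
    Polynomial.monomial i (eval a (homogeneousComponent i P))
  have hp : p = 0 := by
    refine Polynomial.eq_zero_of_infinite_isRoot p
      ((Set.infinite_of_finite_compl (s := {(0 : K)}ᶜ) (by simp)).mono fun t ht => ?_)
    have h1 := h t ht
    rw [← sum_homogeneousComponent P, map_sum] at h1
    rw [Set.mem_ofPred_eq, Polynomial.IsRoot, Polynomial.eval_finsetSum, ← h1]
    refine Finset.sum_congr rfl fun i _ => ?_
    rw [(homogeneousComponent_isHomogeneous i P).eval_smul, Polynomial.eval_monomial, mul_comm]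
  by_cases hk : k ∈ Finset.range (P.totalDegree + 1)
  · have h2 : p.coeff k = 0 := by rw [hp, Polynomial.coeff_zero]
    rw [Polynomial.finsetSum_coeff, Finset.sum_eq_single_of_mem k hk fun i _ hi => by
      rw [Polynomial.coeff_monomial, if_neg hi]] at h2
    rwa [Polynomial.coeff_monomial, if_pos rfl] at h2
  · rw [homogeneousComponent_eq_zero k P (by simpa using hk), map_zero]

lemma eval_homogeneousComponent (P : MvPolynomial (Fin n) K) (a : Fin n → K) (k : ℕ) :
    eval a (homogeneousComponent k P) =
      ∑ e : {e : Fin n →₀ ℕ // e.degree = k}, coeff e.1 P * ∏ i, a i ^ e.1 i := by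
  classical
  have h : homogeneousComponent k P =
      ∑ e : {e : Fin n →₀ ℕ // e.degree = k}, monomial e.1 (coeff e.1 P) := by
    ext e
    simp only [coeff_sum, coeff_monomial, coeff_homogeneousComponent]
    split_ifs with he
    · rw [Finset.sum_eq_single ⟨e, he⟩ (fun x _ hx => if_neg fun h => hx (Subtype.ext h)) (by simp),
        if_pos rfl]
    · exact (Finset.sum_eq_zero fun x _ => if_neg fun h : x.1 = e => he (h ▸ x.2)).symm
  rw [h, map_sum]
  refine Finset.sum_congr rfl fun e _ => ?_
  rw [eval_monomial, Finsupp.prod_fintype _ _ fun _ => pow_zero _]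

/-- The main theorem of elimination theory, for cones: if a system of polynomials has only the
trivial zero at the parameter `s₀`, then at all parameters outside a hypersurface that avoids `s₀`
no line through the origin consists of zeros. -/
theorem exists_eval_ne_zero_of_forall_eq_zero [IsAlgClosed K] {τ : Type*}
    (G : Set (MvPolynomial (Fin n) (MvPolynomial τ K))) (s₀ : τ → K)
    (h₀ : ∀ a, (∀ g ∈ G, eval a (map (eval s₀) g) = 0) → a = 0) :
    ∃ F : MvPolynomial τ K, eval s₀ F ≠ 0 ∧ ∀ s, eval s F ≠ 0 →
      ∀ a, (∀ t : K, t ≠ 0 → ∀ g ∈ G, eval (t • a) (map (eval s) g) = 0) → a = 0 := by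
  classical
  have : Infinite K := IsAlgClosed.instInfinite
  set I := (Ideal.span G).map (map (eval s₀)) with hI
  have hrad : idealOfVars (Fin n) K ≤ I.radical := by
    rw [← vanishingIdeal_zeroLocus_eq_radical (K := K), idealOfVars, Ideal.span_le]
    rintro _ ⟨i, rfl⟩ a ha
    have h1 : a = 0 := h₀ a fun g hg => by
      rw [← coe_aeval_eq_eval]
      exact ha _ (Ideal.mem_map_of_mem _ (Ideal.subset_span hg))
    simp [h1]
  obtain ⟨k, hk⟩ := Ideal.exists_pow_le_of_le_radical_of_fg hrad (idealOfVars_fg _ _)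
  have hsurj : Function.Surjective (map (σ := Fin n) (eval s₀)) :=
    map_surjective _ fun r => ⟨C r, eval_C r⟩
  -- By the Nullstellensatz, all monomials of some degree k lie in the ideal at s₀; they are lifted
  -- to elements of the ideal with indeterminate parameters.
  have hlift : ∀ e : {e : Fin n →₀ ℕ // e.degree = k}, ∃ P ∈ Ideal.span G,
      map (eval s₀) P = monomial e.1 1 := fun e =>
    (Ideal.mem_map_iff_of_surjective _ hsurj).mp
      (hk ((monomial_mem_pow_idealOfVars_iff k e.1 one_ne_zero).mpr e.2.ge))
  choose P hP hP₀ using hlift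
  -- The degree k coefficients of the lifts. The matrix specializes to the identity at s₀. Where it
  -- is invertible, a line of zeros through a kills the degree k parts of all lifts at a, hence all
  -- monomials of degree k in a.
  let M : Matrix {e : Fin n →₀ ℕ // e.degree = k} {e : Fin n →₀ ℕ // e.degree = k}
    (MvPolynomial τ K) := Matrix.of fun e e' => coeff e'.1 (P e)
  refine ⟨M.det, ?_, fun s hs a ha => ?_⟩
  · have h1 : (eval s₀).mapMatrix M = 1 := by
      ext e e'
      simp only [RingHom.mapMatrix_apply, Matrix.map_apply, M, Matrix.of_apply]
      rw [← coeff_map, hP₀, coeff_monomial, Matrix.one_apply]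
      simp only [Subtype.ext_iff]
    rw [RingHom.map_det, h1, Matrix.det_one]
    exact one_ne_zero
  · rw [RingHom.map_det] at hs
    have hvan : ∀ e, ∀ t : K, t ≠ 0 → eval (t • a) (map (eval s) (P e)) = 0 := by
      intro e t ht
      have hle : Ideal.span G ≤ RingHom.ker ((eval (t • a)).comp (map (eval s))) :=
        Ideal.span_le.mpr fun g hg => ha t ht g hg
      exact hle (hP e)
    have hmul : ((eval s).mapMatrix M).mulVec (fun e => ∏ i, a i ^ e.1 i) = 0 := by
      ext e
      have := eval_homogeneousComponent_eq_zero (hvan e) k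
      rw [eval_homogeneousComponent] at this
      simpa [Matrix.mulVec, dotProduct, M, coeff_map] using this
    have hz := Matrix.eq_zero_of_mulVec_eq_zero hs hmul
    ext i
    have := congr_fun hz ⟨Finsupp.single i k, by simp⟩
    simp only [Pi.zero_apply] at this
    rw [Finset.prod_eq_single i (fun j _ hj => by simp [hj.symm]) (by simp)] at this
    simpa using eq_zero_of_pow_eq_zero this

end Elimination

/-! ### Open subsets of the Grassmannian -/

section Grassmannian

variable {K : Type*} [Field K] {n d c : ℕ}

lemma span_range_mem_spacesOfQuadrics {q : Fin d → MvPolynomial (Fin n) K}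
    (hq : ∀ i, (q i).IsHomogeneous 2) (hli : LinearIndependent K q) :
    Submodule.span K (Set.range q) ∈ spacesOfQuadrics K n d :=
  ⟨Submodule.span_le.mpr (Set.range_subset_iff.mpr hq), by
    rw [finrank_span_eq_card hli, Fintype.card_fin]⟩

lemma exists_eq_span_range {V : Submodule K (MvPolynomial (Fin n) K)}
    (hV : V ∈ spacesOfQuadrics K n d) :
    ∃ q : Fin d → MvPolynomial (Fin n) K, (∀ i, (q i).IsHomogeneous 2) ∧ LinearIndependent K q ∧
      V = Submodule.span K (Set.range q) := by
  have : Module.Finite K V := Submodule.finiteDimensional_of_le hV.1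
  let b := Module.finBasisOfFinrankEq K V hV.2
  refine ⟨fun i => b i, fun i => hV.1 (b i).2,
    b.linearIndependent.map' V.subtype V.ker_subtype, ?_⟩
  have := congr_arg (Submodule.map V.subtype) b.span_eq
  rw [Submodule.map_top, Submodule.range_subtype, Submodule.map_span, ← Set.range_comp] at this
  exact this.symm

/-- The spaces of quadrics that have a basis at which a given polynomial in the coefficients
does not vanish form an open subset of the Grassmannian. -/
lemma isZariskiOpen_of_eval_ne_zero
    (F : MvPolynomial (Fin d × {e : Fin n →₀ ℕ // e.degree = 2}) K) :
    IsZariskiOpen d {V | ∃ q : Fin d → MvPolynomial (Fin n) K, (∀ i, (q i).IsHomogeneous 2) ∧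
      LinearIndependent K q ∧ V = Submodule.span K (Set.range q) ∧
        eval (fun p => coeff p.2.1 (q p.1)) F ≠ 0} := by
  -- F depends on the basis; the family of all its transforms under invertible changes of basis `g`
  -- depends only on the span.
  refine ⟨?_, (fun g : Fin d → Fin d → K =>
    bind₁ (fun p : Fin d × {e : Fin n →₀ ℕ // e.degree = 2} => ∑ j, C (g p.1 j) * X (j, p.2)) F) ''
      {g | LinearIndependent K g}, fun q hq hli => ?_⟩
  · rintro _ ⟨q, hq, hli, rfl, -⟩
    exact span_range_mem_spacesOfQuadrics hq hli
  have heval : ∀ g : Fin d → Fin d → K,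
      eval (fun p => coeff p.2.1 (q p.1)) (bind₁ (fun p : Fin d × {e : Fin n →₀ ℕ // e.degree = 2} =>
        ∑ j, C (g p.1 j) * X (j, p.2)) F) =
      eval (fun p => coeff p.2.1 (Fintype.linearCombination K q (g p.1))) F := by
    intro g
    rw [← coe_aeval_eq_eval, RingHom.coe_coe, aeval_bind₁, ← coe_aeval_eq_eval, RingHom.coe_coe]
    congr 2
    ext p
    simp [coeff_sum, Fintype.linearCombination_apply]
  constructor
  · rintro ⟨q', hq', hli', hspan, hne⟩
    have hmem : ∀ i, ∃ g : Fin d → K, Fintype.linearCombination K q g = q' i := fun i => by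
      rw [← LinearMap.mem_range, Fintype.range_linearCombination, hspan]
      exact Submodule.subset_span ⟨i, rfl⟩
    choose g hg using hmem
    refine ⟨_, ⟨g, LinearIndependent.of_comp (Fintype.linearCombination K q) ?_, rfl⟩, ?_⟩
    · exact (funext hg : Fintype.linearCombination K q ∘ g = q') ▸ hli'
    · rw [heval]
      simpa only [hg] using hne
  · rintro ⟨_, ⟨g, hg, rfl⟩, hne⟩
    rw [heval] at hne
    have hker : LinearMap.ker (Fintype.linearCombination K q) = ⊥ :=
      LinearMap.ker_eq_bot.mpr (linearIndependent_iff_injective_fintypeLinearCombination.mp hli)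
    have hspan : Submodule.span K (Set.range q) =
        Submodule.span K (Set.range (Fintype.linearCombination K q ∘ g)) := by
      rw [Set.range_comp, ← Submodule.map_span, hg.span_eq_top_of_card_eq_finrank' (by simp),
        Submodule.map_top, Fintype.range_linearCombination]
    refine ⟨_, fun i => ?_, hg.map' _ hker, hspan, hne⟩
    have : (Fintype.linearCombination K q ∘ g) i ∈ homogeneousSubmodule (Fin n) K 2 :=
      (span_range_mem_spacesOfQuadrics hq hli).1 (hspan ▸ Submodule.subset_span ⟨i, rfl⟩)
    exact this

end Grassmannian

/-! ### Openness of the condition on isotropic linear forms -/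

section Generic

variable {K : Type*} [Field K] {n d c : ℕ} {V : Submodule K (MvPolynomial (Fin n) K)}
  {π : MvPolynomial (Fin n) K →ₗ[K] (Fin c → K)}

/-- Quadrics complete a basis of `V` to a basis of all quadrics if and only if their values under
the functionals that define `V` are independent. -/
lemma det_coeff_ne_zero_iff (hπ : ∀ v, v ∈ V ↔ v.IsHomogeneous 2 ∧ π v = 0)
    (σ : Fin d ⊕ Fin c ≃ {e : Fin n →₀ ℕ // e.degree = 2})
    {q : Fin d → MvPolynomial (Fin n) K} (hli : LinearIndependent K q)
    (hV : V = Submodule.span K (Set.range q)) {w : Fin c → MvPolynomial (Fin n) K}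
    (hw : ∀ k, (w k).IsHomogeneous 2) :
    (Matrix.of fun i j => coeff (σ j).1 (Sum.elim q w i)).det ≠ 0 ↔
      LinearIndependent K (fun k => π (w k)) := by
  have hq : ∀ i, q i ∈ V := fun i => hV ▸ Submodule.subset_span ⟨i, rfl⟩
  let v : Fin d ⊕ Fin c → homogeneousSubmodule (Fin n) K 2 :=
    Sum.elim (fun i => ⟨q i, ((hπ _).mp (hq i)).1⟩) (fun k => ⟨w k, hw k⟩)
  let Φ := quadricEquiv.trans (LinearEquiv.funCongrLeft K K σ)
  have h1 : (Matrix.of fun i j => coeff (σ j).1 (Sum.elim q w i)).row = Φ ∘ v := by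
    ext i j
    cases i <;> rfl
  have h2 : (homogeneousSubmodule (Fin n) K 2).subtype ∘ v = Sum.elim q w := by
    ext1 i
    cases i <;> rfl
  rw [← isUnit_iff_ne_zero, ← Matrix.isUnit_iff_isUnit_det,
    ← Matrix.linearIndependent_rows_iff_isUnit, h1]
  erw [LinearMap.linearIndependent_iff Φ.toLinearMap Φ.ker]
  rw [← LinearMap.linearIndependent_iff _ (Submodule.ker_subtype _), h2]
  have hspan : ∀ x ∈ Submodule.span K (Set.range w), π x = 0 → x ∈ V := fun x hx h0 =>
    (hπ x).mpr ⟨(Submodule.span_le.mpr (Set.range_subset_iff.mpr hw) :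
      _ ≤ homogeneousSubmodule (Fin n) K 2) hx, h0⟩
  rw [linearIndependent_sum, Sum.elim_comp_inl, Sum.elim_comp_inr, ← hV]
  constructor
  · rintro ⟨-, hlw, hdis⟩
    refine hlw.map (f := π) (Submodule.disjoint_def.mpr fun x hx h0 => ?_)
    exact Submodule.disjoint_def.mp hdis x (hspan x hx h0) hx
  · intro h
    have hlw : LinearIndependent K w := LinearIndependent.of_comp π h
    refine ⟨hli, hlw, Submodule.disjoint_def.mpr fun x hx hxw => ?_⟩
    obtain ⟨g, rfl⟩ := (Submodule.mem_span_range_iff_exists_fun K).mp hxw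
    have h0 := ((hπ _).mp hx).2
    simp only [map_sum, map_smul] at h0
    have := Fintype.linearIndependent_iff.mp h g h0
    simp [this]

/-- The determinant of `d` quadrics with indeterminate coefficients, and of `c` quadrics whose
coefficients are polynomials in a vector. -/
noncomputable def completionDet (σ : Fin d ⊕ Fin c ≃ {e : Fin n →₀ ℕ // e.degree = 2})
    (W : Fin c → MvPolynomial (Fin n) (MvPolynomial (Fin n) K)) :
    MvPolynomial (Fin n) (MvPolynomial (Fin d × {e : Fin n →₀ ℕ // e.degree = 2}) K) :=
  (Matrix.of fun i j => Sum.elim (fun i => C (X (i, σ j)))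
    (fun k => map C (coeff (σ j).1 (W k))) i).det

lemma eval_completionDet (σ : Fin d ⊕ Fin c ≃ {e : Fin n →₀ ℕ // e.degree = 2})
    (W : Fin c → MvPolynomial (Fin n) (MvPolynomial (Fin n) K)) (q : Fin d → MvPolynomial (Fin n) K)
    (a : Fin n → K) :
    eval a (map (eval fun p => coeff p.2.1 (q p.1)) (completionDet σ W)) =
      (Matrix.of fun i j => coeff (σ j).1 (Sum.elim q (fun k => map (eval a) (W k)) i)).det := by
  rw [completionDet, RingHom.map_det, RingHom.map_det]
  congr 1
  ext i j
  cases i with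
  | inl i => simp
  | inr k =>
    have h : (eval fun p : Fin d × {e : Fin n →₀ ℕ // e.degree = 2} => coeff p.2.1 (q p.1)).comp C =
      RingHom.id K := RingHom.ext fun r => eval_C r
    simp [map_map, h, coeff_map]

variable (K n) in
/-- The linear form with indeterminate coefficients. -/
noncomputable def genericForm : MvPolynomial (Fin n) (MvPolynomial (Fin n) K) :=
  ∑ j, C (X j) * X j

lemma map_eval_genericForm (a : Fin n → K) : map (eval a) (genericForm K n) = linForm a := by
  simp [genericForm, linForm_apply, smul_eq_C_mul]

lemma map_eval_map_C (a : Fin n → K) (p : MvPolynomial (Fin n) K) :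
    map (eval a) (map C p) = p := by
  have h : (eval a).comp C = RingHom.id K := RingHom.ext fun r => eval_C r
  rw [map_map, h, map_id]

/-- If one space of quadrics of codimension `c` has the property that every isotropic linear form
generates the degree two part, then this holds on an open set. -/
theorem exists_isZariskiOpen_isGQuadratic [IsAlgClosed K] (hd : d + c = (n + 1).choose 2)
    (hc : c < n) (hπ : ∀ v, v ∈ V ↔ v.IsHomogeneous 2 ∧ π v = 0)
    (hs : ∀ y, ∃ q, q.IsHomogeneous 2 ∧ π q = y) (hV : V ∈ spacesOfQuadrics K n d)
    (hgen : ∀ a, a ≠ 0 → mulForm π a a = 0 → ∀ y, ∃ u, mulForm π a u = y) :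
    ∃ U : Set (Submodule K (MvPolynomial (Fin n) K)), IsZariskiOpen d U ∧ U.Nonempty ∧
      ∀ V ∈ U, IsGQuadratic (idealOfQuadrics V) := by
  classical
  let σ : Fin d ⊕ Fin c ≃ {e : Fin n →₀ ℕ // e.degree = 2} :=
    Fintype.equivOfCardEq (by simp [card_exponents_two, hd])
  obtain ⟨q₀, hq₀, hli₀, hV₀⟩ := exists_eq_span_range hV
  -- Two ways to complete V to all quadrics: by a² and fixed quadrics, possible only if a² is
  -- nonzero in R_2, or by c multiples of a, possible exactly if aR_1 = R_2. All determinants vanish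
  -- at a when a² = 0 and aR_1 ≠ R_2.
  let 𝒲 : Set (Fin c → MvPolynomial (Fin n) (MvPolynomial (Fin n) K)) :=
    {W | (∃ (k : Fin c) (y : Fin c → MvPolynomial (Fin n) K), (∀ i, (y i).IsHomogeneous 2) ∧
      W = Function.update (fun i => map C (y i)) k (genericForm K n * genericForm K n)) ∨
      ∃ u : Fin c → Fin n → K, W = fun i => genericForm K n * map C (linForm (u i))}
  have h𝒲 : ∀ W ∈ 𝒲, ∀ a k, (map (eval a) (W k)).IsHomogeneous 2 := by
    rintro _ (⟨k, y, hy, rfl⟩ | ⟨u, rfl⟩) a i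
    · by_cases hik : i = k
      · subst hik
        rw [Function.update_self, map_mul, map_eval_genericForm]
        exact isHomogeneous_linForm_mul a a
      · rw [Function.update_of_ne hik, map_eval_map_C]
        exact hy i
    · rw [map_mul, map_eval_genericForm, map_eval_map_C]
      exact isHomogeneous_linForm_mul a (u i)
  obtain ⟨F, hF₀, hF⟩ := exists_eval_ne_zero_of_forall_eq_zero (completionDet σ '' 𝒲)
    (fun p => coeff p.2.1 (q₀ p.1)) (fun a ha => by
      by_contra ha0
      have hdep : ∀ W ∈ 𝒲, ¬ LinearIndependent K fun k => π (map (eval a) (W k)) := by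
        intro W hW hli
        refine (det_coeff_ne_zero_iff hπ σ hli₀ hV₀ (h𝒲 W hW a)).mpr hli ?_
        rw [← eval_completionDet]
        exact ha _ ⟨W, hW, rfl⟩
      by_cases haa : mulForm π a a = 0
      · choose u hu using hgen a ha0 haa
        refine hdep _ (Or.inr ⟨fun i => u (Pi.single i 1), rfl⟩) ?_
        simp only [map_mul, map_eval_genericForm, map_eval_map_C, ← mulForm_apply, hu]
        exact Pi.linearIndependent_single_one _ _
      · obtain ⟨hk, b, hb⟩ := exists_basis_extending ![mulForm π a a]
          (LinearIndependent.of_subsingleton 0 haa)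
        choose y hy hπy using fun i => hs (b i)
        refine hdep _ (Or.inl ⟨Fin.castLE hk 0, y, hy, rfl⟩) ?_
        convert b.linearIndependent using 2 with i
        by_cases hik : i = Fin.castLE hk 0
        · subst hik
          rw [Function.update_self, map_mul, map_eval_genericForm, ← mulForm_apply, hb]
          rfl
        · rw [Function.update_of_ne hik, map_eval_map_C, hπy])
  refine ⟨_, isZariskiOpen_of_eval_ne_zero F, ⟨V, q₀, hq₀, hli₀, hV₀, hF₀⟩, ?_⟩
  rintro V' ⟨q, hq, hli, hV', hne⟩
  obtain ⟨π', hπ', -⟩ := exists_functionals hd (hV' ▸ span_range_mem_spacesOfQuadrics hq hli)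
  obtain ⟨a, ha0, ha⟩ := exists_isotropic hc fun i =>
    mulForm (LinearMap.proj i ∘ₗ π')
  have haa : mulForm π' a a = 0 := funext fun i => ha i
  refine isGQuadratic_of_generator hπ' ha0 haa fun x y => ?_
  by_contra! hcon
  -- If a did not generate R_2, neither would its multiples, so the whole line through a would
  -- consist of zeros of the determinants.
  refine ha0 (hF _ hne a ?_)
  rintro t ht _ ⟨W, hW, rfl⟩
  rw [eval_completionDet]
  by_contra hdet
  have hind := (det_coeff_ne_zero_iff hπ' σ hli hV' (h𝒲 W hW _)).mp hdet
  rcases hW with ⟨k, z, hz, rfl⟩ | ⟨u, rfl⟩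
  · apply hind.ne_zero k
    rw [Function.update_self, map_mul, map_eval_genericForm, ← mulForm_apply, map_smul, map_smul,
      LinearMap.smul_apply, haa, smul_zero, smul_zero]
  · simp only [map_mul, map_eval_genericForm, map_eval_map_C, ← mulForm_apply] at hind
    have htop := hind.span_eq_top_of_card_eq_finrank' (by simp)
    have hle : Submodule.span K (Set.range fun k => mulForm π' (t • a) (u k)) ≤
        LinearMap.range (mulForm π' a) := Submodule.span_le.mpr (by
      rintro _ ⟨k, rfl⟩
      exact ⟨t • u k, by simp⟩)
    rw [htop] at hle
    obtain ⟨u', hu'⟩ := hle (Submodule.mem_top (x := mulForm π' x y))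
    exact hcon u' hu'.symm

end Generic

/-! ### A space given by diagonal forms -/

section Moments

variable {K : Type*} [Field K] {n c : ℕ} {α : Fin n → K}

/-- Weighted power sums at distinct nodes determine the pairing with polynomials. -/
lemma sum_mul_eval_eq_zero {a : Fin n → K} (h : ∀ i : Fin c, ∑ j, α j ^ (i : ℕ) * a j = 0)
    (p : Polynomial K) (hp : p.natDegree < c) : ∑ j, p.eval (α j) * a j = 0 := by
  simp only [Polynomial.eval_eq_sum_range' hp, Finset.sum_mul]
  rw [Finset.sum_comm]
  refine Finset.sum_eq_zero fun i hi => ?_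
  simp only [mul_assoc, ← Finset.mul_sum]
  rw [h ⟨i, Finset.mem_range.mp hi⟩, mul_zero]

/-- A nonzero vector whose first `c` power sums at distinct nodes vanish has more than `c` nonzero
entries. -/
lemma lt_card_of_sum_pow_eq_zero [DecidableEq K] (hα : Function.Injective α) {a : Fin n → K}
    (ha : a ≠ 0) (h : ∀ i : Fin c, ∑ j, α j ^ (i : ℕ) * a j = 0) :
    c < (Finset.univ.filter fun j => a j ≠ 0).card := by
  by_contra! hcard
  obtain ⟨j₀, hj₀⟩ := Function.ne_iff.mp ha
  set J := Finset.univ.filter fun j => a j ≠ 0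
  have hj₀J : j₀ ∈ J := Finset.mem_filter.mpr ⟨Finset.mem_univ _, hj₀⟩
  -- With at most c nonzero entries this polynomial has degree below c, and pairing it with a
  -- isolates the entry at j₀.
  let p : Polynomial K := ∏ j ∈ J.erase j₀, (Polynomial.X - Polynomial.C (α j))
  have hp : p.natDegree < c := by
    rw [Polynomial.natDegree_finsetProd_X_sub_C_eq_card, Finset.card_erase_of_mem hj₀J]
    have := Finset.card_pos.mpr ⟨j₀, hj₀J⟩
    omega
  have h0 := sum_mul_eval_eq_zero h p hp
  rw [Finset.sum_eq_single j₀ (fun j _ hj => ?_) (by simp)] at h0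
  · refine mul_ne_zero ?_ hj₀ h0
    rw [Polynomial.eval_prod, Finset.prod_ne_zero_iff]
    intro j hj
    rw [Polynomial.eval_sub, Polynomial.eval_X, Polynomial.eval_C, sub_ne_zero]
    exact fun he => (Finset.mem_erase.mp hj).1 (hα he).symm
  · by_cases haj : a j = 0
    · rw [haj, mul_zero]
    · rw [Polynomial.eval_prod, Finset.prod_eq_zero (Finset.mem_erase.mpr
        ⟨hj, Finset.mem_filter.mpr ⟨Finset.mem_univ _, haj⟩⟩) (by simp), zero_mul]

/-- The linear map that sends `b` to the first `c` weighted power sums of `a b`. -/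
noncomputable def momentMap (c : ℕ) (α : Fin n → K) :
    MvPolynomial (Fin n) K →ₗ[K] (Fin c → K) :=
  LinearMap.pi fun i => ∑ j, α j ^ (i : ℕ) • lcoeff K (Finsupp.single j 2)

lemma mulForm_momentMap (a b : Fin n → K) (i : Fin c) :
    mulForm (momentMap c α) a b i = ∑ j, α j ^ (i : ℕ) * (a j * b j) := by
  simp only [mulForm_apply, momentMap, LinearMap.pi_apply, LinearMap.sum_apply,
    LinearMap.smul_apply, smul_eq_mul]
  refine Finset.sum_congr rfl fun j _ => ?_
  rw [← mulForm_lcoeff_single, mulForm_apply]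

/-- A functional that kills the image is a polynomial of degree below c which vanishes at every node
α_j with a_j ≠ 0. There are at least c such nodes, so it is zero. -/
lemma exists_mulForm_momentMap_eq [DecidableEq K] (hα : Function.Injective α) {a : Fin n → K}
    (ha : c ≤ (Finset.univ.filter fun j => a j ≠ 0).card) (y : Fin c → K) :
    ∃ b, mulForm (momentMap c α) a b = y := by
  by_contra hcon
  have hlt : LinearMap.range (mulForm (momentMap c α) a) < ⊤ :=
    lt_top_iff_ne_top.mpr fun htop => hcon (htop.ge (Submodule.mem_top (x := y)))
  obtain ⟨f, hf0, hf⟩ := Submodule.exists_le_ker_of_lt_top _ hlt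
  let p : Polynomial K := ∑ i : Fin c, Polynomial.monomial (i : ℕ) (f (Pi.single i 1))
  have hfp : ∀ v, f v = ∑ i, v i * f (Pi.single i 1) := fun v => by
    conv_lhs => rw [pi_eq_sum_univ' v, map_sum]
    simp
  have heval : ∀ j, a j ≠ 0 → p.eval (α j) = 0 := by
    intro j hj
    have h0 : f (mulForm (momentMap c α) a (Pi.single j 1)) = 0 := hf ⟨_, rfl⟩
    rw [hfp] at h0
    simp only [mulForm_momentMap, Pi.single_apply, mul_ite, mul_one, mul_zero, Finset.sum_ite_eq',
      Finset.mem_univ, if_true] at h0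
    refine (mul_eq_zero.mp ?_).resolve_left hj
    rw [← h0, Polynomial.eval_finsetSum, Finset.mul_sum]
    refine Finset.sum_congr rfl fun i _ => ?_
    rw [Polynomial.eval_monomial]
    ring
  apply hf0
  rcases Nat.eq_zero_or_pos c with rfl | hc
  · exact Subsingleton.elim _ _
  have hdeg : p.natDegree < c := by
    refine lt_of_le_of_lt (Polynomial.natDegree_sum_le_of_forall_le _ _ (n := c - 1)
      fun i _ => (Polynomial.natDegree_monomial_le _).trans (by omega)) (by omega)
  have hp0 : p = 0 := by
    refine Polynomial.eq_zero_of_natDegree_lt_card_of_eval_eq_zero' p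
      ((Finset.univ.filter fun j => a j ≠ 0).image α) ?_ ?_
    · intro x hx
      obtain ⟨j, hj, rfl⟩ := Finset.mem_image.mp hx
      exact heval j (Finset.mem_filter.mp hj).2
    · rw [Finset.card_image_of_injective _ hα]
      omega
  ext i
  have hco : p.coeff i = 0 := by rw [hp0, Polynomial.coeff_zero]
  rw [Polynomial.finsetSum_coeff, Finset.sum_eq_single i (fun k _ hk => by
    rw [Polynomial.coeff_monomial, if_neg fun h => hk (Fin.ext h)]) (by simp),
    Polynomial.coeff_monomial, if_pos rfl] at hco
  simpa using hco

/-- The kernel of `c` independent functionals on the quadrics has codimension `c`. -/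
lemma exists_mem_spacesOfQuadrics {d : ℕ} (hd : d + c = (n + 1).choose 2)
    {π : MvPolynomial (Fin n) K →ₗ[K] (Fin c → K)} (hs : ∀ y, ∃ q, q.IsHomogeneous 2 ∧ π q = y) :
    ∃ V ∈ spacesOfQuadrics K n d, ∀ v, v ∈ V ↔ v.IsHomogeneous 2 ∧ π v = 0 := by
  let π' := π.domRestrict (homogeneousSubmodule (Fin n) K 2)
  refine ⟨(LinearMap.ker π').map (Submodule.subtype _), ⟨Submodule.map_subtype_le _ _, ?_⟩,
    fun v => ?_⟩
  · have hr : LinearMap.range π' = ⊤ := LinearMap.range_eq_top.mpr fun y => by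
      obtain ⟨q, hq, rfl⟩ := hs y
      exact ⟨⟨q, hq⟩, rfl⟩
    have := π'.finrank_range_add_finrank_ker
    rw [hr, finrank_top, Module.finrank_fin_fun, finrank_quadrics] at this
    rw [Submodule.finrank_map_subtype_eq]
    omega
  · constructor
    · rintro ⟨w, hw, rfl⟩
      exact ⟨w.2, hw⟩
    · rintro ⟨hv, h0⟩
      exact ⟨⟨v, hv⟩, h0, rfl⟩

end Moments

/-! ### The two statements -/

theorem exists_isZariskiOpen_of_codim_lt (K : Type*) [Field K] [IsAlgClosed K] {n c d : ℕ}
    (hd : d + c = (n + 1).choose 2) (hc : c < n) :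
    ∃ U : Set (Submodule K (MvPolynomial (Fin n) K)), IsZariskiOpen d U ∧ U.Nonempty ∧
      ∀ V ∈ U, IsGQuadratic (idealOfQuadrics V) := by
  classical
  have : Infinite K := IsAlgClosed.instInfinite
  let α : Fin n → K := fun j => Infinite.natEmbedding K j
  have hα : Function.Injective α :=
    (Infinite.natEmbedding K).injective.comp Fin.val_injective
  have hs : ∀ y : Fin c → K, ∃ q, q.IsHomogeneous 2 ∧ momentMap c α q = y := fun y => by
    obtain ⟨b, hb⟩ := exists_mulForm_momentMap_eq (a := fun _ => 1) hα (by simpa using hc.le) y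
    exact ⟨_, isHomogeneous_linForm_mul _ _, hb⟩
  obtain ⟨V, hV, hπ⟩ := exists_mem_spacesOfQuadrics hd hs
  refine exists_isZariskiOpen_isGQuadratic hd hc hπ hs hV fun a ha haa =>
    exists_mulForm_momentMap_eq hα ?_
  -- That a is isotropic means that the first c power sums weighted by the squares a_j² vanish, so a
  -- has more than c nonzero entries and generates.
  have h := lt_card_of_sum_pow_eq_zero (c := c) hα (a := fun j => a j * a j)
    (fun h0 => ha (funext fun j => mul_self_eq_zero.mp (congr_fun h0 j)))
    fun i => by rw [← mulForm_momentMap, haa, Pi.zero_apply]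
  simpa using h.le

theorem mainTheorem8 (K : Type*) [Field K] [IsAlgClosed K] (n c d : ℕ)
    (hd : d + c = (n + 1).choose 2) :
    (c < n →
      ∃ U : Set (Submodule K (MvPolynomial (Fin n) K)), IsZariskiOpen d U ∧ U.Nonempty ∧
        ∀ V ∈ U, IsGQuadratic (idealOfQuadrics V)) ∧
    (c ≤ 2 →
      ∀ V ∈ spacesOfQuadrics K n d,
        (IsGQuadratic (idealOfQuadrics V) ↔ ¬ IsExceptional V)) := by
  refine ⟨exists_isZariskiOpen_of_codim_lt K hd, fun hc V hV =>
    ⟨fun hG hexc => not_isGQuadratic_of_isExceptional hexc hG, fun hexc => ?_⟩⟩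
  obtain ⟨π, hπ, hs⟩ := exists_functionals hd hV
  interval_cases c
  · exact isGQuadratic_of_codim_zero hπ
  · exact isGQuadratic_of_codim_one hπ hs
  · exact (isGQuadratic_or_isExceptional_of_codim_two hπ hs).resolve_right hexc
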